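/- **Setting.** Let $\mathfrak g$ be a finite-dimensional complex simple Lie algebra and let $q\in\mathbb R\setminus\{-1,0,1\}$. Let $U_q(\mathfrak g)$ be the Drinfeld–Jimbo algebra with coproduct $\Delta E_i=E_i\otimes K_i+1\otimes E_i$, $\Delta F_i=F_i\otimes 1+K_i^{-1}\otimes F_i$, $\Delta K_i=K_i\otimes K_i$ and compact real form $K_i^*=K_i$, $E_i^*=K_iF_i$, $F_i^*=E_iK_i^{-1}$. Let $A=\mathcal O_q(G)$ be the Hopf $*$-algebra of matrix coefficients of its finite-dimensional type-1 representations. A left $A$-comodule is a $U_q(\mathfrak g)$-module by $X\triangleright v=\langle S(X),v_{(-1)}\rangle v_{(0)}$. A *highest weight vector* is a $v\neq0$ with $E_i\triangleright v=0$ and $K_i\triangleright v=q_i^{\mu_i}v$ for some $\mu_i\in\mathbb Z$ and all $i$. For a left $A$-comodule $\mathcal Z$, write $\mathcal Z_{\mathrm{hw}}$ for its set of highest weight vectors. For $l\in\mathbb N_0$ and $x\in\mathbb C$ put $(l)_x=1+x+\dots+x^{l-1}$. A *compact matrix quantum group algebra* (CMQGA) is a finitely generated Hopf $*$-algebra with a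 Haar functional $\mathbf h$ satisfying $\mathbf h(a^*a)>0$ for all $a\neq 0$. A *CQH-Hermitian space* over $A$ consists of the following. * A surjective Hopf $*$-algebra map $\pi:A\to H$ between CMQGAs, with $A$ a domain. Put $B=A^{\mathrm{co}(H)}=\{b\in A:(\mathrm{id}\otimes\pi)\Delta b=b\otimes1\}$. * A differential $*$-calculus $(\Omega^\bullet,\mathrm d)$ over $B$ of total degree $2n$, covariant under the left $A$-coaction. With $B^+=B\cap\ker\varepsilon$, it satisfies $\Omega^\bullet B^+\subseteq B^+\Omega^\bullet$ and $\dim\Omega^\bullet/B^+\Omega^\bullet<\infty$. * A left $A$-comodule, $B$-bimodule and $*$-preserving isomorphism $\mathrm{vol}:\Omega^{2n}\to B$ such that $\int=\mathbf h\circ\mathrm{vol}$ is closed. * A covariant complex structure $\Omega^{(\bullet,\bullet)}$, with $\mathrm d=\partial+\bar\partial$. * A central, real, left-coinvariant form $\sigma\in\Omega^{(1,1)}$ such that $\sigma^{n-k}\wedge-:\Omega^k\to\Omega^{2n-k}$ is bijective for $0\le k<n$. The *Hodge map* $\ast_\sigma$ is the linear map with $\ast_\sigma(\sigma^j\omega)=(-1)^{k(k+1)/2}\,i^{a-b}\frac{j!}{(n-j-k)!}\,\sigma^{n-j-k}\omega$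 for $0\le j\le n-k$ and every primitive $\omega\in\Omega^{(a,b)}$, that is, $k=a+b\le n$ and $\sigma^{n-k+1}\omega=0$. The *metric* is $g(\omega,\nu)=\ast_\sigma(\ast_\sigma(\omega^*)\wedge\nu)$ for $\omega,\nu$ of equal degree, and $0$ for homogeneous forms of different degrees. It is required that $\mathrm{vol}=\ast_\sigma|_{\Omega^{2n}}$ and that, for every $\omega\ne0$, $g(\omega,\omega)$ is a non-zero finite sum $\sum_i\lambda_i b_i^*b_i$ with $\lambda_i>0$ and $b_i\in B$. Let $\bar\partial^\dagger$ be the adjoint of $\bar\partial$ with respect to the inner product $\langle\omega,\nu\rangle=\mathbf h(g(\omega,\nu))$, and put $\Delta_{\bar\partial}=(\bar\partial+\bar\partial^\dagger)^2$. The space is of *Gelfand type* if $\dim\mathrm{Hom}^A(V,\Omega^{(0,k)})\le1$ for every irreducible left $A$-comodule $V$ and every $k$. It is *self-conjugate* if every irreducible left $A$-subcomodule of $B$ is closed under $*$. **Theorem.** Let such a CQH-Hermitian space over $\mathcal O_q(G)$ be of Gelfand type. Let $z\in B_{\mathrm{hw}}$, let $k\in\mathbb N_0$, and let $\omega\in(\bar\partial\Omega^{(0,k)})_{\mathrm{hw}}$.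 1. For every $l\in\mathbb N_0$, the form $z^l\omega$ is an eigenvector of $\Delta_{\bar\partial}$. In particular it is non-zero. 2. There are unique scalars $A_{z,\omega},B_{z,\omega}\in\mathbb C$ with $\partial z\wedge\ast_\sigma\omega=A_{z,\omega}\,z\,\partial(\ast_\sigma\omega)$ and $\bar\partial z\wedge\bar\partial^\dagger\omega=B_{z,\omega}\,z\,\bar\partial\bar\partial^\dagger\omega$. If $\partial z\ne0$, there is a unique scalar $\lambda_z$ with $(\partial z)z=\lambda_z\,z\,\partial z$, and $\lambda_z\neq 0$. If $\bar\partial z\neq0$, there is a unique scalar $\zeta_z$ with $(\bar\partial z)z=\zeta_z\,z\,\bar\partial z$, and $\zeta_z\neq 0$. 3. Let $\mu_\omega$ be the eigenvalue of $\omega$, and let $\lambda_z,\zeta_z$ be any scalars satisfying the last two identities (so $\lambda_z$ is arbitrary if $\partial z=0$, and $\zeta_z$ is arbitrary if $\bar\partial z=0$). If $\lambda_z$ and $\zeta_z$ are not both equal to $-1$, then for all $l\in\mathbb N_0$ $$\Delta_{\bar\partial}(z^l\omega)=\big(A_{z,\omega}(l)_{\lambda_z}+1\big)\big(B_{z,\omega}(l)_{\zeta_z}+1\big)\,\mu_\omega\,z^l\omega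 .$$ 4. If moreover the space is self-conjugate, $\lambda_z$ is real and $\lambda_z\ne-1$, then $\zeta_z=\lambda_z^{-1}$ whenever $\bar\partial z\ne0$, and for all $l\in\mathbb N_0$ (with the convention $0^{-1}=0$) $$\Delta_{\bar\partial}(z^l\omega)=\big(A_{z,\omega}(l)_{\lambda_z}+1\big)\big(B_{z,\omega}(l)_{\lambda_z^{-1}}+1\big)\,\mu_\omega\,z^l\omega .$$ -/

import Mathlib

open scoped TensorProduct ComplexConjugate

namespace QuantumGroup

/-! ### Quantum integers and the quantum Serre polynomial -/

/-- The quantum integer `(m)_x = 1 + x + ⋯ + x ^ (m - 1)`. -/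
noncomputable def quantumInt (m : ℕ) (x : ℂ) : ℂ := ∑ k ∈ Finset.range m, x ^ k

/-- The symmetric quantum integer `[m]_x = x ^ (1 - m) + x ^ (3 - m) + ⋯ + x ^ (m - 1)`. -/
noncomputable def symQuantumInt (x : ℂ) (m : ℕ) : ℂ :=
  ∑ k ∈ Finset.range m, x ^ (2 * (k : ℤ) + 1 - m)

/-- The quantum factorial `[m]_x!`. -/
noncomputable def quantumFactorial (x : ℂ) (m : ℕ) : ℂ :=
  ∏ k ∈ Finset.range m, symQuantumInt x (k + 1)

/-- The quantum binomial coefficient `[n]_x! / ([r]_x! [n - r]_x!)`. -/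
noncomputable def quantumBinom (x : ℂ) (n r : ℕ) : ℂ :=
  quantumFactorial x n / (quantumFactorial x r * quantumFactorial x (n - r))

/-- The quantum Serre polynomial `∑_{r = 0}^N (-1)^r [N, r]_x X^{N - r} Y X^r`. -/
noncomputable def serre {R : Type*} [Ring R] [Algebra ℂ R] (x : ℂ) (N : ℕ) (X Y : R) : R :=
  ∑ r ∈ Finset.range (N + 1), ((-1) ^ r * quantumBinom x N r) • (X ^ (N - r) * Y * X ^ r)

/-- `x` is non-zero and no positive even power of `x` is `1`. -/
structure Generic (x : ℂ) : Prop where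
  ne_zero : x ≠ 0
  pow_ne_one : ∀ m : ℕ, 0 < m → x ^ (2 * m) ≠ 1

theorem Generic.sub_ne_zero {x : ℂ} (hx : Generic x) : x - x⁻¹ ≠ 0 := by
  intro h
  apply hx.pow_ne_one 1 one_pos
  have h0 := hx.ne_zero
  have : x = x⁻¹ := sub_eq_zero.mp h
  calc x ^ (2 * 1) = x * x := by ring
    _ = x * x⁻¹ := by rw [← this]
    _ = 1 := mul_inv_cancel₀ h0

theorem symQuantumInt_mul {x : ℂ} (hx : Generic x) (m : ℕ) :
    symQuantumInt x m * (x - x⁻¹) = x ^ (m : ℤ) - x ^ (-(m : ℤ)) := by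
  have h0 := hx.ne_zero
  have key : ∀ n : ℕ, (∑ k ∈ Finset.range n, x ^ (2 * (k : ℤ) + 1 - m)) * (x - x⁻¹)
      = x ^ (2 * (n : ℤ) - m) - x ^ (-(m : ℤ)) := by
    intro n
    induction n with
    | zero => simp
    | succ n ih =>
      rw [Finset.sum_range_succ, add_mul, ih]
      have e1 : x ^ (2 * (n : ℤ) + 1 - m) = x ^ (2 * (n : ℤ) - m) * x := by
        rw [← zpow_add_one₀ h0]; congr 1; ring
      have e2 : x ^ (2 * ((n + 1 : ℕ) : ℤ) - m) = x ^ (2 * (n : ℤ) - m) * x * x := by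
        rw [← zpow_add_one₀ h0, ← zpow_add_one₀ h0]; congr 1; push_cast; ring
      rw [e1, e2]
      field_simp
      ring
  have := key m
  rw [symQuantumInt, this]
  congr 2
  ring

theorem symQuantumInt_ne_zero {x : ℂ} (hx : Generic x) (m : ℕ) : symQuantumInt x (m + 1) ≠ 0 := by
  intro h
  have h1 := symQuantumInt_mul hx (m + 1)
  rw [h, zero_mul, eq_comm, sub_eq_zero, zpow_neg, zpow_natCast] at h1
  apply hx.pow_ne_one (m + 1) (Nat.succ_pos m)
  have h0 : x ^ (m + 1) ≠ 0 := pow_ne_zero _ hx.ne_zero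
  rw [two_mul, pow_add]
  nth_rewrite 1 [h1]
  exact inv_mul_cancel₀ h0

theorem quantumFactorial_ne_zero {x : ℂ} (hx : Generic x) (m : ℕ) : quantumFactorial x m ≠ 0 :=
  Finset.prod_ne_zero_iff.mpr fun k _ => symQuantumInt_ne_zero hx k

theorem symQuantumInt_add {x : ℂ} (hx : Generic x) (a b : ℕ) :
    symQuantumInt x (a + b) = x⁻¹ ^ b * symQuantumInt x a + x ^ a * symQuantumInt x b := by
  have h := hx.sub_ne_zero
  have h0 := hx.ne_zero
  apply mul_right_cancel₀ h
  rw [add_mul, mul_assoc, mul_assoc, symQuantumInt_mul hx, symQuantumInt_mul hx,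
    symQuantumInt_mul hx]
  push_cast
  simp only [zpow_neg, zpow_add₀ h0, zpow_natCast, inv_pow, neg_add]
  ring

theorem quantumFactorial_succ (x : ℂ) (m : ℕ) :
    quantumFactorial x (m + 1) = quantumFactorial x m * symQuantumInt x (m + 1) :=
  Finset.prod_range_succ _ _

theorem quantumBinom_zero {x : ℂ} (hx : Generic x) (n : ℕ) : quantumBinom x n 0 = 1 := by
  have h1 : quantumFactorial x 0 = 1 := by simp [quantumFactorial]
  simp [quantumBinom, h1, quantumFactorial_ne_zero hx n]

theorem quantumBinom_self {x : ℂ} (hx : Generic x) (n : ℕ) : quantumBinom x n n = 1 := by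
  have h1 : quantumFactorial x 0 = 1 := by simp [quantumFactorial]
  simp [quantumBinom, h1, quantumFactorial_ne_zero hx n]

theorem quantumBinom_succ {x : ℂ} (hx : Generic x) {n r : ℕ} (h : r < n) :
    quantumBinom x (n + 1) (r + 1) =
      x⁻¹ ^ (r + 1) * quantumBinom x n (r + 1) + x ^ (n - r) * quantumBinom x n r := by
  obtain ⟨c, rfl⟩ : ∃ c, n = r + 1 + c := ⟨n - (r + 1), by omega⟩
  have e1 : r + 1 + c + 1 - (r + 1) = c + 1 := by omega
  have e2 : r + 1 + c - (r + 1) = c := by omega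
  have e3 : r + 1 + c - r = c + 1 := by omega
  have f1 := quantumFactorial_ne_zero hx r
  have f2 := quantumFactorial_ne_zero hx c
  have f3 := symQuantumInt_ne_zero hx r
  have f4 := symQuantumInt_ne_zero hx c
  have hs : symQuantumInt x (r + 1 + c + 1)
      = x⁻¹ ^ (r + 1) * symQuantumInt x (c + 1) + x ^ (c + 1) * symQuantumInt x (r + 1) := by
    rw [← symQuantumInt_add hx]; congr 1; omega
  simp only [quantumBinom, e1, e2, e3, quantumFactorial_succ x (r + 1 + c),
    quantumFactorial_succ x r, quantumFactorial_succ x c, hs]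
  field_simp

/-- The chain `W₀ = Y`, `W_{m + 1} = X W_m - t x^{2m} W_m X`. -/
noncomputable def serreChain {R : Type*} [Ring R] [Algebra ℂ R] (x t : ℂ) (X Y : R) : ℕ → R
  | 0 => Y
  | m + 1 => X * serreChain x t X Y m - (t * x ^ (2 * m)) • (serreChain x t X Y m * X)

theorem serreChain_eq {R : Type*} [Ring R] [Algebra ℂ R] {x : ℂ} (hx : Generic x) (t : ℂ)
    (X Y : R) (m : ℕ) :
    serreChain x (t * x) X Y m = ∑ r ∈ Finset.range (m + 1),
      ((-1) ^ r * quantumBinom x m r * (t * x ^ m) ^ r) • (X ^ (m - r) * Y * X ^ r) := by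
  have h0 := hx.ne_zero
  induction m with
  | zero => simp [serreChain, quantumBinom_zero hx]
  | succ m ih =>
    rw [serreChain, ih]
    set f : ℕ → R := fun r =>
      ((-1) ^ r * quantumBinom x m r * (t * x ^ m) ^ r) • (X ^ (m - r) * Y * X ^ r)
    have hf1 : X * ∑ r ∈ Finset.range (m + 1), f r
        = (∑ r ∈ Finset.range m, X * f (r + 1)) + X * f 0 := by
      rw [Finset.mul_sum, Finset.sum_range_succ']
    have hf2 : (t * x * x ^ (2 * m)) • ((∑ r ∈ Finset.range (m + 1), f r) * X)
        = (∑ r ∈ Finset.range m, (t * x * x ^ (2 * m)) • (f r * X))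
          + (t * x * x ^ (2 * m)) • (f m * X) := by
      rw [Finset.sum_mul, Finset.smul_sum, Finset.sum_range_succ]
    rw [hf1, hf2, Finset.sum_range_succ' _ (m + 1), Finset.sum_range_succ _ m]
    simp only [f, quantumBinom_zero hx, quantumBinom_self hx, pow_zero, mul_one, one_smul,
      Nat.sub_zero, Nat.sub_self, one_mul]
    have key : ∀ r ∈ Finset.range m,
        ((-1) ^ (r + 1) * quantumBinom x (m + 1) (r + 1) * (t * x ^ (m + 1)) ^ (r + 1)) •
            (X ^ (m + 1 - (r + 1)) * Y * X ^ (r + 1))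
          = X * (((-1) ^ (r + 1) * quantumBinom x m (r + 1) * (t * x ^ m) ^ (r + 1)) •
              (X ^ (m - (r + 1)) * Y * X ^ (r + 1)))
            - (t * x * x ^ (2 * m)) • ((((-1) ^ r * quantumBinom x m r * (t * x ^ m) ^ r) •
              (X ^ (m - r) * Y * X ^ r)) * X) := by
      intro r hr
      have hr' : r < m := Finset.mem_range.mp hr
      obtain ⟨c, rfl⟩ : ∃ c, m = r + 1 + c := ⟨m - (r + 1), by omega⟩
      have e1 : r + 1 + c + 1 - (r + 1) = c + 1 := by omega
      have e2 : r + 1 + c - (r + 1) = c := by omega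
      have e3 : r + 1 + c - r = c + 1 := by omega
      rw [quantumBinom_succ hx hr', e1, e2, e3, mul_smul_comm, smul_mul_assoc, smul_smul,
        ← mul_assoc X, ← mul_assoc X, ← pow_succ' X c, mul_assoc _ (X ^ r) X, ← pow_succ X r,
        ← sub_smul]
      congr 1
      have : x⁻¹ ^ (r + 1) = (x ^ (r + 1))⁻¹ := inv_pow _ _
      rw [this]
      field_simp
      ring
    rw [Finset.sum_congr rfl key, Finset.sum_sub_distrib]
    have last : ((-1) ^ (m + 1) * (t * x ^ (m + 1)) ^ (m + 1)) • (Y * X ^ (m + 1))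
        = - ((t * x * x ^ (2 * m)) • (((-1) ^ m * (t * x ^ m) ^ m) • (Y * X ^ m) * X)) := by
      rw [smul_mul_assoc, smul_smul, mul_assoc Y, ← pow_succ, ← neg_smul]
      congr 1
      ring
    rw [last, ← mul_assoc X (X ^ m), ← pow_succ' X m]
    abel

theorem Generic.inv {x : ℂ} (hx : Generic x) : Generic x⁻¹ where
  ne_zero := inv_ne_zero hx.ne_zero
  pow_ne_one m hm h := hx.pow_ne_one m hm (by rw [inv_pow, inv_eq_one] at h; exact h)

theorem symQuantumInt_inv {x : ℂ} (hx : Generic x) (m : ℕ) :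
    symQuantumInt x⁻¹ m = symQuantumInt x m := by
  have h := hx.sub_ne_zero
  have h1 := symQuantumInt_mul hx m
  have h2 := symQuantumInt_mul hx.inv m
  apply mul_right_cancel₀ h
  rw [h1]
  rw [inv_inv] at h2
  have : symQuantumInt x⁻¹ m * (x - x⁻¹) = -(symQuantumInt x⁻¹ m * (x⁻¹ - x)) := by ring
  rw [this, h2]
  simp

theorem quantumBinom_inv {x : ℂ} (hx : Generic x) (n r : ℕ) :
    quantumBinom x⁻¹ n r = quantumBinom x n r := by
  simp [quantumBinom, quantumFactorial, symQuantumInt_inv hx]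

theorem serre_eq_chain {R : Type*} [Ring R] [Algebra ℂ R] {x : ℂ} (hx : Generic x) (N : ℕ)
    (X Y : R) : serre x N X Y = serreChain x (x⁻¹ ^ N * x) X Y N := by
  have h0 := hx.ne_zero
  rw [serreChain_eq hx, serre]
  refine Finset.sum_congr rfl fun r _ => ?_
  rw [← mul_pow, inv_mul_cancel₀ h0]
  simp

theorem serre_eq_chain' {R : Type*} [Ring R] [Algebra ℂ R] {x : ℂ} (hx : Generic x) (N : ℕ)
    (X Y : R) : serre x N X Y = serreChain x⁻¹ (x ^ N * x⁻¹) X Y N := by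
  have := serre_eq_chain hx.inv N X Y
  rw [inv_inv] at this
  rw [← this]
  simp [serre, quantumBinom_inv hx]

/-- Additivity of the quantum Serre polynomial on quasi-commuting pairs. -/
theorem serre_add {R : Type*} [Ring R] [Algebra ℂ R] {x : ℂ} (hx : Generic x) (N : ℕ)
    {u v u' v' : R} (h1 : u * v = (x ^ 2) • (v * u)) (h2 : u * v' = (x⁻¹ ^ N * x) • (v' * u))
    (h3 : u' * v = (x⁻¹ ^ N * x) • (v * u')) :
    serre x N (u + v) (u' + v') = serre x N u u' + serre x N v v' := by
  have h0 := hx.ne_zero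
  have hadd : ∀ Y Y' : R, serre x N (u + v) (Y + Y')
      = serre x N (u + v) Y + serre x N (u + v) Y' := by
    intro Y Y'
    simp [serre, mul_add, add_mul, Finset.sum_add_distrib]
  rw [hadd]
  congr 1
  · rw [serre_eq_chain' hx, serre_eq_chain' hx]
    have key : ∀ m, serreChain x⁻¹ (x ^ N * x⁻¹) (u + v) u' m
          = serreChain x⁻¹ (x ^ N * x⁻¹) u u' m ∧
        serreChain x⁻¹ (x ^ N * x⁻¹) u u' m * v
          = (x⁻¹ ^ N * x * x ^ (2 * m)) • (v * serreChain x⁻¹ (x ^ N * x⁻¹) u u' m) := by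
      intro m
      induction m with
      | zero => simpa [serreChain] using h3
      | succ m ih =>
        obtain ⟨ih1, ih2⟩ := ih
        simp only [serreChain]
        rw [ih1]
        set W := serreChain x⁻¹ (x ^ N * x⁻¹) u u' m
        constructor
        · rw [add_mul, mul_add W, ih2, smul_add, smul_smul]
          have : x ^ N * x⁻¹ * x⁻¹ ^ (2 * m) * (x⁻¹ ^ N * x * x ^ (2 * m)) = 1 := by
            rw [inv_pow, inv_pow]; field_simp
          rw [this, one_smul]
          abel
        · rw [sub_mul, smul_mul_assoc, mul_assoc u W v, ih2, mul_assoc W u v, h1, mul_smul_comm,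
            mul_smul_comm, ← mul_assoc u v W, h1, ← mul_assoc W v u, ih2, smul_mul_assoc,
            smul_mul_assoc, mul_sub, smul_sub, mul_smul_comm, mul_assoc v u W, mul_assoc v W u]
          simp only [smul_smul]
          congr 2 <;> ring
    exact (key N).1
  · rw [serre_eq_chain hx, serre_eq_chain hx]
    have key : ∀ m, serreChain x (x⁻¹ ^ N * x) (u + v) v' m
          = serreChain x (x⁻¹ ^ N * x) v v' m ∧
        u * serreChain x (x⁻¹ ^ N * x) v v' m
          = (x⁻¹ ^ N * x * x ^ (2 * m)) • (serreChain x (x⁻¹ ^ N * x) v v' m * u) := by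
      intro m
      induction m with
      | zero => simpa [serreChain] using h2
      | succ m ih =>
        obtain ⟨ih1, ih2⟩ := ih
        simp only [serreChain]
        rw [ih1]
        set W := serreChain x (x⁻¹ ^ N * x) v v' m
        constructor
        · rw [add_mul, mul_add W, ih2, smul_add]
          abel
        · rw [mul_sub, mul_smul_comm, ← mul_assoc u v W, h1, smul_mul_assoc, mul_assoc v u W, ih2,
            ← mul_assoc u W v, ih2, smul_mul_assoc, mul_assoc W u v, h1, mul_smul_comm,
            mul_smul_comm, sub_mul, smul_sub, smul_mul_assoc, ← mul_assoc v W u,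
            ← mul_assoc W v u]
          simp only [smul_smul]
          congr 2 <;> ring
    exact (key N).1

theorem quantumBinom_symm (x : ℂ) {n r : ℕ} (h : r ≤ n) :
    quantumBinom x n (n - r) = quantumBinom x n r := by
  rw [quantumBinom, quantumBinom, Nat.sub_sub_self h, mul_comm (quantumFactorial x r)]

/-- The quantum Serre polynomial in the opposite algebra. -/
theorem unop_serre {R : Type*} [Ring R] [Algebra ℂ R] (x : ℂ) (N : ℕ) (X Y : Rᵐᵒᵖ) :
    (serre x N X Y).unop = (-1 : ℂ) ^ N • serre x N X.unop Y.unop := by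
  rw [serre, serre, ← Finset.sum_range_reflect, Finset.smul_sum,
    ← MulOpposite.opAddEquiv_symm_apply, map_sum]
  refine Finset.sum_congr rfl fun r hr => ?_
  have hr' : r ≤ N := Nat.lt_succ_iff.mp (Finset.mem_range.mp hr)
  have e : N + 1 - 1 - r = N - r := by omega
  rw [e, Nat.sub_sub_self hr', quantumBinom_symm x hr', smul_smul]
  have : (-1 : ℂ) ^ (N - r) = (-1) ^ N * (-1) ^ r := by
    obtain ⟨c, rfl⟩ := Nat.exists_eq_add_of_le hr'
    rw [Nat.add_sub_cancel_left, pow_add]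
    have h : ((-1 : ℂ) ^ r) * (-1) ^ r = 1 := by rw [← mul_pow]; simp
    linear_combination (-(-1 : ℂ) ^ c) * h
  rw [this]
  simp [mul_assoc]

/-- Multiplying by quasi-central elements rescales the quantum Serre polynomial. -/
theorem serre_mul_quasi {R : Type*} [Ring R] [Algebra ℂ R] {x : ℂ} (hx : Generic x) (N : ℕ)
    {X Y k l : R} {y : ℂ} (hkl : k * l = l * k) (h1 : k * X = (y ^ 2) • (X * k))
    {s : ℂ} (h2 : k * Y = s • (Y * k)) (h3 : l * X = s • (X * l))
    (h : serre x N X Y = 0) : serre x N (X * k) (Y * l) = 0 := by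
  rw [serre_eq_chain hx] at h ⊢
  set t := x⁻¹ ^ N * x
  have key : ∀ m, ∃ c : ℂ, serreChain x t (X * k) (Y * l) m
        = c • (serreChain x t X Y m * (k ^ m * l)) ∧
      k * serreChain x t X Y m = (y ^ (2 * m) * s) • (serreChain x t X Y m * k) := by
    intro m
    induction m with
    | zero => exact ⟨1, by simp [serreChain], by simpa [serreChain] using h2⟩
    | succ m ih =>
      obtain ⟨c, ih1, ih2⟩ := ih
      simp only [serreChain]
      rw [ih1]
      set W := serreChain x t X Y m
      refine ⟨c * (y ^ (2 * m) * s), ?_, ?_⟩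
      · have hk : ∀ m : ℕ, k ^ m * X = y ^ (2 * m) • (X * k ^ m) := by
          intro m
          induction m with
          | zero => simp
          | succ m ih =>
            rw [pow_succ, mul_assoc, h1, mul_smul_comm, ← mul_assoc, ih, smul_mul_assoc, smul_smul,
              mul_assoc]
            congr 1
            ring
        have e1 : X * k * (W * (k ^ m * l)) = (y ^ (2 * m) * s) • (X * W * (k ^ (m + 1) * l)) := by
          rw [mul_assoc X k, ← mul_assoc k W, ih2, smul_mul_assoc, mul_smul_comm]
          congr 1
          rw [pow_succ']
          simp only [mul_assoc]
        have e2 : W * (k ^ m * l) * (X * k) = (y ^ (2 * m) * s) • (W * X * (k ^ (m + 1) * l)) := by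
          rw [mul_assoc W, mul_assoc (k ^ m), ← mul_assoc l X, h3, smul_mul_assoc, mul_smul_comm,
            mul_smul_comm, mul_assoc X l, ← mul_assoc (k ^ m) X, hk, smul_mul_assoc, mul_smul_comm,
            smul_smul, ← hkl, pow_succ, mul_comm s]
          simp only [mul_assoc]
        rw [mul_smul_comm, smul_mul_assoc, e1, e2, sub_mul, smul_sub, smul_mul_assoc]
        simp only [smul_smul]
        congr 2
        ring
      · rw [mul_sub, mul_smul_comm, ← mul_assoc k X, h1, smul_mul_assoc, mul_assoc X k, ih2,
          ← mul_assoc k W, ih2, smul_mul_assoc, mul_assoc W k X, h1, mul_smul_comm, mul_smul_comm,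
          sub_mul, smul_sub, smul_mul_assoc, mul_assoc X W k, mul_assoc W X k]
        simp only [smul_smul]
        congr 2 <;> ring
  obtain ⟨c, hc, -⟩ := key N
  rw [hc, h, zero_mul, smul_zero]

theorem serre_smul {R : Type*} [Ring R] [Algebra ℂ R] (x : ℂ) (N : ℕ) (a b : ℂ) (X Y : R) :
    serre x N (a • X) (b • Y) = (a ^ N * b) • serre x N X Y := by
  rw [serre, serre, Finset.smul_sum]
  refine Finset.sum_congr rfl fun r hr => ?_
  have hr' : r ≤ N := Nat.lt_succ_iff.mp (Finset.mem_range.mp hr)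
  obtain ⟨c, rfl⟩ := Nat.exists_eq_add_of_le hr'
  rw [Nat.add_sub_cancel_left]
  simp only [smul_pow, smul_mul_assoc, mul_smul_comm, smul_smul]
  congr 1
  ring

theorem serre_neg {R : Type*} [Ring R] [Algebra ℂ R] (x : ℂ) (N : ℕ) (X Y : R) :
    serre x N (-X) (-Y) = (-1 : ℂ) ^ (N + 1) • serre x N X Y := by
  simpa [pow_succ] using serre_smul x N (-1) (-1) X Y

theorem map_serre {R S : Type*} [Ring R] [Algebra ℂ R] [Ring S] [Algebra ℂ S] (f : R →ₐ[ℂ] S)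
    (x : ℂ) (N : ℕ) (X Y : R) : f (serre x N X Y) = serre x N (f X) (f Y) := by
  simp [serre]


/-! ### The Drinfeld--Jimbo quantised enveloping algebra -/

/-- A symmetrised Cartan matrix: `a i j = (αᵢ^∨, αⱼ)` and `d i = (αᵢ, αᵢ) / 2`. -/
structure CartanDatum (ι : Type*) where
  a : ι → ι → ℤ
  d : ι → ℕ
  a_self : ∀ i, a i i = 2
  a_nonpos : ∀ i j, i ≠ j → a i j ≤ 0
  d_pos : ∀ i, 0 < d i
  symm : ∀ i j, d i * a i j = d j * a j i

/-- A real deformation parameter `q ≠ -1, 0, 1`. -/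
structure Parameter where
  val : ℝ
  ne_neg_one : val ≠ -1
  ne_zero : val ≠ 0
  ne_one : val ≠ 1

variable {ι : Type*}

/-- `qᵢ = q ^ dᵢ`. -/
noncomputable def CartanDatum.qi (D : CartanDatum ι) (q : Parameter) (i : ι) : ℂ :=
  ((q.val ^ D.d i : ℝ) : ℂ)

theorem CartanDatum.generic (D : CartanDatum ι) (q : Parameter) (i : ι) : Generic (D.qi q i) where
  ne_zero := by simpa [qi] using fun h => absurd h q.ne_zero
  pow_ne_one m hm h := by
    have h1 : (q.val ^ D.d i) ^ (2 * m) = 1 := by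
      apply Complex.ofReal_injective
      simpa [qi] using h
    rw [← pow_mul] at h1
    have hne : D.d i * (2 * m) ≠ 0 := by have := D.d_pos i; positivity
    have h2 : |q.val| ^ (D.d i * (2 * m)) = 1 := by rw [← abs_pow, h1, abs_one]
    have h3 : |q.val| = 1 := (pow_eq_one_iff_of_nonneg (abs_nonneg _) hne).mp h2
    rcases (abs_eq zero_le_one).mp h3 with h | h
    · exact q.ne_one h
    · exact q.ne_neg_one h

theorem CartanDatum.qi_zpow_symm (D : CartanDatum ι) (q : Parameter) (i j : ι) :
    D.qi q i ^ D.a i j = D.qi q j ^ D.a j i := by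
  have h : ∀ i j, D.qi q i ^ D.a i j = (q.val : ℂ) ^ (D.d i * D.a i j) := by
    intro i j
    rw [qi, Complex.ofReal_pow, zpow_mul, zpow_natCast]
  rw [h, h, D.symm]

theorem CartanDatum.conj_qi (D : CartanDatum ι) (q : Parameter) (i : ι) :
    conj (D.qi q i) = D.qi q i := Complex.conj_ofReal _

/-- The exponent `1 - aᵢⱼ` of the quantum Serre relations. -/
def CartanDatum.serreExp (D : CartanDatum ι) (i j : ι) : ℕ := (1 - D.a i j).toNat

/-- `qᵢ^{aᵢⱼ}` expressed through the Serre exponent. -/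
theorem CartanDatum.qi_zpow (D : CartanDatum ι) (q : Parameter) {i j : ι} (h : i ≠ j) :
    D.qi q i ^ D.a i j = (D.qi q i)⁻¹ ^ D.serreExp i j * D.qi q i := by
  have h0 := (D.generic q i).ne_zero
  have h1 : ((D.serreExp i j : ℕ) : ℤ) = 1 - D.a i j :=
    Int.toNat_of_nonneg (by have := D.a_nonpos i j h; omega)
  rw [inv_pow, ← zpow_natCast, h1, ← zpow_neg, ← zpow_add_one₀ h0]
  congr 1; ring

theorem CartanDatum.qi_zpow_self (D : CartanDatum ι) (q : Parameter) (i : ι) :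
    D.qi q i ^ D.a i i = D.qi q i ^ 2 := by
  rw [D.a_self]; norm_cast

/-- The generators `Eᵢ, Fᵢ, Kᵢ, Kᵢ⁻¹`. -/
inductive Generator (ι : Type*) where
  | E (i : ι)
  | F (i : ι)
  | K (i : ι)
  | K' (i : ι)

section Relations

variable {R : Type*} [Ring R] [Algebra ℂ R]

/-- The defining relations of `U_q(𝔤)` for a family `g` of elements of an algebra. -/
structure Relations [DecidableEq ι] (D : CartanDatum ι) (q : Parameter) (g : Generator ι → R) :
    Prop where
  K_mul_K' : ∀ i, g (.K i) * g (.K' i) = 1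
  K'_mul_K : ∀ i, g (.K' i) * g (.K i) = 1
  K_mul_K : ∀ i j, g (.K i) * g (.K j) = g (.K j) * g (.K i)
  K_mul_E : ∀ i j, g (.K i) * g (.E j) = (D.qi q i ^ D.a i j) • (g (.E j) * g (.K i))
  K_mul_F : ∀ i j, g (.K i) * g (.F j) = (D.qi q i ^ (-D.a i j)) • (g (.F j) * g (.K i))
  E_mul_F : ∀ i j, g (.E i) * g (.F j) - g (.F j) * g (.E i) =
    if i = j then (D.qi q i - (D.qi q i)⁻¹)⁻¹ • (g (.K i) - g (.K' i)) else 0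
  serre_E : ∀ i j, i ≠ j → serre (D.qi q i) (D.serreExp i j) (g (.E i)) (g (.E j)) = 0
  serre_F : ∀ i j, i ≠ j → serre (D.qi q i) (D.serreExp i j) (g (.F i)) (g (.F j)) = 0

end Relations

/-- The pairs of elements of the free algebra that are identified in `U_q(𝔤)`. -/
inductive Rel [DecidableEq ι] (D : CartanDatum ι) (q : Parameter) :
    FreeAlgebra ℂ (Generator ι) → FreeAlgebra ℂ (Generator ι) → Prop
  | K_mul_K' (i) : Rel D q (.ι ℂ (.K i) * .ι ℂ (.K' i)) 1
  | K'_mul_K (i) : Rel D q (.ι ℂ (.K' i) * .ι ℂ (.K i)) 1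
  | K_mul_K (i j) : Rel D q (.ι ℂ (.K i) * .ι ℂ (.K j)) (.ι ℂ (.K j) * .ι ℂ (.K i))
  | K_mul_E (i j) : Rel D q (.ι ℂ (.K i) * .ι ℂ (.E j))
      ((D.qi q i ^ D.a i j) • (.ι ℂ (.E j) * .ι ℂ (.K i)))
  | K_mul_F (i j) : Rel D q (.ι ℂ (.K i) * .ι ℂ (.F j))
      ((D.qi q i ^ (-D.a i j)) • (.ι ℂ (.F j) * .ι ℂ (.K i)))
  | E_mul_F (i j) : Rel D q (.ι ℂ (.E i) * .ι ℂ (.F j) - .ι ℂ (.F j) * .ι ℂ (.E i))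
      (if i = j then (D.qi q i - (D.qi q i)⁻¹)⁻¹ • (.ι ℂ (.K i) - .ι ℂ (.K' i)) else 0)
  | serre_E (i j) (h : i ≠ j) :
      Rel D q (serre (D.qi q i) (D.serreExp i j) (.ι ℂ (.E i)) (.ι ℂ (.E j))) 0
  | serre_F (i j) (h : i ≠ j) :
      Rel D q (serre (D.qi q i) (D.serreExp i j) (.ι ℂ (.F i)) (.ι ℂ (.F j))) 0

/-- The quantised enveloping algebra `U_q(𝔤)`. -/
def Uq [DecidableEq ι] (D : CartanDatum ι) (q : Parameter) : Type _ := RingQuot (Rel D q)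

namespace Uq

variable [DecidableEq ι] (D : CartanDatum ι) (q : Parameter)

noncomputable instance : Ring (Uq D q) := inferInstanceAs (Ring (RingQuot (Rel D q)))

noncomputable instance : Algebra ℂ (Uq D q) := inferInstanceAs (Algebra ℂ (RingQuot (Rel D q)))

/-- The quotient map from the free algebra. -/
noncomputable def mk : FreeAlgebra ℂ (Generator ι) →ₐ[ℂ] Uq D q := RingQuot.mkAlgHom ℂ (Rel D q)

theorem mk_rel {x y : FreeAlgebra ℂ (Generator ι)} (h : Rel D q x y) : mk D q x = mk D q y :=
  RingQuot.mkAlgHom_rel ℂ h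

theorem mk_surjective : Function.Surjective (mk D q) := RingQuot.mkAlgHom_surjective ℂ (Rel D q)

/-- The generators of `U_q(𝔤)`. -/
noncomputable def gen (g : Generator ι) : Uq D q := mk D q (.ι ℂ g)

theorem relations : Relations D q (gen D q) := by
  constructor
  · intro i; simpa [gen] using mk_rel D q (.K_mul_K' i)
  · intro i; simpa [gen] using mk_rel D q (.K'_mul_K i)
  · intro i j; simpa [gen] using mk_rel D q (.K_mul_K i j)
  · intro i j; simpa [gen] using mk_rel D q (.K_mul_E i j)
  · intro i j; simpa [gen] using mk_rel D q (.K_mul_F i j)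
  · intro i j
    have := mk_rel D q (.E_mul_F i j)
    split_ifs at this ⊢ <;> simpa [gen] using this
  · intro i j h; simpa [gen, map_serre] using mk_rel D q (.serre_E i j h)
  · intro i j h; simpa [gen, map_serre] using mk_rel D q (.serre_F i j h)

variable {D q} {R : Type*} [Ring R] [Algebra ℂ R]

/-- The universal property of `U_q(𝔤)`. -/
noncomputable def lift {g : Generator ι → R} (h : Relations D q g) : Uq D q →ₐ[ℂ] R :=
  RingQuot.liftAlgHom ℂ ⟨FreeAlgebra.lift ℂ g, by
    intro x y hxy
    induction hxy with
    | K_mul_K' i => simpa using h.K_mul_K' i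
    | K'_mul_K i => simpa using h.K'_mul_K i
    | K_mul_K i j => simpa using h.K_mul_K i j
    | K_mul_E i j => simpa using h.K_mul_E i j
    | K_mul_F i j => simpa using h.K_mul_F i j
    | E_mul_F i j =>
      have := h.E_mul_F i j
      split_ifs at this ⊢ <;> simpa using this
    | serre_E i j hij => simpa [map_serre] using h.serre_E i j hij
    | serre_F i j hij => simpa [map_serre] using h.serre_F i j hij⟩

@[simp] theorem lift_gen {g : Generator ι → R} (h : Relations D q g) (x : Generator ι) :
    lift h (gen D q x) = g x := by
  simp only [lift, gen]
  exact (RingQuot.liftAlgHom_mkAlgHom_apply ℂ _ _ _).trans (by simp)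

theorem algHom_ext {f g : Uq D q →ₐ[ℂ] R} (h : ∀ x, f (gen D q x) = g (gen D q x)) : f = g := by
  apply RingQuot.ringQuot_ext' ℂ
  ext x
  exact h x

/-- Induction on the generators. -/
theorem induction {p : Uq D q → Prop} (hs : ∀ c : ℂ, p (algebraMap ℂ _ c))
    (hg : ∀ x, p (gen D q x)) (ha : ∀ x y, p x → p y → p (x + y))
    (hm : ∀ x y, p x → p y → p (x * y)) (x : Uq D q) : p x := by
  obtain ⟨y, rfl⟩ := mk_surjective D q x
  induction y using FreeAlgebra.induction with
  | grade0 c => simpa only [AlgHom.commutes] using hs c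
  | grade1 x => exact hg x
  | mul a b iha ihb => simpa only [map_mul] using hm _ _ iha ihb
  | add a b iha ihb => simpa only [map_add] using ha _ _ iha ihb

section Consequences

variable {g : Generator ι → R}

theorem _root_.QuantumGroup.Relations.K'_mul_K' (h : Relations D q g) (i j : ι) :
    g (.K' i) * g (.K' j) = g (.K' j) * g (.K' i) := by
  calc g (.K' i) * g (.K' j)
      = g (.K' i) * g (.K' j) * (g (.K i) * g (.K j) * (g (.K' j) * g (.K' i))) := by
        rw [mul_assoc (g (.K i)), ← mul_assoc (g (.K j)), h.K_mul_K', one_mul, h.K_mul_K', mul_one]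
    _ = g (.K' j) * g (.K' i) := by
        rw [h.K_mul_K i j, mul_assoc (g (.K' i)), ← mul_assoc (g (.K' j)), ← mul_assoc (g (.K' j)),
          h.K'_mul_K, one_mul, ← mul_assoc, h.K'_mul_K, one_mul]

theorem _root_.QuantumGroup.Relations.K_mul_K'_comm (h : Relations D q g) (i j : ι) :
    g (.K i) * g (.K' j) = g (.K' j) * g (.K i) := by
  calc g (.K i) * g (.K' j) = g (.K' j) * (g (.K j) * g (.K i)) * g (.K' j) := by
        rw [← mul_assoc, h.K'_mul_K, one_mul]
    _ = g (.K' j) * g (.K i) := by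
        rw [← h.K_mul_K, mul_assoc, mul_assoc, h.K_mul_K', mul_one]

/-- Inverting a quasi-commutation relation. -/
theorem _root_.QuantumGroup.Relations.K'_mul (h : Relations D q g) {i : ι} {X : R} {c : ℂ}
    (hc : c ≠ 0)
    (hX : g (.K i) * X = c • (X * g (.K i))) : g (.K' i) * X = c⁻¹ • (X * g (.K' i)) := by
  have h1 : X * g (.K' i) = c • (g (.K' i) * X) := by
    calc X * g (.K' i) = g (.K' i) * (g (.K i) * X) * g (.K' i) := by
          rw [← mul_assoc, h.K'_mul_K, one_mul]
      _ = c • (g (.K' i) * X) := by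
          rw [hX, mul_smul_comm, smul_mul_assoc, mul_assoc, mul_assoc X, h.K_mul_K', mul_one]
  rw [h1, smul_smul, inv_mul_cancel₀ hc, one_smul]

theorem _root_.QuantumGroup.Relations.K'_mul_E (h : Relations D q g) (i j : ι) :
    g (.K' i) * g (.E j) = (D.qi q i ^ (-D.a i j)) • (g (.E j) * g (.K' i)) := by
  rw [zpow_neg]
  exact h.K'_mul (zpow_ne_zero _ (D.generic q i).ne_zero) (h.K_mul_E i j)

theorem _root_.QuantumGroup.Relations.K'_mul_F (h : Relations D q g) (i j : ι) :
    g (.K' i) * g (.F j) = (D.qi q i ^ D.a i j) • (g (.F j) * g (.K' i)) := by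
  have := h.K'_mul (zpow_ne_zero _ (D.generic q i).ne_zero) (h.K_mul_F i j)
  rwa [← zpow_neg, neg_neg] at this

end Consequences

variable (D q)

/-- `Eᵢ`. -/
noncomputable abbrev E (i : ι) : Uq D q := gen D q (.E i)
/-- `Fᵢ`. -/
noncomputable abbrev F (i : ι) : Uq D q := gen D q (.F i)
/-- `Kᵢ`. -/
noncomputable abbrev K (i : ι) : Uq D q := gen D q (.K i)
/-- `Kᵢ⁻¹`. -/
noncomputable abbrev K' (i : ι) : Uq D q := gen D q (.K' i)

/-- The coproduct on generators. -/
noncomputable def comulGen : Generator ι → Uq D q ⊗[ℂ] Uq D q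
  | .E i => E D q i ⊗ₜ K D q i + 1 ⊗ₜ E D q i
  | .F i => F D q i ⊗ₜ 1 + K' D q i ⊗ₜ F D q i
  | .K i => K D q i ⊗ₜ K D q i
  | .K' i => K' D q i ⊗ₜ K' D q i

/-- The counit on generators. -/
def counitGen : Generator ι → ℂ
  | .E _ => 0
  | .F _ => 0
  | .K _ => 1
  | .K' _ => 1

/-- The antipode on generators. -/
noncomputable def antipodeGen : Generator ι → (Uq D q)ᵐᵒᵖ
  | .E i => .op (-(E D q i * K' D q i))
  | .F i => .op (-(K D q i * F D q i))
  | .K i => .op (K' D q i)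
  | .K' i => .op (K D q i)

theorem relations_comul : Relations D q (comulGen D q) := by
  have h := relations D q
  have hz : ∀ i, D.qi q i ≠ 0 := fun i => (D.generic q i).ne_zero
  constructor
  · intro i
    simp [comulGen, h.K_mul_K', Algebra.TensorProduct.one_def]
  · intro i
    simp [comulGen, h.K'_mul_K, Algebra.TensorProduct.one_def]
  · intro i j
    simp [comulGen, h.K_mul_K i j]
  · intro i j
    simp [comulGen, mul_add, add_mul, h.K_mul_K i j, h.K_mul_E i j, TensorProduct.smul_tmul',
      TensorProduct.tmul_smul]
  · intro i j
    simp [comulGen, mul_add, add_mul, h.K_mul_K'_comm i j, h.K_mul_F i j, TensorProduct.smul_tmul',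
      TensorProduct.tmul_smul, -zpow_neg]
  · intro i j
    have e1 : K D q i * F D q j = D.qi q i ^ (-D.a i j) • (F D q j * K D q i) := h.K_mul_F i j
    have e2 : K' D q j * E D q i = D.qi q j ^ (-D.a j i) • (E D q i * K' D q j) := h.K'_mul_E j i
    have e3 := D.qi_zpow_symm q i j
    have e4 : E D q i * F D q j = F D q j * E D q i + (if i = j then
      (D.qi q i - (D.qi q i)⁻¹)⁻¹ • (K D q i - K' D q i) else 0) := by
      rw [← h.E_mul_F i j]; abel
    have e5 : E D q i * K' D q j = D.qi q i ^ (D.a i j) • (K' D q j * E D q i) := by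
      rw [e2, smul_smul, e3, ← zpow_add₀ (hz j)]; simp
    simp only [comulGen, mul_add, add_mul, Algebra.TensorProduct.tmul_mul_tmul, one_mul, mul_one,
      e1, e4, e5]
    have e6 : (D.qi q i ^ D.a i j • (K' D q j * E D q i)) ⊗ₜ[ℂ]
        (D.qi q i ^ (-D.a i j) • (F D q j * K D q i))
        = (K' D q j * E D q i) ⊗ₜ[ℂ] (F D q j * K D q i) := by
      rw [TensorProduct.smul_tmul, smul_smul, ← zpow_add₀ (hz i)]; simp
    rw [e6]
    split_ifs with hij
    · subst hij
      simp only [TensorProduct.add_tmul, TensorProduct.tmul_add, TensorProduct.smul_tmul',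
        TensorProduct.tmul_smul, TensorProduct.sub_tmul, TensorProduct.tmul_sub, smul_sub]
      abel
    · simp only [add_zero]
      abel
  · intro i j hij
    have hx := D.generic q i
    have hs := D.qi_zpow q hij
    have e1 := h.K_mul_E i i
    have e2 := h.K_mul_E i j
    have e3 := h.K_mul_E j i
    rw [D.qi_zpow_self] at e1
    rw [hs] at e2
    rw [← D.qi_zpow_symm q i j, hs] at e3
    simp only [comulGen]
    rw [serre_add hx]
    · have a1 := serre_mul_quasi (R := Uq D q ⊗[ℂ] Uq D q) hx (D.serreExp i j)
        (X := E D q i ⊗ₜ 1) (Y := E D q j ⊗ₜ 1) (k := 1 ⊗ₜ K D q i) (l := 1 ⊗ₜ K D q j) (y := 1)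
        (s := 1) (by simp [h.K_mul_K i j]) (by simp) (by simp) (by simp) ?_
      · have a2 : serre (D.qi q i) (D.serreExp i j) ((1 : Uq D q) ⊗ₜ[ℂ] E D q i) (1 ⊗ₜ[ℂ] E D q j)
            = 0 := by
          have := map_serre (Algebra.TensorProduct.includeRight : Uq D q →ₐ[ℂ] Uq D q ⊗[ℂ] Uq D q)
            (D.qi q i) (D.serreExp i j) (E D q i) (E D q j)
          rw [h.serre_E i j hij, map_zero] at this
          exact this.symm
        rw [a2, add_zero]
        simpa using a1
      · have := map_serre (Algebra.TensorProduct.includeLeft : Uq D q →ₐ[ℂ] Uq D q ⊗[ℂ] Uq D q)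
            (D.qi q i) (D.serreExp i j) (E D q i) (E D q j)
        rw [h.serre_E i j hij, map_zero] at this
        exact this.symm
    · simp [e1]
    · simp [e2]
    · simp [e3]
  · intro i j hij
    have hx := D.generic q i
    have hs := D.qi_zpow q hij
    have e1 := h.K'_mul_F i i
    have e2 := h.K'_mul_F i j
    have e3 := h.K'_mul_F j i
    rw [D.qi_zpow_self] at e1
    rw [hs] at e2
    rw [← D.qi_zpow_symm q i j, hs] at e3
    simp only [comulGen]
    rw [add_comm (F D q i ⊗ₜ[ℂ] 1), add_comm (F D q j ⊗ₜ[ℂ] 1), serre_add hx]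
    · have a1 := serre_mul_quasi (R := Uq D q ⊗[ℂ] Uq D q) hx (D.serreExp i j)
        (X := 1 ⊗ₜ F D q i) (Y := 1 ⊗ₜ F D q j) (k := K' D q i ⊗ₜ 1) (l := K' D q j ⊗ₜ 1) (y := 1)
        (s := 1) (by simp [h.K'_mul_K' i j]) (by simp) (by simp) (by simp) ?_
      · have a2 : serre (D.qi q i) (D.serreExp i j) (F D q i ⊗ₜ[ℂ] (1 : Uq D q)) (F D q j ⊗ₜ[ℂ] 1)
            = 0 := by
          have := map_serre (Algebra.TensorProduct.includeLeft : Uq D q →ₐ[ℂ] Uq D q ⊗[ℂ] Uq D q)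
            (D.qi q i) (D.serreExp i j) (F D q i) (F D q j)
          rw [h.serre_F i j hij, map_zero] at this
          exact this.symm
        rw [a2, add_zero]
        simpa using a1
      · have := map_serre (Algebra.TensorProduct.includeRight : Uq D q →ₐ[ℂ] Uq D q ⊗[ℂ] Uq D q)
            (D.qi q i) (D.serreExp i j) (F D q i) (F D q j)
        rw [h.serre_F i j hij, map_zero] at this
        exact this.symm
    · simp [e1, TensorProduct.smul_tmul']
    · simp [e2, TensorProduct.smul_tmul']
    · simp [e3, TensorProduct.smul_tmul']

theorem relations_counit : Relations D q (counitGen : Generator ι → ℂ) := by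
  constructor
  · simp [counitGen]
  · simp [counitGen]
  · simp [counitGen]
  · simp [counitGen]
  · simp [counitGen]
  · intro i j; simp [counitGen]
  · intro i j _
    exact Finset.sum_eq_zero fun r _ => by simp [counitGen]
  · intro i j _
    exact Finset.sum_eq_zero fun r _ => by simp [counitGen]

theorem relations_antipode : Relations D q (antipodeGen D q) := by
  have h := relations D q
  have hz : ∀ i, D.qi q i ≠ 0 := fun i => (D.generic q i).ne_zero
  constructor
  · intro i
    simp [antipodeGen, ← MulOpposite.op_mul, h.K_mul_K']
  · intro i
    simp [antipodeGen, ← MulOpposite.op_mul, h.K'_mul_K]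
  · intro i j
    simp only [antipodeGen, ← MulOpposite.op_mul, h.K'_mul_K' i j]
  · intro i j
    simp only [antipodeGen, ← MulOpposite.op_mul, ← MulOpposite.op_smul]
    congr 1
    rw [mul_neg, neg_mul, smul_neg, ← mul_assoc, h.K'_mul_E i j, smul_mul_assoc, smul_smul,
      ← zpow_add₀ (hz i), add_neg_cancel, zpow_zero, one_smul, mul_assoc, mul_assoc,
      h.K'_mul_K' i j]
  · intro i j
    simp only [antipodeGen, ← MulOpposite.op_mul, ← MulOpposite.op_smul]
    congr 1
    have e1 : K' D q i * F D q j = D.qi q i ^ D.a i j • (F D q j * K' D q i) := h.K'_mul_F i j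
    have e2 : K' D q i * K D q j = K D q j * K' D q i := (h.K_mul_K'_comm j i).symm
    rw [mul_neg, neg_mul, smul_neg, ← mul_assoc, e2, mul_assoc, mul_assoc,
      e1, mul_smul_comm, smul_smul, ← zpow_add₀ (hz i), neg_add_cancel, zpow_zero, one_smul]
  · intro i j
    have e0 : (-(K D q j * F D q j)) * (-(E D q i * K' D q i))
        - (-(E D q i * K' D q i)) * (-(K D q j * F D q j))
        = if i = j then (D.qi q i - (D.qi q i)⁻¹)⁻¹ • (K' D q i - K D q i) else 0 := by
      have e1 : E D q i * K' D q i * (K D q j * F D q j)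
          = K D q j * (E D q i * F D q j) * K' D q i := by
        have a1 : K' D q i * F D q j = D.qi q i ^ D.a i j • (F D q j * K' D q i) := h.K'_mul_F i j
        have a2 : K D q j * E D q i = D.qi q i ^ D.a i j • (E D q i * K D q j) := by
          rw [D.qi_zpow_symm]; exact h.K_mul_E j i
        have a3 : K' D q i * K D q j = K D q j * K' D q i := (h.K_mul_K'_comm j i).symm
        rw [mul_assoc (E D q i), ← mul_assoc (K' D q i), a3, mul_assoc (K D q j), a1,
          ← mul_assoc (K D q j), a2, mul_smul_comm, mul_smul_comm, smul_mul_assoc, smul_mul_assoc]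
        simp only [mul_assoc]
      have e2 : K D q j * F D q j * (E D q i * K' D q i)
          = K D q j * (F D q j * E D q i) * K' D q i := by simp only [mul_assoc]
      rw [neg_mul_neg, neg_mul_neg, e1, e2, ← sub_mul, ← mul_sub, ← neg_sub, h.E_mul_F i j]
      split_ifs with hij
      · subst hij
        have a3 : K D q i * K' D q i = 1 := h.K_mul_K' i
        rw [mul_neg, neg_mul, mul_smul_comm, smul_mul_assoc, mul_sub, sub_mul, a3, one_mul,
          mul_assoc, a3, mul_one, ← smul_neg, neg_sub]
      · simp
    simp only [antipodeGen, ← MulOpposite.op_mul, ← MulOpposite.op_sub]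
    rw [e0]
    split_ifs <;> simp
  · intro i j hij
    have hx := D.generic q i
    have hs := D.qi_zpow q hij
    have e1 := h.K'_mul_E i i
    have e2 := h.K'_mul_E i j
    have e3 := h.K'_mul_E j i
    rw [zpow_neg, D.qi_zpow_self, ← inv_pow] at e1
    rw [zpow_neg, ← D.qi_zpow_symm q i j, ← zpow_neg] at e3
    apply MulOpposite.unop_injective
    rw [unop_serre]
    simp only [antipodeGen, MulOpposite.unop_op, MulOpposite.unop_zero]
    rw [serre_neg, serre_mul_quasi hx _ (h.K'_mul_K' i j) e1 e2 e3 (h.serre_E i j hij)]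
    simp
  · intro i j hij
    have hx := D.generic q i
    have e1 := h.K_mul_F i i
    have e2 := h.K_mul_F i j
    have e3 := h.K_mul_F j i
    rw [zpow_neg, D.qi_zpow_self, ← inv_pow] at e1
    rw [zpow_neg, ← D.qi_zpow_symm q i j, ← zpow_neg] at e3
    have hz2 : ((D.qi q i)⁻¹ ^ 2 : ℂ) ≠ 0 := pow_ne_zero _ (inv_ne_zero (hz i))
    have hz3 : (D.qi q i ^ (-D.a i j) : ℂ) ≠ 0 := zpow_ne_zero _ (hz i)
    apply MulOpposite.unop_injective
    rw [unop_serre]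
    simp only [antipodeGen, MulOpposite.unop_op, MulOpposite.unop_zero]
    rw [serre_neg, e1, h.K_mul_F j j, zpow_neg, D.qi_zpow_self, ← inv_pow, serre_smul,
      serre_mul_quasi hx _ (h.K_mul_K i j) e1 e2 e3 (h.serre_F i j hij)]
    simp


/-- The coproduct as an algebra homomorphism. -/
noncomputable def comulHom : Uq D q →ₐ[ℂ] Uq D q ⊗[ℂ] Uq D q := lift (relations_comul D q)

/-- The counit as an algebra homomorphism. -/
noncomputable def counitHom : Uq D q →ₐ[ℂ] ℂ := lift (relations_counit D q)

/-- The antipode as an algebra homomorphism to the opposite algebra. -/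
noncomputable def antipodeHom : Uq D q →ₐ[ℂ] (Uq D q)ᵐᵒᵖ := lift (relations_antipode D q)

noncomputable instance : Bialgebra ℂ (Uq D q) :=
  Bialgebra.ofAlgHom (comulHom D q) (counitHom D q)
    (algHom_ext fun x => by
      cases x <;>
        simp [comulHom, comulGen, TensorProduct.add_tmul, TensorProduct.tmul_add, add_assoc,
          Algebra.TensorProduct.one_def])
    (algHom_ext fun x => by
      cases x <;> simp [comulHom, comulGen, counitHom, counitGen])
    (algHom_ext fun x => by
      cases x <;> simp [comulHom, comulGen, counitHom, counitGen])

theorem comul_gen (x : Generator ι) :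
    Coalgebra.comul (R := ℂ) (gen D q x) = comulGen D q x := lift_gen _ x

theorem counit_gen (x : Generator ι) :
    Coalgebra.counit (R := ℂ) (gen D q x) = counitGen x := lift_gen _ x

/-- The antipode as a linear map. -/
noncomputable def antipodeLin : Uq D q →ₗ[ℂ] Uq D q :=
  (MulOpposite.opLinearEquiv ℂ).symm.toLinearMap ∘ₗ (antipodeHom D q).toLinearMap

theorem antipodeLin_one : antipodeLin D q 1 = 1 := by simp [antipodeLin]

theorem antipodeLin_mul (x y : Uq D q) :
    antipodeLin D q (x * y) = antipodeLin D q y * antipodeLin D q x := by simp [antipodeLin]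

theorem antipodeLin_gen (x : Generator ι) :
    antipodeLin D q (gen D q x) = (antipodeGen D q x).unop := by
  simp [antipodeLin, antipodeHom]

theorem antipode_left_mul {t : Uq D q ⊗[ℂ] Uq D q} {c : ℂ}
    (ht : LinearMap.mul' ℂ _ ((antipodeLin D q).rTensor _ t) = algebraMap ℂ _ c)
    (u : Uq D q ⊗[ℂ] Uq D q) :
    LinearMap.mul' ℂ _ ((antipodeLin D q).rTensor _ (t * u))
      = c • LinearMap.mul' ℂ _ ((antipodeLin D q).rTensor _ u) := by
  induction u with
  | zero => simp
  | add a b ha hb => simp only [mul_add, map_add, ha, hb, smul_add]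
  | tmul a b =>
    have key : ∀ s : Uq D q ⊗[ℂ] Uq D q,
        LinearMap.mul' ℂ _ ((antipodeLin D q).rTensor _ (s * a ⊗ₜ b))
        = antipodeLin D q a * LinearMap.mul' ℂ _ ((antipodeLin D q).rTensor _ s) * b := by
      intro s
      induction s with
      | zero => simp
      | add x y hx hy => simp only [add_mul, map_add, hx, hy, mul_add]
      | tmul x y => simp [antipodeLin_mul, mul_assoc]
    rw [key, ht]
    simp [Algebra.algebraMap_eq_smul_one]

theorem antipode_right_mul {u : Uq D q ⊗[ℂ] Uq D q} {c : ℂ}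
    (hu : LinearMap.mul' ℂ _ ((antipodeLin D q).lTensor _ u) = algebraMap ℂ _ c)
    (t : Uq D q ⊗[ℂ] Uq D q) :
    LinearMap.mul' ℂ _ ((antipodeLin D q).lTensor _ (t * u))
      = c • LinearMap.mul' ℂ _ ((antipodeLin D q).lTensor _ t) := by
  induction t with
  | zero => simp
  | add a b ha hb => simp only [add_mul, map_add, ha, hb, smul_add]
  | tmul a b =>
    have key : ∀ s : Uq D q ⊗[ℂ] Uq D q,
        LinearMap.mul' ℂ _ ((antipodeLin D q).lTensor _ (a ⊗ₜ b * s))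
        = a * LinearMap.mul' ℂ _ ((antipodeLin D q).lTensor _ s) * antipodeLin D q b := by
      intro s
      induction s with
      | zero => simp
      | add x y hx hy => simp only [add_mul, map_add, hx, hy, mul_add]
      | tmul x y => simp [antipodeLin_mul, mul_assoc]
    rw [key, hu]
    simp [Algebra.algebraMap_eq_smul_one]

noncomputable instance : HopfAlgebra ℂ (Uq D q) where
  antipode := antipodeLin D q
  mul_antipode_rTensor_comul := by
    have h := relations D q
    have h1 : ∀ i, K D q i * K' D q i = 1 := h.K_mul_K'
    have h2 : ∀ i, K' D q i * K D q i = 1 := h.K'_mul_K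
    ext x
    simp only [LinearMap.comp_apply, Algebra.linearMap_apply]
    induction x using Uq.induction with
    | hs c =>
      rw [Bialgebra.comul_algebraMap, Bialgebra.counit_algebraMap, Algebra.algebraMap_eq_smul_one,
        Algebra.TensorProduct.one_def, map_smul, map_smul]
      simp [antipodeLin_one, Algebra.algebraMap_eq_smul_one]
    | hg x =>
      rw [comul_gen, counit_gen]
      cases x <;>
        simp [comulGen, counitGen, antipodeLin_gen, antipodeGen, antipodeLin_one, h1, h2, mul_assoc]
    | ha x y hx hy => simp only [map_add, hx, hy]
    | hm x y hx hy =>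
      rw [Bialgebra.comul_mul, antipode_left_mul D q hx, hy, Bialgebra.counit_mul]
      simp [Algebra.algebraMap_eq_smul_one, smul_smul]
  mul_antipode_lTensor_comul := by
    have h := relations D q
    have h1 : ∀ i, K D q i * K' D q i = 1 := h.K_mul_K'
    have h2 : ∀ i, K' D q i * K D q i = 1 := h.K'_mul_K
    have h3 : ∀ i x, K' D q i * (K D q i * x) = x := fun i x => by rw [← mul_assoc, h2, one_mul]
    ext x
    simp only [LinearMap.comp_apply, Algebra.linearMap_apply]
    induction x using Uq.induction with
    | hs c =>
      rw [Bialgebra.comul_algebraMap, Bialgebra.counit_algebraMap, Algebra.algebraMap_eq_smul_one,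
        Algebra.TensorProduct.one_def, map_smul, map_smul]
      simp [antipodeLin_one, Algebra.algebraMap_eq_smul_one]
    | hg x =>
      rw [comul_gen, counit_gen]
      cases x <;>
        simp [comulGen, counitGen, antipodeLin_gen, antipodeGen, antipodeLin_one, h1, h2, h3]
    | ha x y hx hy => simp only [map_add, hx, hy]
    | hm x y hx hy =>
      rw [Bialgebra.comul_mul, antipode_right_mul D q hy, hx, Bialgebra.counit_mul]
      simp [Algebra.algebraMap_eq_smul_one, smul_smul, mul_comm]

theorem antipode_gen (x : Generator ι) :
    HopfAlgebra.antipode ℂ (gen D q x) = (antipodeGen D q x).unop := antipodeLin_gen D q x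

/-! ### The conjugate-linear automorphism `θ`

For the compact real form `Kᵢ^* = Kᵢ`, `Eᵢ^* = Kᵢ Fᵢ`, `Fᵢ^* = Eᵢ Kᵢ⁻¹` of `U_q(𝔤)`, one has
`θ X = S(X)^*`. -/

/-- An algebra with the conjugate scalar action. -/
def ConjAlg (R : Type*) : Type _ := R

instance (R : Type*) [Ring R] : Ring (ConjAlg R) := inferInstanceAs (Ring R)

noncomputable instance (R : Type*) [Ring R] [Algebra ℂ R] : Algebra ℂ (ConjAlg R) :=
  Algebra.compHom R (starRingEnd ℂ)

/-- The identity map to the conjugate algebra. -/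
def toConj (R : Type*) [Ring R] : R ≃+* ConjAlg R := RingEquiv.refl R

theorem toConj_smul {R : Type*} [Ring R] [Algebra ℂ R] (c : ℂ) (x : R) :
    toConj R (c • x) = conj c • toConj R x := by
  have : conj c • toConj R x = toConj R ((conj (conj c)) • x) := rfl
  rw [this, Complex.conj_conj]

theorem conj_quantumBinom {x : ℂ} (hx : conj x = x) (n r : ℕ) :
    conj (quantumBinom x n r) = quantumBinom x n r := by
  simp [quantumBinom, quantumFactorial, symQuantumInt, hx]

theorem toConj_serre {R : Type*} [Ring R] [Algebra ℂ R] {x : ℂ} (hx : conj x = x) (N : ℕ)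
    (X Y : R) : toConj R (serre x N X Y) = serre x N (toConj R X) (toConj R Y) := by
  simp only [serre, map_sum, toConj_smul, map_mul, map_pow, conj_quantumBinom hx]
  simp

/-- `θ` on generators. -/
noncomputable def thetaGen : Generator ι → Uq D q
  | .E i => -F D q i
  | .F i => -E D q i
  | .K i => K' D q i
  | .K' i => K D q i

theorem relations_theta : Relations D q fun x => toConj _ (thetaGen D q x) := by
  have h := relations D q
  have hc : ∀ i (n : ℤ), conj (D.qi q i ^ n) = D.qi q i ^ n := fun i n => by
    rw [map_zpow₀, D.conj_qi]
  constructor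
  · intro i; simp [thetaGen, ← map_mul, h.K'_mul_K]
  · intro i; simp [thetaGen, ← map_mul, h.K_mul_K']
  · intro i j; simp only [thetaGen, ← map_mul, h.K'_mul_K' i j]
  · intro i j
    simp only [thetaGen]
    rw [← map_mul, ← map_mul, ← hc, ← toConj_smul, mul_neg, neg_mul, smul_neg, h.K'_mul_F i j]
  · intro i j
    simp only [thetaGen]
    rw [← map_mul, ← map_mul, ← hc, ← toConj_smul, mul_neg, neg_mul, smul_neg, h.K'_mul_E i j]
  · intro i j
    have e := h.E_mul_F j i
    simp only [thetaGen]
    rw [← map_mul, ← map_mul, ← map_sub, neg_mul_neg, neg_mul_neg, ← neg_sub, e]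
    by_cases hij : i = j
    · subst hij
      have hc' : conj ((D.qi q i - (D.qi q i)⁻¹)⁻¹) = (D.qi q i - (D.qi q i)⁻¹)⁻¹ := by
        simp [D.conj_qi]
      rw [if_pos rfl, if_pos rfl, ← map_sub, ← hc', ← toConj_smul, ← smul_neg, neg_sub, hc']
    · rw [if_neg hij, if_neg (Ne.symm hij)]
      simp
  · intro i j hij
    simp only [thetaGen]
    rw [← toConj_serre (D.conj_qi q i), serre_neg, h.serre_F i j hij, smul_zero, map_zero]
  · intro i j hij
    simp only [thetaGen]
    rw [← toConj_serre (D.conj_qi q i), serre_neg, h.serre_E i j hij, smul_zero, map_zero]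

/-- The conjugate-linear ring endomorphism `θ` of `U_q(𝔤)` with `θ Eᵢ = -Fᵢ`, `θ Fᵢ = -Eᵢ` and
`θ Kᵢ = Kᵢ⁻¹`. -/
noncomputable def theta : Uq D q →+* Uq D q :=
  ((toConj (Uq D q)).symm : ConjAlg (Uq D q) →+* Uq D q).comp (lift (relations_theta D q)).toRingHom

theorem theta_smul (c : ℂ) (x : Uq D q) : theta D q (c • x) = conj c • theta D q x := by
  simp only [theta, RingHom.comp_apply, AlgHom.toRingHom_eq_coe, RingHom.coe_coe, map_smul]
  apply (toConj (Uq D q)).injective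
  rw [toConj_smul, Complex.conj_conj, RingEquiv.apply_symm_apply, RingEquiv.apply_symm_apply]

@[simp] theorem theta_gen (x : Generator ι) : theta D q (gen D q x) = thetaGen D q x := by
  simp only [theta, RingHom.comp_apply, AlgHom.toRingHom_eq_coe, RingHom.coe_coe, lift_gen]
  exact (toConj (Uq D q)).symm_apply_apply _

theorem theta_algebraMap (c : ℂ) :
    theta D q (algebraMap ℂ _ c) = algebraMap ℂ _ (conj c) := by
  rw [Algebra.algebraMap_eq_smul_one, theta_smul, map_one, Algebra.algebraMap_eq_smul_one]

@[simp] theorem theta_theta (x : Uq D q) : theta D q (theta D q x) = x := by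
  induction x using Uq.induction with
  | hs c => simp [theta_algebraMap]
  | hg x => cases x <;> simp [thetaGen]
  | ha x y hx hy => simp [hx, hy]
  | hm x y hx hy => simp [hx, hy]

/-- `θ` as a conjugate-linear map. -/
noncomputable def thetaLin : Uq D q →ₗ⋆[ℂ] Uq D q where
  toFun := theta D q
  map_add' := map_add _
  map_smul' := theta_smul D q

/-- `a ⊗ b ↦ θ b ⊗ θ a`. -/
noncomputable def thetaTwo : Uq D q ⊗[ℂ] Uq D q →ₗ⋆[ℂ] Uq D q ⊗[ℂ] Uq D q :=
  TensorProduct.map (thetaLin D q) (thetaLin D q) ∘ₛₗ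
    (TensorProduct.comm ℂ (Uq D q) (Uq D q)).toLinearMap

@[simp] theorem thetaTwo_tmul (a b : Uq D q) :
    thetaTwo D q (a ⊗ₜ b) = theta D q b ⊗ₜ theta D q a := rfl

theorem thetaTwo_mul (s t : Uq D q ⊗[ℂ] Uq D q) :
    thetaTwo D q (s * t) = thetaTwo D q s * thetaTwo D q t := by
  induction s with
  | zero => simp
  | add x y hx hy => simp only [add_mul, map_add, hx, hy]
  | tmul a b =>
    induction t with
    | zero => simp
    | add x y hx hy => simp only [mul_add, map_add, hx, hy]
    | tmul c d => simp

theorem comul_theta (x : Uq D q) :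
    Coalgebra.comul (R := ℂ) (theta D q x) = thetaTwo D q (Coalgebra.comul (R := ℂ) x) := by
  induction x using Uq.induction with
  | hs c =>
    rw [theta_algebraMap, Bialgebra.comul_algebraMap, Bialgebra.comul_algebraMap]
    simp [Algebra.algebraMap_eq_smul_one, Algebra.TensorProduct.one_def, LinearMap.map_smulₛₗ]
  | hg x =>
    rw [theta_gen, comul_gen]
    cases x <;> simp [thetaGen, comulGen, comul_gen, TensorProduct.neg_tmul,
      TensorProduct.tmul_neg, add_comm]
  | ha x y hx hy => simp [hx, hy]
  | hm x y hx hy => simp [hx, hy, thetaTwo_mul]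

/-- The compact real form of `U_q(𝔤)`. -/
noncomputable instance : Star (Uq D q) := ⟨fun x => antipodeLin D q (theta D q x)⟩

theorem star_def (x : Uq D q) : star x = antipodeLin D q (theta D q x) := rfl

theorem star_K (i : ι) : star (K D q i) = K D q i := by
  simp [star_def, thetaGen, antipodeLin_gen, antipodeGen]

theorem star_K' (i : ι) : star (K' D q i) = K' D q i := by
  simp [star_def, thetaGen, antipodeLin_gen, antipodeGen]

theorem star_E (i : ι) : star (E D q i) = K D q i * F D q i := by
  simp [star_def, thetaGen, antipodeLin_gen, antipodeGen]

theorem star_F (i : ι) : star (F D q i) = E D q i * K' D q i := by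
  simp [star_def, thetaGen, antipodeLin_gen, antipodeGen]

theorem star_mul' (x y : Uq D q) : star (x * y) = star y * star x := by
  simp [star_def, antipodeLin_mul]

theorem star_algebraMap (c : ℂ) :
    star (algebraMap ℂ (Uq D q) c) = algebraMap ℂ (Uq D q) (conj c) := by
  rw [star_def, theta_algebraMap, Algebra.algebraMap_eq_smul_one, map_smul, antipodeLin_one,
    ← Algebra.algebraMap_eq_smul_one]

noncomputable instance : StarRing (Uq D q) where
  star_involutive x := by
    have h1 : ∀ i, K' D q i * K D q i = 1 := (relations D q).K'_mul_K
    have h2 : ∀ i, K D q i * K' D q i = 1 := (relations D q).K_mul_K'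
    induction x using Uq.induction with
    | hs c => rw [star_algebraMap, star_algebraMap, Complex.conj_conj]
    | hg x =>
      cases x with
      | E i => rw [star_E, star_mul', star_K, star_F, mul_assoc, h1, mul_one]
      | F i => rw [star_F, star_mul', star_K', star_E, ← mul_assoc, h1, one_mul]
      | K i => rw [star_K, star_K]
      | K' i => rw [star_K', star_K']
    | ha x y hx hy =>
      have : ∀ u v : Uq D q, star (u + v) = star u + star v := fun u v => by simp [star_def]
      rw [this, this, hx, hy]
    | hm x y hx hy => rw [star_mul', star_mul', hx, hy]
  star_add x y := by simp [star_def]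
  star_mul := star_mul' D q

/-- `θ X = S(X)^*`. -/
theorem theta_eq (x : Uq D q) : theta D q x = star (HopfAlgebra.antipode ℂ x) := by
  change theta D q x = star (antipodeLin D q x)
  have h1 : ∀ i, K' D q i * K D q i = 1 := (relations D q).K'_mul_K
  have h2 : ∀ i, K D q i * K' D q i = 1 := (relations D q).K_mul_K'
  induction x using Uq.induction with
  | hs c =>
    rw [theta_algebraMap, Algebra.algebraMap_eq_smul_one c, map_smul, antipodeLin_one,
      ← Algebra.algebraMap_eq_smul_one, star_algebraMap]
  | hg x =>
    rw [theta_gen, antipodeLin_gen]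
    cases x with
    | E i =>
      simp only [thetaGen, antipodeGen, MulOpposite.unop_op]
      rw [star_neg, star_mul', star_K', star_E, ← mul_assoc, h1, one_mul]
    | F i =>
      simp only [thetaGen, antipodeGen, MulOpposite.unop_op]
      rw [star_neg, star_mul', star_K, star_F, mul_assoc, h1, mul_one]
    | K i => simp only [thetaGen, antipodeGen, MulOpposite.unop_op, star_K']
    | K' i => simp only [thetaGen, antipodeGen, MulOpposite.unop_op, star_K]
  | ha x y hx hy => rw [map_add, map_add, star_add, hx, hy]
  | hm x y hx hy => rw [map_mul, antipodeLin_mul, star_mul', hx, hy]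

/-! ### Matrix coefficients of type-one representations -/

/-- A finite-dimensional type-one representation of `U_q(𝔤)`, in a basis of weight vectors: the
generator `Kᵢ` acts on the `k`-th basis vector by `qᵢ ^ wt k i`. -/
structure WeightRep where
  κ : Type
  [fintype : Fintype κ]
  [decEq : DecidableEq κ]
  ρ : Uq D q →ₐ[ℂ] Matrix κ κ ℂ
  wt : κ → ι → ℤ
  map_K : ∀ i, ρ (K D q i) = Matrix.diagonal fun k => D.qi q i ^ wt k i

attribute [instance] WeightRep.fintype WeightRep.decEq

variable {D q}

theorem WeightRep.map_K' (V : WeightRep D q) (i : ι) :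
    V.ρ (K' D q i) = Matrix.diagonal fun k => D.qi q i ^ (-V.wt k i) := by
  have h1 : V.ρ (K' D q i) * V.ρ (K D q i) = 1 := by
    rw [← map_mul, (relations D q).K'_mul_K, map_one]
  have h2 : V.ρ (K D q i) * (Matrix.diagonal fun k => D.qi q i ^ (-V.wt k i)) = 1 := by
    rw [V.map_K, Matrix.diagonal_mul_diagonal, ← Matrix.diagonal_one]
    congr 1
    ext k
    rw [← zpow_add₀ (D.generic q i).ne_zero, add_neg_cancel, zpow_zero]
  calc V.ρ (K' D q i) = V.ρ (K' D q i) * (V.ρ (K D q i) *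
        (Matrix.diagonal fun k => D.qi q i ^ (-V.wt k i))) := by rw [h2, mul_one]
    _ = _ := by rw [← mul_assoc, h1, one_mul]

/-- The matrix coefficients of a representation. -/
noncomputable def WeightRep.coeff (V : WeightRep D q) (i j : V.κ) :
    WithConv (Uq D q →ₗ[ℂ] ℂ) :=
  .toConv (Matrix.entryLinearMap ℂ ℂ i j ∘ₗ V.ρ.toLinearMap)

@[simp] theorem WeightRep.coeff_apply (V : WeightRep D q) (i j : V.κ) (x : Uq D q) :
    V.coeff i j x = V.ρ x i j := rfl

/-- The trivial representation. -/
noncomputable def WeightRep.trivial : WeightRep D q where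
  κ := Unit
  ρ := (Algebra.ofId ℂ (Matrix Unit Unit ℂ)).comp (counitHom D q)
  wt _ _ := 0
  map_K i := by
    ext a b
    simp [counitHom, counitGen, Algebra.ofId_apply]

/-- The Kronecker product of matrices as an algebra homomorphism. -/
noncomputable def kron (m n : Type*) [Fintype m] [DecidableEq m] [Fintype n] [DecidableEq n] :
    Matrix m m ℂ ⊗[ℂ] Matrix n n ℂ →ₐ[ℂ] Matrix (m × n) (m × n) ℂ :=
  (Algebra.TensorProduct.lid ℂ ℂ).toAlgHom.mapMatrix.comp
    (Matrix.kroneckerTMulAlgEquiv m n ℂ ℂ ℂ ℂ).toAlgHom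

theorem kron_tmul {m n : Type*} [Fintype m] [DecidableEq m] [Fintype n] [DecidableEq n]
    (a : Matrix m m ℂ) (b : Matrix n n ℂ) (i j : m × n) :
    kron m n (a ⊗ₜ b) i j = a i.1 j.1 * b i.2 j.2 := by
  simp [kron]

/-- The tensor product of two representations. -/
noncomputable def WeightRep.tensor (V W : WeightRep D q) : WeightRep D q where
  κ := V.κ × W.κ
  ρ := ((kron V.κ W.κ).comp (Algebra.TensorProduct.map V.ρ W.ρ)).comp (comulHom D q)
  wt k i := V.wt k.1 i + W.wt k.2 i
  map_K i := by
    ext a b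
    have e : comulHom D q (K D q i) = K D q i ⊗ₜ K D q i := lift_gen _ _
    rw [AlgHom.comp_apply, AlgHom.comp_apply, e, Algebra.TensorProduct.map_tmul, kron_tmul, V.map_K,
      W.map_K]
    by_cases h1 : a.1 = b.1 <;> by_cases h2 : a.2 = b.2 <;>
      simp [Matrix.diagonal_apply, h1, h2, Prod.ext_iff, zpow_add₀ (D.generic q i).ne_zero]

theorem WeightRep.coeff_mul (V W : WeightRep D q) (i j : V.κ) (k l : W.κ) :
    V.coeff i j * W.coeff k l = (V.tensor W).coeff (i, k) (j, l) := by
  ext x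
  change LinearMap.mul' ℂ ℂ (TensorProduct.map (V.coeff i j).ofConv (W.coeff k l).ofConv
      (comulHom D q x))
    = kron V.κ W.κ (Algebra.TensorProduct.map V.ρ W.ρ (comulHom D q x)) (i, k) (j, l)
  induction comulHom D q x with
  | zero => simp
  | add a b ha hb => simp only [map_add, ha, hb, Matrix.add_apply]
  | tmul a b => simp [kron_tmul]

/-- The dual representation. -/
noncomputable def WeightRep.dual (V : WeightRep D q) : WeightRep D q where
  κ := V.κ
  ρ := AlgHom.ofLinearMap
    ((Matrix.transposeLinearEquiv V.κ V.κ ℂ ℂ).toLinearMap ∘ₗ V.ρ.toLinearMap ∘ₗ antipodeLin D q)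
    (by simp [antipodeLin_one])
    (fun x y => by simp [antipodeLin_mul])
  wt k i := -V.wt k i
  map_K i := by
    simp [antipodeLin_gen, antipodeGen, V.map_K', -zpow_neg]

theorem WeightRep.dual_apply (V : WeightRep D q) (x : Uq D q) (i j : V.κ) :
    V.dual.ρ x i j = V.ρ (antipodeLin D q x) j i := rfl

/-- The conjugate representation. -/
noncomputable def WeightRep.conj (V : WeightRep D q) : WeightRep D q where
  κ := V.κ
  ρ := AlgHom.ofLinearMap
    { toFun := fun x => (V.ρ (theta D q x)).map (starRingEnd ℂ)
      map_add' := fun x y => by simp [Matrix.map_add]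
      map_smul' := fun c x => by
        ext a b
        simp [theta_smul] }
    (by simp)
    (fun x y => by simp [Matrix.map_mul])
  wt k i := -V.wt k i
  map_K i := by
    ext a b
    simp only [AlgHom.ofLinearMap_apply, LinearMap.coe_mk, AddHom.coe_mk, theta_gen, thetaGen,
      V.map_K', Matrix.map_apply, Matrix.diagonal_apply]
    split_ifs
    · rw [map_zpow₀, D.conj_qi]
    · simp

theorem WeightRep.conj_apply (V : WeightRep D q) (x : Uq D q) (i j : V.κ) :
    V.conj.ρ x i j = starRingEnd ℂ (V.ρ (theta D q x) i j) := rfl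

end Uq

open Uq

/-! ### The quantised coordinate algebra -/

variable [DecidableEq ι] (D : CartanDatum ι) (q : Parameter)

/-- The span of the matrix coefficients, inside the convolution algebra of functionals. -/
noncomputable def coeffSpan : Submodule ℂ (WithConv (Uq D q →ₗ[ℂ] ℂ)) :=
  Submodule.span ℂ {f | ∃ (V : WeightRep D q) (i j : V.κ), f = V.coeff i j}

/-- The subalgebra of matrix coefficients. -/
noncomputable def coeffAlg : Subalgebra ℂ (WithConv (Uq D q →ₗ[ℂ] ℂ)) :=
  (coeffSpan D q).toSubalgebra
    (Submodule.subset_span ⟨WeightRep.trivial, (), (), by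
      ext x
      change algebraMap ℂ ℂ (counitHom D q x) = algebraMap ℂ (Matrix Unit Unit ℂ) _ () ()
      simp [Matrix.algebraMap_matrix_apply]⟩)
    (fun f g hf hg => by
      have h : coeffSpan D q * coeffSpan D q ≤ coeffSpan D q := by
        rw [coeffSpan, Submodule.span_mul_span]
        apply Submodule.span_mono
        rintro _ ⟨_, ⟨V, i, j, rfl⟩, _, ⟨W, k, l, rfl⟩, rfl⟩
        exact ⟨V.tensor W, (i, k), (j, l), V.coeff_mul W i j k l⟩
      exact h (Submodule.mul_mem_mul hf hg))

/-- The quantised coordinate algebra `𝒪_q(G)`: the Hopf algebra of matrix coefficients of the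
finite-dimensional type-one representations of `U_q(𝔤)`. -/
def Oq : Type _ := coeffAlg D q

namespace Oq

noncomputable instance : Ring (Oq D q) := inferInstanceAs (Ring (coeffAlg D q))
noncomputable instance : Algebra ℂ (Oq D q) := inferInstanceAs (Algebra ℂ (coeffAlg D q))

/-- Evaluation at an element of `U_q(𝔤)`, the dual pairing. -/
noncomputable def ev (x : Uq D q) : Oq D q →ₗ[ℂ] ℂ :=
  LinearMap.applyₗ x ∘ₗ (WithConv.linearEquiv ℂ _).toLinearMap ∘ₗ (coeffAlg D q).val.toLinearMap

/-- The matrix coefficients as elements of the quantised coordinate algebra. -/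
noncomputable def coeff (V : WeightRep D q) (i j : V.κ) : Oq D q :=
  ⟨V.coeff i j, Submodule.subset_span ⟨V, i, j, rfl⟩⟩

variable {D q}

@[simp] theorem ev_coeff (V : WeightRep D q) (i j : V.κ) (x : Uq D q) :
    ev D q x (coeff D q V i j) = V.ρ x i j := rfl

theorem ev_ext {f g : Oq D q} (h : ∀ x, ev D q x f = ev D q x g) : f = g := by
  apply Subtype.ext
  apply WithConv.ext
  ext x
  exact h x

theorem ev_eq_zero {f : Oq D q} (h : ∀ x, ev D q x f = 0) : f = 0 :=
  ev_ext fun x => by rw [h, map_zero]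

/-- Construct an element from a functional lying in the span of the matrix coefficients. -/
noncomputable def ofFun (f : Uq D q →ₗ[ℂ] ℂ) (h : WithConv.toConv f ∈ coeffSpan D q) : Oq D q :=
  ⟨.toConv f, h⟩

@[simp] theorem ev_ofFun (f : Uq D q →ₗ[ℂ] ℂ) (h : WithConv.toConv f ∈ coeffSpan D q)
    (x : Uq D q) : ev D q x (ofFun f h) = f x := rfl

theorem ev_add_left (x y : Uq D q) (f : Oq D q) : ev D q (x + y) f = ev D q x f + ev D q y f :=
  map_add (f.1.ofConv) x y

theorem ev_smul_left (c : ℂ) (x : Uq D q) (f : Oq D q) : ev D q (c • x) f = c * ev D q x f :=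
  map_smul (f.1.ofConv) c x

theorem ev_one (x : Uq D q) : ev D q x 1 = Coalgebra.counit (R := ℂ) x := rfl

theorem ev_mul (x : Uq D q) (f g : Oq D q) {κ : Type*} (s : Coalgebra.Repr ℂ x κ) :
    ev D q x (f * g) = ∑ i ∈ s.index, ev D q (s.left i) f * ev D q (s.right i) g :=
  s.convMul_apply f.1 g.1

/-- Induction on matrix coefficients. -/
theorem induction {p : Oq D q → Prop} (hc : ∀ V i j, p (coeff D q V i j)) (h0 : p 0)
    (ha : ∀ f g, p f → p g → p (f + g)) (hs : ∀ (c : ℂ) f, p f → p (c • f)) (f : Oq D q) : p f := by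
  obtain ⟨f, hf⟩ := f
  refine Submodule.span_induction (p := fun f hf => p (⟨f, hf⟩ : coeffAlg D q)) ?_ h0 ?_ ?_ hf
  · rintro _ ⟨V, i, j, rfl⟩
    exact hc V i j
  · intro x y hx hy h1 h2
    exact ha _ _ h1 h2
  · intro c x hx h1
    exact hs c _ h1

/-- Separating families of functionals on the factors separate the tensor product. -/
theorem separate {M N : Type*} [AddCommGroup M] [Module ℂ M] [AddCommGroup N] [Module ℂ N]
    {α β : Type*} {F : α → M →ₗ[ℂ] ℂ} {G : β → N →ₗ[ℂ] ℂ}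
    (hF : ∀ m, (∀ a, F a m = 0) → m = 0) (hG : ∀ n, (∀ b, G b n = 0) → n = 0)
    {t : M ⊗[ℂ] N} (ht : ∀ a b, LinearMap.mul' ℂ ℂ (TensorProduct.map (F a) (G b) t) = 0) :
    t = 0 := by
  classical
  let B := Module.Basis.ofVectorSpace ℂ M
  apply (TensorProduct.equivFinsuppOfBasisLeft (N := N) B).injective
  rw [map_zero]
  obtain ⟨c, rfl⟩ := TensorProduct.eq_repr_basis_left (N := N) B t
  suffices hc : c = 0 by simp [hc]
  have h1 : ∀ b a, F a (c.sum fun i n => G b n • B i) = 0 := by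
    intro b a
    have := ht a b
    simp only [Finsupp.sum, map_sum, TensorProduct.map_tmul, LinearMap.mul'_apply] at this ⊢
    rw [← this]
    exact Finset.sum_congr rfl fun i _ => by simp [mul_comm]
  have h2 : ∀ b, (c.sum fun i n => G b n • B i) = 0 := fun b => hF _ (h1 b)
  ext i
  apply hG
  intro b
  have h3 := B.linearIndependent
  rw [linearIndependent_iff'] at h3
  by_cases hi : i ∈ c.support
  · exact h3 c.support (fun i => G b (c i)) (h2 b) i hi
  · rw [Finsupp.notMem_support_iff.mp hi, map_zero]

/-- Evaluation of both tensor factors. -/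
noncomputable def ev₂ (x y : Uq D q) : Oq D q ⊗[ℂ] Oq D q →ₗ[ℂ] ℂ :=
  LinearMap.mul' ℂ ℂ ∘ₗ TensorProduct.map (ev D q x) (ev D q y)

/-- Evaluation of three tensor factors. -/
noncomputable def ev₃ (x y z : Uq D q) : Oq D q ⊗[ℂ] (Oq D q ⊗[ℂ] Oq D q) →ₗ[ℂ] ℂ :=
  LinearMap.mul' ℂ ℂ ∘ₗ TensorProduct.map (ev D q x) (ev₂ y z)

@[simp] theorem ev₂_tmul (x y : Uq D q) (f g : Oq D q) :
    ev₂ x y (f ⊗ₜ g) = ev D q x f * ev D q y g := rfl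

@[simp] theorem ev₃_tmul (x y z : Uq D q) (f : Oq D q) (t : Oq D q ⊗[ℂ] Oq D q) :
    ev₃ x y z (f ⊗ₜ t) = ev D q x f * ev₂ y z t := rfl

theorem ev₂_eq_zero {t : Oq D q ⊗[ℂ] Oq D q} (h : ∀ x y, ev₂ x y t = 0) : t = 0 :=
  separate (F := ev D q) (G := ev D q) (fun _ => ev_eq_zero) (fun _ => ev_eq_zero) h

theorem ev₂_ext {s t : Oq D q ⊗[ℂ] Oq D q} (h : ∀ x y, ev₂ x y s = ev₂ x y t) : s = t :=
  sub_eq_zero.mp (ev₂_eq_zero fun x y => by rw [map_sub, h, sub_self])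

theorem ev₃_ext {s t : Oq D q ⊗[ℂ] (Oq D q ⊗[ℂ] Oq D q)}
    (h : ∀ x y z, ev₃ x y z s = ev₃ x y z t) : s = t :=
  sub_eq_zero.mp (separate (F := ev D q) (G := fun p : Uq D q × Uq D q => ev₂ p.1 p.2)
    (fun _ => ev_eq_zero) (fun _ hn => ev₂_eq_zero fun x y => hn (x, y)) fun x p => by
      have := h x p.1 p.2
      rw [map_sub, map_sub, sub_eq_zero]
      exact this)

theorem exists_comul (f : Oq D q) :
    ∃ t : Oq D q ⊗[ℂ] Oq D q, ∀ x y, ev₂ x y t = ev D q (x * y) f := by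
  induction f using induction with
  | hc V i j =>
    refine ⟨∑ k, coeff D q V i k ⊗ₜ coeff D q V k j, fun x y => ?_⟩
    simp [Matrix.mul_apply]
  | h0 => exact ⟨0, by simp⟩
  | ha f g hf hg =>
    obtain ⟨s, hs⟩ := hf
    obtain ⟨t, ht⟩ := hg
    exact ⟨s + t, by simp [hs, ht]⟩
  | hs c f hf =>
    obtain ⟨s, hs⟩ := hf
    exact ⟨c • s, by simp [hs]⟩

/-- The coproduct, dual to the product of `U_q(𝔤)`. -/
noncomputable def comulLin : Oq D q →ₗ[ℂ] Oq D q ⊗[ℂ] Oq D q where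
  toFun f := (exists_comul f).choose
  map_add' f g := ev₂_ext fun x y => by
    rw [map_add, (exists_comul _).choose_spec, (exists_comul _).choose_spec,
      (exists_comul _).choose_spec, map_add]
  map_smul' c f := ev₂_ext fun x y => by
    rw [map_smul, (exists_comul _).choose_spec, (exists_comul _).choose_spec, map_smul]
    rfl

theorem ev₂_comulLin (x y : Uq D q) (f : Oq D q) : ev₂ x y (comulLin f) = ev D q (x * y) f :=
  (exists_comul f).choose_spec x y

noncomputable instance : Coalgebra ℂ (Oq D q) where
  comul := comulLin
  counit := ev D q 1
  coassoc := by
    have h1 : ∀ x y z (t : Oq D q ⊗[ℂ] Oq D q),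
        ev₃ x y z (TensorProduct.assoc ℂ _ _ _ (comulLin.rTensor _ t)) = ev₂ (x * y) z t := by
      intro x y z t
      induction t with
      | zero => simp
      | add a b ha hb => simp only [map_add, ha, hb]
      | tmul a b =>
        rw [LinearMap.rTensor_tmul, ev₂_tmul, ← ev₂_comulLin]
        induction comulLin a with
        | zero => simp
        | add a b ha hb => simp only [TensorProduct.add_tmul, map_add, ha, hb, add_mul]
        | tmul a c => simp [mul_assoc]
    have h2 : ∀ x y z (t : Oq D q ⊗[ℂ] Oq D q),
        ev₃ x y z (comulLin.lTensor _ t) = ev₂ x (y * z) t := by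
      intro x y z t
      induction t with
      | zero => simp
      | add a b ha hb => simp only [map_add, ha, hb]
      | tmul a b => simp [ev₂_comulLin]
    ext f
    refine ev₃_ext fun x y z => ?_
    simp only [LinearMap.comp_apply, LinearEquiv.coe_coe]
    rw [h1, h2, ev₂_comulLin, ev₂_comulLin, mul_assoc]
  rTensor_counit_comp_comul := by
    have h : ∀ x (t : Oq D q ⊗[ℂ] Oq D q),
        ev D q x (TensorProduct.lid ℂ _ ((ev D q 1).rTensor _ t)) = ev₂ 1 x t := by
      intro x t
      induction t with
      | zero => simp
      | add a b ha hb => simp only [map_add, ha, hb]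
      | tmul a b => simp
    ext f
    apply (TensorProduct.lid ℂ (Oq D q)).injective
    refine ev_ext fun x => ?_
    rw [LinearMap.comp_apply, h, ev₂_comulLin]
    simp
  lTensor_counit_comp_comul := by
    have h : ∀ x (t : Oq D q ⊗[ℂ] Oq D q),
        ev D q x (TensorProduct.rid ℂ _ ((ev D q 1).lTensor _ t)) = ev₂ x 1 t := by
      intro x t
      induction t with
      | zero => simp
      | add a b ha hb => simp only [map_add, ha, hb]
      | tmul a b => simp [mul_comm]
    ext f
    apply (TensorProduct.rid ℂ (Oq D q)).injective
    refine ev_ext fun x => ?_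
    rw [LinearMap.comp_apply, h, ev₂_comulLin]
    simp

theorem ev₂_comul (x y : Uq D q) (f : Oq D q) :
    ev₂ x y (Coalgebra.comul (R := ℂ) f) = ev D q (x * y) f := ev₂_comulLin x y f

theorem counit_eq (f : Oq D q) : Coalgebra.counit (R := ℂ) f = ev D q 1 f := rfl

theorem ev₂_mul {κ κ' : Type*} (x y : Uq D q) (s : Coalgebra.Repr ℂ x κ)
    (s' : Coalgebra.Repr ℂ y κ') (t u : Oq D q ⊗[ℂ] Oq D q) :
    ev₂ x y (t * u) = ∑ i ∈ s.index, ∑ j ∈ s'.index,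
      ev₂ (s.left i) (s'.left j) t * ev₂ (s.right i) (s'.right j) u := by
  induction t with
  | zero => simp
  | add a b ha hb => simp only [map_add, add_mul, ha, hb, Finset.sum_add_distrib]
  | tmul a b =>
    induction u with
    | zero => simp
    | add a b ha hb => simp only [map_add, mul_add, ha, hb, Finset.sum_add_distrib]
    | tmul c d =>
      rw [Algebra.TensorProduct.tmul_mul_tmul, ev₂_tmul, ev_mul x a c s, ev_mul y b d s',
        Finset.sum_mul_sum]
      refine Finset.sum_congr rfl fun i _ => Finset.sum_congr rfl fun j _ => ?_
      simp only [ev₂_tmul]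
      ring

noncomputable instance : Bialgebra ℂ (Oq D q) :=
  Bialgebra.mk' ℂ (Oq D q)
    (by change ev D q 1 1 = 1; rw [ev_one, Bialgebra.counit_one])
    (fun {f g} => by
      change ev D q 1 (f * g) = ev D q 1 f * ev D q 1 g
      let s : Coalgebra.Repr ℂ (1 : Uq D q) Unit :=
        { index := Finset.univ
          left := fun _ => 1
          right := fun _ => 1
          eq := by rw [Bialgebra.comul_one]; simp [Algebra.TensorProduct.one_def] }
      rw [ev_mul 1 f g s]
      simp [s])
    (ev₂_ext fun x y => by
      rw [ev₂_comul, ev_one, Bialgebra.counit_mul, Algebra.TensorProduct.one_def, ev₂_tmul, ev_one,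
        ev_one])
    (fun {f g} => ev₂_ext fun x y => by
      let s := Coalgebra.Repr.arbitrary ℂ x
      let s' := Coalgebra.Repr.arbitrary ℂ y
      let r : Coalgebra.Repr ℂ (x * y) (_ × _) :=
        { index := s.index ×ˢ s'.index
          left := fun i => s.left i.1 * s'.left i.2
          right := fun i => s.right i.1 * s'.right i.2
          eq := by
            rw [Bialgebra.comul_mul, ← s.eq, ← s'.eq, Finset.sum_mul_sum, Finset.sum_product]
            simp }
      rw [ev₂_comul, ev_mul (x * y) f g r, ev₂_mul x y s s', Finset.sum_product]
      simp only [ev₂_comul]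
      rfl)

/-- The antipode, dual to the antipode of `U_q(𝔤)`. -/
theorem antipode_mem (f : Oq D q) :
    WithConv.toConv (f.1.ofConv ∘ₗ antipodeLin D q) ∈ coeffSpan D q := by
  induction f using induction with
  | hc V i j => exact Submodule.subset_span ⟨V.dual, j, i, rfl⟩
  | h0 => exact (coeffSpan D q).zero_mem
  | ha f g hf hg => exact (coeffSpan D q).add_mem hf hg
  | hs c f hf => exact (coeffSpan D q).smul_mem c hf

/-- The antipode, dual to the antipode of `U_q(𝔤)`. -/
noncomputable def antipodeMap : Oq D q →ₗ[ℂ] Oq D q where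
  toFun f := ofFun _ (antipode_mem f)
  map_add' _ _ := rfl
  map_smul' _ _ := rfl

@[simp] theorem ev_antipodeMap (x : Uq D q) (f : Oq D q) :
    ev D q x (antipodeMap f) = ev D q (antipodeLin D q x) f := rfl

theorem ev_sum {κ : Type*} (s : Finset κ) (g : κ → Uq D q) (f : Oq D q) :
    ev D q (∑ i ∈ s, g i) f = ∑ i ∈ s, ev D q (g i) f := map_sum (f.1.ofConv) g s

theorem ev_algebraMap_left (c : ℂ) (f : Oq D q) :
    ev D q (algebraMap ℂ _ c) f = c * ev D q 1 f := by
  rw [Algebra.algebraMap_eq_smul_one, ev_smul_left]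

noncomputable instance : HopfAlgebra ℂ (Oq D q) where
  antipode := antipodeMap
  mul_antipode_rTensor_comul := by
    ext f
    refine ev_ext fun x => ?_
    let s := Coalgebra.Repr.arbitrary ℂ x
    have h : ∀ t : Oq D q ⊗[ℂ] Oq D q, ev D q x (LinearMap.mul' ℂ _ (antipodeMap.rTensor _ t))
        = ∑ i ∈ s.index, ev₂ (antipodeLin D q (s.left i)) (s.right i) t := by
      intro t
      induction t with
      | zero => simp
      | add a b ha hb => simp only [map_add, ha, hb, Finset.sum_add_distrib]
      | tmul a b => simp [ev_mul x _ _ s]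
    rw [LinearMap.comp_apply, LinearMap.comp_apply, h]
    simp only [ev₂_comul]
    rw [← ev_sum]
    have h2 := HopfAlgebra.mul_antipode_rTensor_comul_apply (R := ℂ) x
    rw [← s.eq] at h2
    simp only [map_sum, LinearMap.rTensor_tmul, LinearMap.mul'_apply] at h2
    have h3 : ∑ i ∈ s.index, antipodeLin D q (s.left i) * s.right i
      = algebraMap ℂ (Uq D q) (Coalgebra.counit x) := h2
    rw [h3, ev_algebraMap_left, LinearMap.comp_apply, Algebra.linearMap_apply,
      Algebra.algebraMap_eq_smul_one, map_smul, ev_one, counit_eq]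
    simp [mul_comm]
  mul_antipode_lTensor_comul := by
    ext f
    refine ev_ext fun x => ?_
    let s := Coalgebra.Repr.arbitrary ℂ x
    have h : ∀ t : Oq D q ⊗[ℂ] Oq D q, ev D q x (LinearMap.mul' ℂ _ (antipodeMap.lTensor _ t))
        = ∑ i ∈ s.index, ev₂ (s.left i) (antipodeLin D q (s.right i)) t := by
      intro t
      induction t with
      | zero => simp
      | add a b ha hb => simp only [map_add, ha, hb, Finset.sum_add_distrib]
      | tmul a b => simp [ev_mul x _ _ s]
    rw [LinearMap.comp_apply, LinearMap.comp_apply, h]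
    simp only [ev₂_comul]
    rw [← ev_sum]
    have h2 := HopfAlgebra.mul_antipode_lTensor_comul_apply (R := ℂ) x
    rw [← s.eq] at h2
    simp only [map_sum, LinearMap.lTensor_tmul, LinearMap.mul'_apply] at h2
    have h3 : ∑ i ∈ s.index, s.left i * antipodeLin D q (s.right i)
      = algebraMap ℂ (Uq D q) (Coalgebra.counit x) := h2
    rw [h3, ev_algebraMap_left, LinearMap.comp_apply, Algebra.linearMap_apply,
      Algebra.algebraMap_eq_smul_one, map_smul, ev_one, counit_eq]
    simp [mul_comm]

/-- The functional `x ↦ conj (f (θ x))`. -/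
noncomputable def starFun (f : Oq D q) : Uq D q →ₗ[ℂ] ℂ where
  toFun x := conj (ev D q (theta D q x) f)
  map_add' x y := by rw [map_add, ev_add_left, map_add]
  map_smul' c x := by
    rw [theta_smul, ev_smul_left, map_mul, Complex.conj_conj]
    rfl

theorem star_mem (f : Oq D q) : WithConv.toConv (starFun f) ∈ coeffSpan D q := by
  induction f using induction with
  | hc V i j => exact Submodule.subset_span ⟨V.conj, i, j, rfl⟩
  | h0 =>
    convert (coeffSpan D q).zero_mem
    ext x
    simp [starFun]
  | ha f g hf hg =>
    convert (coeffSpan D q).add_mem hf hg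
    ext x
    simp [starFun]
  | hs c f hf =>
    convert (coeffSpan D q).smul_mem (conj c) hf
    ext x
    simp [starFun]

/-- The `*`-structure dual to the compact real form: `f^* (x) = conj (f (S(x)^*))`. -/
noncomputable instance : Star (Oq D q) := ⟨fun f => ofFun (starFun f) (star_mem f)⟩

@[simp] theorem ev_star (x : Uq D q) (f : Oq D q) :
    ev D q x (star f) = conj (ev D q (theta D q x) f) := rfl

noncomputable instance : StarRing (Oq D q) where
  star_involutive f := ev_ext fun x => by simp
  star_add f g := ev_ext fun x => by simp
  star_mul f g := ev_ext fun x => by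
    let s := Coalgebra.Repr.arbitrary ℂ x
    let r : Coalgebra.Repr ℂ (theta D q x) _ :=
      { index := s.index
        left := fun i => theta D q (s.right i)
        right := fun i => theta D q (s.left i)
        eq := by rw [comul_theta, ← s.eq, map_sum]; simp }
    rw [ev_star, ev_mul _ f g r, ev_mul _ _ _ s, map_sum]
    refine Finset.sum_congr rfl fun i _ => ?_
    simp [r, mul_comm]

noncomputable instance : StarModule ℂ (Oq D q) where
  star_smul c f := ev_ext fun x => by simp

theorem ev_star' (x : Uq D q) (f : Oq D q) :
    ev D q x (star f) = conj (ev D q (star (HopfAlgebra.antipode ℂ x)) f) := by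
  rw [ev_star, theta_eq]

/-- The coproduct is a `*`-homomorphism. -/
theorem comul_star (f : Oq D q) :
    Coalgebra.comul (R := ℂ) (star f) = star (Coalgebra.comul (R := ℂ) f) := by
  have h : ∀ x y (t : Oq D q ⊗[ℂ] Oq D q),
      ev₂ x y (star t) = conj (ev₂ (theta D q x) (theta D q y) t) := by
    intro x y t
    induction t with
    | zero => simp
    | add a b ha hb => simp only [star_add, map_add, ha, hb]
    | tmul a b => simp
  refine ev₂_ext fun x y => ?_
  rw [h, ev₂_comul, ev₂_comul, ev_star, map_mul]

end Oq

end QuantumGroup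

namespace CQH

/-! ### Compact matrix quantum group algebras and homogeneous spaces -/

section HopfStar

variable (A : Type*) [Ring A] [HopfAlgebra ℂ A] [StarRing A] [StarModule ℂ A]

/-- A normalised bi-invariant functional. -/
structure IsHaar (h : A →ₗ[ℂ] ℂ) : Prop where
  map_one : h 1 = 1
  left_invariant : ∀ a, TensorProduct.rid ℂ A (h.lTensor A (Coalgebra.comul a)) = h a • (1 : A)
  right_invariant : ∀ a, TensorProduct.lid ℂ A (h.rTensor A (Coalgebra.comul a)) = h a • (1 : A)

open Classical in
/-- The Haar functional (zero if there is none). -/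
noncomputable def haar : A →ₗ[ℂ] ℂ := if h : ∃ f, IsHaar A f then h.choose else 0

/-- A compact matrix quantum group algebra: a finitely generated cosemisimple Hopf `*`-algebra whose
Haar functional is positive definite. Cosemisimplicity is the existence of the Haar functional. -/
structure IsCMQGA : Prop where
  comul_star : ∀ a : A, Coalgebra.comul (R := ℂ) (star a) = star (Coalgebra.comul (R := ℂ) a)
  finiteType : Algebra.FiniteType ℂ A
  exists_haar : ∃ h, IsHaar A h
  haar_pos : ∀ a : A, a ≠ 0 → ∃ r : ℝ, 0 < r ∧ haar A (star a * a) = r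

end HopfStar

section Homogeneous

variable (A H : Type*) [Ring A] [HopfAlgebra ℂ A] [StarRing A] [StarModule ℂ A]
  [Ring H] [HopfAlgebra ℂ H] [StarRing H] [StarModule ℂ H]

/-- A surjective Hopf `*`-algebra map `π : A → H` of compact matrix quantum group algebras. -/
structure HomogeneousSpace where
  π : A →ₐc[ℂ] H
  π_surjective : Function.Surjective π
  π_star : ∀ a, π (star a) = star (π a)
  isCMQGA_left : IsCMQGA A
  isCMQGA_right : IsCMQGA H

variable {A H} (X : HomogeneousSpace A H)

/-- The homogeneous right `H`-coaction `(id ⊗ π) ∘ Δ` on `A`. -/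
noncomputable def HomogeneousSpace.coaction : A →ₐ[ℂ] A ⊗[ℂ] H :=
  (Algebra.TensorProduct.map (AlgHom.id ℂ A) (X.π : A →ₐ[ℂ] H)).comp (Bialgebra.comulAlgHom ℂ A)

/-- The quantum homogeneous space `B = {b ∈ A | (id ⊗ π) Δ b = b ⊗ 1}`. -/
noncomputable def HomogeneousSpace.B : Subalgebra ℂ A :=
  AlgHom.equalizer X.coaction Algebra.TensorProduct.includeLeft

theorem HomogeneousSpace.mem_B {a : A} : a ∈ X.B ↔ X.coaction a = a ⊗ₜ 1 := Iff.rfl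

theorem HomogeneousSpace.star_mem {a : A} (ha : a ∈ X.B) : star a ∈ X.B := by
  have key : ∀ t : A ⊗[ℂ] A, Algebra.TensorProduct.map (AlgHom.id ℂ A) (X.π : A →ₐ[ℂ] H) (star t)
      = star (Algebra.TensorProduct.map (AlgHom.id ℂ A) (X.π : A →ₐ[ℂ] H) t) := by
    intro t
    induction t with
    | zero => simp
    | add s t hs ht => simp only [star_add, map_add, hs, ht]
    | tmul a b => simp [X.π_star]
  rw [X.mem_B] at ha ⊢
  change Algebra.TensorProduct.map (AlgHom.id ℂ A) (X.π : A →ₐ[ℂ] H)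
    (Coalgebra.comul (R := ℂ) (star a)) = _
  rw [X.isCMQGA_left.comul_star, key]
  change star (X.coaction a) = _
  rw [ha]
  simp

/-- The `*`-map of `B`. -/
def HomogeneousSpace.starB (b : X.B) : X.B := ⟨star (b : A), X.star_mem b.2⟩

end Homogeneous

/-! ### Comodules -/

section Comodules

variable {A : Type*} [Ring A] [HopfAlgebra ℂ A]
  {V W : Type*} [AddCommGroup V] [Module ℂ V] [AddCommGroup W] [Module ℂ W]

/-- `δ` is a left `A`-comodule structure. -/
structure IsCoaction (δ : V →ₗ[ℂ] A ⊗[ℂ] V) : Prop where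
  coassoc : ∀ v, TensorProduct.assoc ℂ A A V ((Coalgebra.comul (R := ℂ)).rTensor V (δ v)) =
    δ.lTensor A (δ v)
  counit : ∀ v, TensorProduct.lid ℂ V ((Coalgebra.counit (R := ℂ)).rTensor V (δ v)) = v

/-- `U` is a subcomodule. -/
def IsSubcomodule (δ : V →ₗ[ℂ] A ⊗[ℂ] V) (U : Submodule ℂ V) : Prop :=
  ∀ u ∈ U, δ u ∈ LinearMap.range (U.subtype.lTensor A)

/-- `U` is an irreducible subcomodule. -/
structure IsIrreducible (δ : V →ₗ[ℂ] A ⊗[ℂ] V) (U : Submodule ℂ V) : Prop where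
  isSubcomodule : IsSubcomodule δ U
  ne_bot : U ≠ ⊥
  eq_bot_or_eq : ∀ U' ≤ U, IsSubcomodule δ U' → U' = ⊥ ∨ U' = U

/-- The space `Hom^A(V, U)` of comodule maps into a subspace `U` of `W`. -/
def comoduleHom (ρ : V →ₗ[ℂ] A ⊗[ℂ] V) (δ : W →ₗ[ℂ] A ⊗[ℂ] W) (U : Submodule ℂ W) :
    Submodule ℂ (V →ₗ[ℂ] W) where
  carrier := {f | (∀ v, f v ∈ U) ∧ ∀ v, δ (f v) = f.lTensor A (ρ v)}
  zero_mem' := ⟨fun _ => U.zero_mem, fun v => by simp⟩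
  add_mem' := fun {f g} hf hg => ⟨fun v => U.add_mem (hf.1 v) (hg.1 v), fun v => by
    simp [hf.2, hg.2, LinearMap.lTensor_add]⟩
  smul_mem' := fun c f hf => ⟨fun v => U.smul_mem c (hf.1 v), fun v => by
    simp [hf.2, LinearMap.lTensor_smul]⟩

/-- `U` contains every irreducible comodule with multiplicity at most one. -/
def IsMultiplicityFree (δ : W →ₗ[ℂ] A ⊗[ℂ] W) (U : Submodule ℂ W) : Prop :=
  ∀ (V : Type) [AddCommGroup V] [Module ℂ V] (ρ : V →ₗ[ℂ] A ⊗[ℂ] V), IsCoaction ρ →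
    IsIrreducible ρ ⊤ → Module.rank ℂ (comoduleHom ρ δ U) ≤ 1

end Comodules

/-! ### Calculi, complex structures and Hermitian structures -/

section Calculi

variable {A H : Type*} [Ring A] [HopfAlgebra ℂ A] [StarRing A] [StarModule ℂ A]
  [Ring H] [HopfAlgebra ℂ H] [StarRing H] [StarModule ℂ H]

/-- A differential `*`-calculus `Ω` over `B`: the degree zero part is identified with `B` by `ι`. -/
structure StarCalculus (X : HomogeneousSpace A H) (Ω : Type*) [Ring Ω] [Algebra ℂ Ω] where
  deg : ℕ → Submodule ℂ Ω
  [gradedAlgebra : GradedAlgebra deg]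
  ι : X.B →ₐ[ℂ] Ω
  ι_injective : Function.Injective ι
  range_ι : LinearMap.range ι.toLinearMap = deg 0
  d : Ω →ₗ[ℂ] Ω
  d_mem : ∀ k, ∀ w ∈ deg k, d w ∈ deg (k + 1)
  d_d : ∀ w, d (d w) = 0
  d_mul : ∀ k, ∀ w ∈ deg k, ∀ v, d (w * v) = d w * v + (-1) ^ k * (w * d v)
  generated : Algebra.adjoin ℂ (Set.range ι ∪ Set.range fun b => d (ι b)) = ⊤
  starMap : Ω →ₗ⋆[ℂ] Ω
  starMap_starMap : ∀ w, starMap (starMap w) = w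
  starMap_ι : ∀ b, starMap (ι b) = ι (X.starB b)
  starMap_mul : ∀ k l, ∀ w ∈ deg k, ∀ v ∈ deg l, starMap (w * v) = (-1) ^ (k * l) * (starMap v * starMap w)
  starMap_d : ∀ w, starMap (d w) = d (starMap w)

attribute [instance] StarCalculus.gradedAlgebra

/-- The subspace `B⁺ Ω`, where `B⁺` is the kernel of the counit on `B`. -/
def StarCalculus.augmentation {X : HomogeneousSpace A H} {Ω : Type*} [Ring Ω] [Algebra ℂ Ω]
    (S : StarCalculus X Ω) : Submodule ℂ Ω :=
  Submodule.span ℂ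
    {v | ∃ (b : X.B) (w : Ω), Coalgebra.counit (R := ℂ) (b : A) = 0 ∧ v = S.ι b * w}

/-- A compact quantum calculus homogeneous space of total degree `m`. -/
structure CalculusSpace (X : HomogeneousSpace A H) (Ω : Type*) [Ring Ω] [Algebra ℂ Ω] (m : ℕ)
    extends StarCalculus X Ω where
  noZeroDivisors : NoZeroDivisors A
  δ : Ω →ₐ[ℂ] A ⊗[ℂ] Ω
  isCoaction : IsCoaction δ.toLinearMap
  /-- The coaction extends the restriction of the coproduct to `B`. -/
  δ_ι : ∀ b : X.B, ∃ t : A ⊗[ℂ] X.B, X.B.val.toLinearMap.lTensor A t = Coalgebra.comul (b : A) ∧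
    δ (ι b) = ι.toLinearMap.lTensor A t
  δ_d : ∀ w, δ (d w) = d.lTensor A (δ w)
  /-- `Ω B⁺ ⊆ B⁺ Ω`. -/
  mul_mem_augmentation : ∀ (b : X.B) (w : Ω), Coalgebra.counit (R := ℂ) (b : A) = 0 →
    w * ι b ∈ toStarCalculus.augmentation
  finiteDimensional : FiniteDimensional ℂ (Ω ⧸ toStarCalculus.augmentation)
  deg_top : deg m ≠ ⊥
  deg_gt : ∀ k, m < k → deg k = ⊥
  /-- The isomorphism `Ω^m ≃ B`. -/
  vol : deg m ≃ₗ[ℂ] X.B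
  vol_mul_left : ∀ (b : X.B) (w v : deg m), (v : Ω) = ι b * w → vol v = b * vol w
  vol_mul_right : ∀ (b : X.B) (w v : deg m), (v : Ω) = w * ι b → vol v = vol w * b
  vol_coaction : ∀ w : deg m, ∃ t : A ⊗[ℂ] deg m,
    (deg m).subtype.lTensor A t = δ w ∧
      δ (ι (vol w)) = (ι.toLinearMap ∘ₗ vol.toLinearMap).lTensor A t
  vol_starMap : ∀ w v : deg m, (v : Ω) = starMap w → vol v = X.starB (vol w)
  /-- The integral `haar ∘ vol` is closed. -/
  integral_d : ∀ k, k + 1 = m → ∀ w ∈ deg k, ∀ v : deg m, (v : Ω) = d w →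
    haar A (vol v : A) = 0

/-- A compact quantum homogeneous complex space. -/
structure ComplexSpace (X : HomogeneousSpace A H) (Ω : Type*) [Ring Ω] [Algebra ℂ Ω] (m : ℕ)
    extends CalculusSpace X Ω m where
  bideg : ℕ × ℕ → Submodule ℂ Ω
  [bigradedAlgebra : GradedAlgebra bideg]
  deg_eq : ∀ k, deg k = ⨆ (p : ℕ × ℕ) (_ : p.1 + p.2 = k), bideg p
  starMap_bideg : ∀ a b, ∀ w ∈ bideg (a, b), starMap w ∈ bideg (b, a)
  d_bideg : ∀ a b, ∀ w ∈ bideg (a, b), d w ∈ bideg (a + 1, b) ⊔ bideg (a, b + 1)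
  isSubcomodule_bideg : ∀ p, IsSubcomodule δ.toLinearMap (bideg p)

attribute [instance] ComplexSpace.bigradedAlgebra

section Dolbeault

variable {X : HomogeneousSpace A H} {Ω : Type*} [Ring Ω] [Algebra ℂ Ω] {m : ℕ}
  (S : ComplexSpace X Ω m)

/-- The operator that is `proj_{(a, b) + s} ∘ d` on `(a, b)`-forms. -/
noncomputable def ComplexSpace.component (s : ℕ × ℕ) : Ω →ₗ[ℂ] Ω :=
  DirectSum.toModule ℂ (ℕ × ℕ) Ω
      (fun p => GradedAlgebra.proj S.bideg (p + s) ∘ₗ S.d ∘ₗ (S.bideg p).subtype) ∘ₗ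
    (DirectSum.decomposeLinearEquiv S.bideg).toLinearMap

/-- The operator `∂`. -/
noncomputable def ComplexSpace.del : Ω →ₗ[ℂ] Ω := S.component (1, 0)

/-- The operator `∂̄`. -/
noncomputable def ComplexSpace.delbar : Ω →ₗ[ℂ] Ω := S.component (0, 1)

/-- Gelfand type: the comodule `Ω^{(0, k)}` is multiplicity-free for every `k`. -/
def ComplexSpace.IsGelfand : Prop :=
  ∀ k, IsMultiplicityFree S.δ.toLinearMap (S.bideg (0, k))

/-- Self-conjugacy: every irreducible subcomodule of `B` is closed under `*`. -/
def ComplexSpace.IsSelfConjugate : Prop :=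
  ∀ U ≤ S.deg 0, IsIrreducible S.δ.toLinearMap U → ∀ u ∈ U, S.starMap u ∈ U

end Dolbeault

/-- A covariant Hermitian structure on a complex space of total degree `2n`. -/
structure HermitianStructure {X : HomogeneousSpace A H} {Ω : Type*} [Ring Ω] [Algebra ℂ Ω] {n : ℕ}
    (S : ComplexSpace X Ω (2 * n)) where
  σ : Ω
  σ_mem : σ ∈ S.bideg (1, 1)
  starMap_σ : S.starMap σ = σ
  central : ∀ w, σ * w = w * σ
  coinvariant : S.δ σ = 1 ⊗ₜ σ
  lefschetz : ∀ k < n, Set.BijOn (fun w => σ ^ (n - k) * w) (S.deg k) (S.deg (2 * n - k))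

namespace HermitianStructure

variable {X : HomogeneousSpace A H} {Ω : Type*} [Ring Ω] [Algebra ℂ Ω] {n : ℕ}
  {S : ComplexSpace X Ω (2 * n)} (T : HermitianStructure S)

/-- `w` is a primitive form of bidegree `p`. -/
structure IsPrimitive (p : ℕ × ℕ) (w : Ω) : Prop where
  mem : w ∈ S.bideg p
  le : p.1 + p.2 ≤ n
  pow_mul : T.σ ^ (n - (p.1 + p.2) + 1) * w = 0

/-- The Weil formula, which characterises the Hodge map. -/
def IsHodge (f : Ω →ₗ[ℂ] Ω) : Prop :=
  ∀ (p : ℕ × ℕ) (w : Ω), T.IsPrimitive p w → ∀ j, j + (p.1 + p.2) ≤ n →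
    f (T.σ ^ j * w) =
      ((-1 : ℂ) ^ ((p.1 + p.2) * (p.1 + p.2 + 1) / 2) * Complex.I ^ ((p.1 : ℤ) - (p.2 : ℤ)) *
        ((j.factorial : ℂ) / ((n - j - (p.1 + p.2)).factorial : ℂ))) •
          (T.σ ^ (n - j - (p.1 + p.2)) * w)

open Classical in
/-- The Hodge map: the linear map given by the Weil formula. It exists and is unique by the
Lefschetz decomposition. -/
noncomputable def hodge : Ω →ₗ[ℂ] Ω := if h : ∃ f, T.IsHodge f then h.choose else 0

/-- The metric `g(w, v) = ∑ₖ *(*(wₖ^*) ∧ vₖ)`, as an element of `Ω⁰`. -/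
noncomputable def metric (w v : Ω) : Ω :=
  ∑ k ∈ Finset.range (2 * n + 1),
    T.hodge (T.hodge (S.starMap (GradedAlgebra.proj S.deg k w)) * GradedAlgebra.proj S.deg k v)

/-- The pairing `⟨w, v⟩ = haar (g(w, v))`. -/
noncomputable def inner (w v : Ω) : ℂ := haar A ((Function.invFun S.ι (T.metric w v) : X.B) : A)

/-- `g` is `†`-adjoint to `f`. -/
def IsAdjoint (f g : Ω →ₗ[ℂ] Ω) : Prop := ∀ w v, T.inner w (f v) = T.inner (g w) v

open Classical in
/-- The adjoint `∂̄†`. -/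
noncomputable def delbarAdj : Ω →ₗ[ℂ] Ω :=
  if h : ∃ g, T.IsAdjoint S.delbar g then h.choose else 0

/-- The Laplacian `Δ_∂̄ = (∂̄ + ∂̄†)²`. -/
noncomputable def laplacian : Module.End ℂ Ω := (S.delbar + T.delbarAdj) ^ 2

end HermitianStructure

/-- A compact quantum homogeneous Hermitian space. -/
structure HermitianSpace (X : HomogeneousSpace A H) (Ω : Type*) [Ring Ω] [Algebra ℂ Ω] (n : ℕ)
    extends ComplexSpace X Ω (2 * n), HermitianStructure toComplexSpace where
  vol_eq : ∀ w : deg (2 * n), ι (vol w) = toHermitianStructure.hodge w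
  /-- The metric is positive definite. -/
  positive : ∀ w : Ω, w ≠ 0 → toHermitianStructure.metric w w ≠ 0 ∧
    ∃ (l : ℕ) (c : Fin l → ℝ) (b : Fin l → X.B), (∀ i, 0 < c i) ∧
      toHermitianStructure.metric w w = ι (∑ i, (c i : ℂ) • (X.starB (b i) * b i))

end Calculi

end CQH

namespace QuantumGroup

/-! ### Highest weight vectors -/

section HighestWeight

variable {ι : Type*} [DecidableEq ι] {D : CartanDatum ι} {q : Parameter}
  {V : Type*} [AddCommGroup V] [Module ℂ V]

/-- The action `x ▷ v = ⟨S x, v₍₋₁₎⟩ v₍₀₎` of `U_q(𝔤)` on a left `𝒪_q(G)`-comodule. -/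
noncomputable def act (δ : V →ₗ[ℂ] Oq D q ⊗[ℂ] V) (x : Uq D q) : V →ₗ[ℂ] V :=
  (TensorProduct.lid ℂ V).toLinearMap ∘ₗ
    (Oq.ev D q (HopfAlgebra.antipode ℂ x)).rTensor V ∘ₗ δ

/-- A highest weight vector of weight `∑ μᵢ ϖᵢ`, where `(ϖᵢ, αⱼ) = δᵢⱼ dᵢ`. -/
structure IsHighestWeight (δ : V →ₗ[ℂ] Oq D q ⊗[ℂ] V) (v : V) : Prop where
  ne_zero : v ≠ 0
  E_act : ∀ i, act δ (Uq.E D q i) v = 0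
  K_act : ∃ μ : ι → ℤ, ∀ i, act δ (Uq.K D q i) v = (D.qi q i ^ μ i) • v

end HighestWeight

end QuantumGroup

/-!
# The Laplacian along rays of highest weight forms

The quantised enveloping algebra acts on an `O_q(G)`-comodule through `op δ x`, and this action
commutes with `∂`, `∂̄`, the Hodge map and hence with the adjoint `∂̄†`, which is `∗ ∘ ∂ ∘ ∗`
(`delbarAdj_apply`). Compatibility with the involution (`op_starMap`) makes the inner product
invariant for the compact real form (`isInvariantForm_innerₛₗ`), so that the module generated by a
highest weight vector is irreducible (`IsInvariantForm.eq_bot_or_eq`). If `v` and `w` are highest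
weight vectors of the same weight in `Ω^{(0, k)}`, the irreducible module generated by `(v, w)` has
two projections to `Ω^{(0, k)}`. By the Gelfand property these are linearly dependent, and `w` is a
multiple of `v` (`IsMaximal.exists_smul_of_gelfand`); taking adjoints, the same holds in
`Ω^{(k, 0)}`. As `z ^ l ω` is non-zero (`ι_mul_ne_zero`, since `O_q(G)` is a domain), it is an
eigenvector of the Laplacian, and the scalars `A`, `B`, `λ`, `ζ` exist.

For the eigenvalue, the twisted Leibniz rule evaluates `∂̄† (z ^ l ω)` and `∂̄ (z ^ l ∂̄† ω)` as
multiples of `z ^ l ∂̄† ω` and `z ^ l ∂̄ ∂̄† ω`. It remains to know that `z ^ l ω` is closed, that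
is, that `∂̄z ∧ ω` vanishes. Each `z ^ l ω` is closed or coclosed, and if `∂̄z ∧ ω ≠ 0` then
`l = 1`, `2`, `3` force `λ = ζ = -1` (`delbar_mul_eq_zero`).

On a self-conjugate space `z^*` is a lowest weight vector of the module generated by `z`. The
coaction of `z` has a leading term `a ⊗ z^*` with `a ≠ 0`, the other terms having different weights,
because the Cartan matrix is non-degenerate. Comparing leading terms, the relation `∂̄z z = ζ z ∂̄z`
passes to `z^*` (`twistedCommutator_lowest`). It is then compared with the adjoint of
`∂z z = λ z ∂z`, whence `ζ = λ⁻¹`.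
-/

namespace CQH

/-! ### Dolbeault operators -/

/-- If `x z = c z x` for `x = D z`, then `D (z ^ l v) = (l)_c z ^ (l - 1) x v + z ^ l D v`. For
`l = 0` the first summand vanishes because `(0)_c = 0`. -/
theorem derivation_pow_mul {R : Type*} [Ring R] [Algebra ℂ R] {D : R → R} {z : R} {c : ℂ}
    (hD : ∀ v, D (z * v) = D z * v + z * D v) (h : D z * z = c • (z * D z)) (l : ℕ) (v : R) :
    D (z ^ l * v) =
      QuantumGroup.quantumInt l c • (z ^ (l - 1) * (D z * v)) + z ^ l * D v := by
  have hpow : ∀ l, D z * z ^ l = c ^ l • (z ^ l * D z) := by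
    intro l
    induction l with
    | zero => simp
    | succ l ih =>
      rw [pow_succ', ← mul_assoc, h, smul_mul_assoc, mul_assoc, ih, mul_smul_comm, smul_smul,
        ← pow_succ', mul_assoc]
  induction l with
  | zero => simp [QuantumGroup.quantumInt]
  | succ l ih =>
    have e : z * (QuantumGroup.quantumInt l c • (z ^ (l - 1) * (D z * v))) =
        QuantumGroup.quantumInt l c • (z ^ l * (D z * v)) := by
      cases l with
      | zero => simp [QuantumGroup.quantumInt]
      | succ l => rw [mul_smul_comm, ← mul_assoc, ← pow_succ', Nat.add_sub_cancel]
    rw [pow_succ', mul_assoc, hD, ih, mul_add, e, ← mul_assoc (D z), hpow, smul_mul_assoc,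
      Nat.add_sub_cancel, show QuantumGroup.quantumInt (l + 1) c =
        QuantumGroup.quantumInt l c + c ^ l from Finset.sum_range_succ _ _, add_smul,
      mul_assoc (z ^ l), ← mul_assoc z]
    abel

section Dolbeault

variable {A H : Type*} [Ring A] [HopfAlgebra ℂ A] [StarRing A] [StarModule ℂ A]
  [Ring H] [HopfAlgebra ℂ H] [StarRing H] [StarModule ℂ H]
  {X : HomogeneousSpace A H} {Ω : Type*} [Ring Ω] [Algebra ℂ Ω] {m : ℕ} (S : ComplexSpace X Ω m)

namespace ComplexSpace

theorem proj_same {p : ℕ × ℕ} {w : Ω} (hw : w ∈ S.bideg p) :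
    GradedAlgebra.proj S.bideg p w = w := by
  rw [GradedAlgebra.proj_apply, DirectSum.decompose_of_mem_same _ hw]

theorem proj_ne {p r : ℕ × ℕ} {w : Ω} (hw : w ∈ S.bideg p) (h : p ≠ r) :
    GradedAlgebra.proj S.bideg r w = 0 := by
  rw [GradedAlgebra.proj_apply, DirectSum.decompose_of_mem_ne _ hw h]

theorem proj_mem (p : ℕ × ℕ) (w : Ω) : GradedAlgebra.proj S.bideg p w ∈ S.bideg p := by
  rw [GradedAlgebra.proj_apply]
  exact SetLike.coe_mem _

/-- Every additive statement about forms may be checked on forms of pure bidegree. -/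
theorem bideg_induction {C : Ω → Prop} (h0 : C 0) (hadd : ∀ w v, C w → C v → C (w + v))
    (h : ∀ p, ∀ w ∈ S.bideg p, C w) (w : Ω) : C w :=
  DirectSum.Decomposition.inductionOn S.bideg h0 (fun {p} w => h p w w.2) hadd w

theorem linearMap_eq_of_bideg {M : Type*} [AddCommGroup M] {f g : Ω → M}
    (hf : ∀ w v, f (w + v) = f w + f v) (hg : ∀ w v, g (w + v) = g w + g v)
    (h : ∀ p, ∀ w ∈ S.bideg p, f w = g w) (w : Ω) : f w = g w := by
  refine S.bideg_induction (C := fun w => f w = g w) ?_ ?_ h w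
  · have h1 := hf 0 0
    have h2 := hg 0 0
    simp only [add_zero, left_eq_add] at h1 h2
    rw [h1, h2]
  · intro w v h1 h2
    rw [hf, hg, h1, h2]

theorem bideg_le_deg (p : ℕ × ℕ) : S.bideg p ≤ S.deg (p.1 + p.2) := by
  rw [S.deg_eq]
  exact le_iSup₂_of_le p rfl le_rfl

theorem mul_mem_bideg {p r : ℕ × ℕ} {w v : Ω} (hw : w ∈ S.bideg p) (hv : v ∈ S.bideg r) :
    w * v ∈ S.bideg (p + r) := SetLike.mul_mem_graded hw hv

theorem deg_zero_eq : S.deg 0 = S.bideg (0, 0) := by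
  rw [S.deg_eq]
  refine le_antisymm (iSup₂_le fun p hp => ?_) (le_iSup₂_of_le (0, 0) rfl le_rfl)
  obtain ⟨a, b⟩ := p
  obtain rfl : a = 0 := by simp only at hp; omega
  obtain rfl : b = 0 := by simp only at hp; omega
  exact le_rfl

theorem ι_mem_deg (b : X.B) : S.ι b ∈ S.deg 0 := by
  rw [← S.range_ι]
  exact ⟨b, rfl⟩

theorem ι_mem (b : X.B) : S.ι b ∈ S.bideg (0, 0) := S.deg_zero_eq ▸ S.ι_mem_deg b

theorem mem_range_ι {w : Ω} (hw : w ∈ S.bideg (0, 0)) : ∃ b, S.ι b = w := by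
  rw [← S.deg_zero_eq, ← S.range_ι] at hw
  exact hw

theorem ι_mul_mem {p : ℕ × ℕ} {w : Ω} (b : X.B) (hw : w ∈ S.bideg p) :
    S.ι b * w ∈ S.bideg p := by
  simpa only [Prod.mk_zero_zero, zero_add] using S.mul_mem_bideg (S.ι_mem b) hw

theorem mul_ι_mem {p : ℕ × ℕ} {w : Ω} (hw : w ∈ S.bideg p) (b : X.B) :
    w * S.ι b ∈ S.bideg p := by
  simpa only [Prod.mk_zero_zero, add_zero] using S.mul_mem_bideg hw (S.ι_mem b)

theorem ι_pow_mul_mem {p : ℕ × ℕ} {w : Ω} (b : X.B) (hw : w ∈ S.bideg p) (l : ℕ) :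
    S.ι b ^ l * w ∈ S.bideg p := by
  rw [← map_pow]
  exact S.ι_mul_mem _ hw

theorem bideg_eq_bot {p : ℕ × ℕ} (h : m < p.1 + p.2) : S.bideg p = ⊥ :=
  le_bot_iff.mp ((S.bideg_le_deg p).trans (S.deg_gt _ h).le)

theorem component_apply (s p : ℕ × ℕ) {w : Ω} (hw : w ∈ S.bideg p) :
    S.component s w = GradedAlgebra.proj S.bideg (p + s) (S.d w) := by
  have e : DirectSum.decompose S.bideg w =
      DirectSum.lof ℂ (ℕ × ℕ) (fun p => S.bideg p) p ⟨w, hw⟩ := DirectSum.decompose_of_mem _ hw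
  rw [component, LinearMap.comp_apply]
  change DirectSum.toModule ℂ (ℕ × ℕ) Ω _ (DirectSum.decompose S.bideg w) = _
  rw [e, DirectSum.toModule_lof]
  rfl

theorem del_apply {p : ℕ × ℕ} {w : Ω} (hw : w ∈ S.bideg p) :
    S.del w = GradedAlgebra.proj S.bideg (p + (1, 0)) (S.d w) := S.component_apply _ _ hw

theorem delbar_apply {p : ℕ × ℕ} {w : Ω} (hw : w ∈ S.bideg p) :
    S.delbar w = GradedAlgebra.proj S.bideg (p + (0, 1)) (S.d w) := S.component_apply _ _ hw

theorem del_mem {p : ℕ × ℕ} {w : Ω} (hw : w ∈ S.bideg p) : S.del w ∈ S.bideg (p + (1, 0)) := by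
  rw [S.del_apply hw]
  exact S.proj_mem _ _

theorem delbar_mem {p : ℕ × ℕ} {w : Ω} (hw : w ∈ S.bideg p) :
    S.delbar w ∈ S.bideg (p + (0, 1)) := by
  rw [S.delbar_apply hw]
  exact S.proj_mem _ _

theorem d_eq (w : Ω) : S.d w = S.del w + S.delbar w := by
  refine S.linearMap_eq_of_bideg (f := S.d) (g := fun w => S.del w + S.delbar w)
    (by simp) (by intro w v; simp only [map_add]; abel) (fun p w hw => ?_) w
  obtain ⟨x, hx, y, hy, hxy⟩ := Submodule.mem_sup.mp (S.d_bideg p.1 p.2 w hw)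
  have hne : (p.1 + 1, p.2) ≠ (p.1, p.2 + 1) := by simp
  have e1 : p + (1, 0) = (p.1 + 1, p.2) := rfl
  have e2 : p + (0, 1) = (p.1, p.2 + 1) := rfl
  simp only [S.del_apply hw, S.delbar_apply hw, ← hxy, map_add, e1, e2, S.proj_same hx,
    S.proj_same hy, S.proj_ne hx hne, S.proj_ne hy hne.symm]
  abel

/-- If `w = x + y` with `x` of bidegree `p` and `y` of a different bidegree, the component of `w`
in bidegree `p` is `x`. -/
theorem proj_add {p r : ℕ × ℕ} {x y : Ω} (hx : x ∈ S.bideg p) (hy : y ∈ S.bideg r) (h : r ≠ p) :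
    GradedAlgebra.proj S.bideg p (x + y) = x := by
  rw [map_add, S.proj_same hx, S.proj_ne hy h, add_zero]

theorem d_mul_bideg {p : ℕ × ℕ} {w : Ω} (hw : w ∈ S.bideg p) (v : Ω) :
    S.d (w * v) = S.d w * v + (-1) ^ (p.1 + p.2) * (w * S.d v) :=
  S.d_mul _ _ (S.bideg_le_deg p hw) v

theorem neg_one_pow_mul_mem {p : ℕ × ℕ} {w : Ω} (k : ℕ) (hw : w ∈ S.bideg p) :
    (-1) ^ k * w ∈ S.bideg p := by
  rcases neg_one_pow_eq_or Ω k with h | h <;> rw [h]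
  · simpa using hw
  · simpa using hw

/-- The Leibniz rules for `∂` and `∂̄` are the two components of the one for `d`. -/
theorem del_mul_and_delbar_mul {p : ℕ × ℕ} {w : Ω} (hw : w ∈ S.bideg p) (v : Ω) :
    S.del (w * v) = S.del w * v + (-1) ^ (p.1 + p.2) * (w * S.del v) ∧
    S.delbar (w * v) = S.delbar w * v + (-1) ^ (p.1 + p.2) * (w * S.delbar v) := by
  refine S.bideg_induction (C := fun v =>
    S.del (w * v) = S.del w * v + (-1) ^ (p.1 + p.2) * (w * S.del v) ∧
    S.delbar (w * v) = S.delbar w * v + (-1) ^ (p.1 + p.2) * (w * S.delbar v)) (by simp) ?_ ?_ v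
  · rintro v v' ⟨h1, h2⟩ ⟨h3, h4⟩
    constructor
    · simp only [mul_add, map_add, h1, h3]
      abel
    · simp only [mul_add, map_add, h2, h4]
      abel
  · intro r v hv
    have e := S.d_mul_bideg hw v
    rw [S.d_eq w, S.d_eq v] at e
    have m1 : S.del w * v + (-1) ^ (p.1 + p.2) * (w * S.del v) ∈ S.bideg (p + r + (1, 0)) := by
      refine add_mem ?_ (S.neg_one_pow_mul_mem _ ?_)
      · convert S.mul_mem_bideg (S.del_mem hw) hv using 2
        abel
      · convert S.mul_mem_bideg hw (S.del_mem hv) using 2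
        abel
    have m2 : S.delbar w * v + (-1) ^ (p.1 + p.2) * (w * S.delbar v) ∈
        S.bideg (p + r + (0, 1)) := by
      refine add_mem ?_ (S.neg_one_pow_mul_mem _ ?_)
      · convert S.mul_mem_bideg (S.delbar_mem hw) hv using 2
        abel
      · convert S.mul_mem_bideg hw (S.delbar_mem hv) using 2
        abel
    have hne : p + r + (0, 1) ≠ p + r + (1, 0) := by simp
    have hwv := S.mul_mem_bideg hw hv
    constructor
    · rw [S.del_apply hwv, e, ← S.proj_add m1 m2 hne]
      congr 1
      simp only [add_mul, mul_add]
      abel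
    · rw [S.delbar_apply hwv, e, ← S.proj_add m2 m1 hne.symm]
      congr 1
      simp only [add_mul, mul_add]
      abel

theorem del_mul {p : ℕ × ℕ} {w : Ω} (hw : w ∈ S.bideg p) (v : Ω) :
    S.del (w * v) = S.del w * v + (-1) ^ (p.1 + p.2) * (w * S.del v) :=
  (S.del_mul_and_delbar_mul hw v).1

theorem delbar_mul {p : ℕ × ℕ} {w : Ω} (hw : w ∈ S.bideg p) (v : Ω) :
    S.delbar (w * v) = S.delbar w * v + (-1) ^ (p.1 + p.2) * (w * S.delbar v) :=
  (S.del_mul_and_delbar_mul hw v).2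

theorem del_ι_mul (b : X.B) (v : Ω) : S.del (S.ι b * v) = S.del (S.ι b) * v + S.ι b * S.del v := by
  simpa using S.del_mul (S.ι_mem b) v

theorem delbar_ι_mul (b : X.B) (v : Ω) :
    S.delbar (S.ι b * v) = S.delbar (S.ι b) * v + S.ι b * S.delbar v := by
  simpa using S.delbar_mul (S.ι_mem b) v

theorem delbar_delbar (w : Ω) : S.delbar (S.delbar w) = 0 := by
  refine S.linearMap_eq_of_bideg (f := fun w => S.delbar (S.delbar w)) (g := fun _ => (0 : Ω))
    (by simp) (by simp) (fun p w hw => ?_) w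
  have e := S.d_d w
  rw [S.d_eq w, map_add, S.d_eq, S.d_eq (S.delbar w)] at e
  have h1 := S.del_mem (S.del_mem hw)
  have h2 := S.delbar_mem (S.del_mem hw)
  have h3 := S.del_mem (S.delbar_mem hw)
  have h4 := S.delbar_mem (S.delbar_mem hw)
  have := congrArg (GradedAlgebra.proj S.bideg (p + (0, 1) + (0, 1))) e
  simp only [map_add, map_zero] at this
  rw [S.proj_ne h1 (by simp [add_assoc]), S.proj_ne h2 (by simp [add_assoc]),
    S.proj_ne h3 (by simp [add_assoc]), S.proj_same h4] at this
  simpa using this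

theorem starMap_mem {p : ℕ × ℕ} {w : Ω} (hw : w ∈ S.bideg p) : S.starMap w ∈ S.bideg p.swap :=
  S.starMap_bideg p.1 p.2 w hw

theorem starMap_proj (p : ℕ × ℕ) (w : Ω) :
    S.starMap (GradedAlgebra.proj S.bideg p w) =
      GradedAlgebra.proj S.bideg p.swap (S.starMap w) := by
  refine S.linearMap_eq_of_bideg (f := fun w => S.starMap (GradedAlgebra.proj S.bideg p w))
    (g := fun w => GradedAlgebra.proj S.bideg p.swap (S.starMap w)) (by simp) (by simp)
    (fun r w hw => ?_) w
  by_cases h : r = p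
  · subst h
    simp only [S.proj_same hw, S.proj_same (S.starMap_mem hw)]
  · have h' : r.swap ≠ p.swap := fun e => h (Prod.swap_injective e)
    simp only [S.proj_ne hw h, S.proj_ne (S.starMap_mem hw) h', map_zero]

theorem starMap_del (w : Ω) : S.starMap (S.del w) = S.delbar (S.starMap w) := by
  refine S.linearMap_eq_of_bideg (f := fun w => S.starMap (S.del w))
    (g := fun w => S.delbar (S.starMap w)) (by simp) (by simp) (fun p w hw => ?_) w
  rw [S.del_apply hw, S.starMap_proj, S.starMap_d, S.delbar_apply (S.starMap_mem hw)]
  rfl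

theorem starMap_delbar (w : Ω) : S.starMap (S.delbar w) = S.del (S.starMap w) := by
  rw [← S.starMap_starMap w, ← S.starMap_del, S.starMap_starMap, S.starMap_starMap]

theorem starMap_ι_mul (b : X.B) (w : Ω) :
    S.starMap (S.ι b * w) = S.starMap w * S.ι (X.starB b) := by
  refine S.linearMap_eq_of_bideg (f := fun w => S.starMap (S.ι b * w))
    (g := fun w => S.starMap w * S.ι (X.starB b)) (by simp [mul_add]) (by simp [add_mul])
    (fun p w hw => ?_) w
  rw [S.starMap_mul 0 _ _ (S.ι_mem_deg b) w (S.bideg_le_deg p hw), S.starMap_ι]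
  simp

theorem starMap_mul_ι (w : Ω) (b : X.B) :
    S.starMap (w * S.ι b) = S.ι (X.starB b) * S.starMap w := by
  refine S.linearMap_eq_of_bideg (f := fun w => S.starMap (w * S.ι b))
    (g := fun w => S.ι (X.starB b) * S.starMap w) (by simp [add_mul]) (by simp [mul_add])
    (fun p w hw => ?_) w
  rw [S.starMap_mul _ 0 w (S.bideg_le_deg p hw) _ (S.ι_mem_deg b), S.starMap_ι]
  simp

theorem starMap_injective : Function.Injective S.starMap := fun w v h => by
  rw [← S.starMap_starMap w, h, S.starMap_starMap]

theorem starB_starB (b : X.B) : X.starB (X.starB b) = b := Subtype.ext (star_star (b : A))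

end ComplexSpace

end Dolbeault

end CQH

namespace CQH

/-! ### Lefschetz decomposition and the Hodge map -/

section Hodge

variable {A H : Type*} [Ring A] [HopfAlgebra ℂ A] [StarRing A] [StarModule ℂ A]
  [Ring H] [HopfAlgebra ℂ H] [StarRing H] [StarModule ℂ H]
  {X : HomogeneousSpace A H} {Ω : Type*} [Ring Ω] [Algebra ℂ Ω] {n : ℕ}
  {S : ComplexSpace X Ω (2 * n)} (T : HermitianStructure S)

namespace HermitianStructure

theorem σ_pow_mem (j : ℕ) : T.σ ^ j ∈ S.bideg (j, j) := by
  have h := SetLike.pow_mem_graded (A := S.bideg) j T.σ_mem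
  have e : j • ((1, 1) : ℕ × ℕ) = (j, j) := by simp
  rwa [e] at h

theorem σ_pow_mul_mem {p : ℕ × ℕ} {w : Ω} (j : ℕ) (hw : w ∈ S.bideg p) :
    T.σ ^ j * w ∈ S.bideg (p + (j, j)) := by
  rw [add_comm]
  exact S.mul_mem_bideg (T.σ_pow_mem j) hw

theorem σ_pow_comm (j : ℕ) (w : Ω) : T.σ ^ j * w = w * T.σ ^ j :=
  (Commute.pow_left (show Commute T.σ w from T.central w) j).eq

theorem proj_σ_pow_mul_of_le {p : ℕ × ℕ} {j : ℕ} (h : (j, j) ≤ p) (w : Ω) :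
    GradedAlgebra.proj S.bideg p (T.σ ^ j * w) =
      T.σ ^ j * GradedAlgebra.proj S.bideg (p - (j, j)) w := by
  simp only [GradedAlgebra.proj_apply]
  exact DirectSum.coe_decompose_mul_of_left_mem_of_le S.bideg (T.σ_pow_mem j) h

theorem proj_σ_pow_mul_of_not_le {p : ℕ × ℕ} {j : ℕ} (h : ¬ (j, j) ≤ p) (w : Ω) :
    GradedAlgebra.proj S.bideg p (T.σ ^ j * w) = 0 := by
  simp only [GradedAlgebra.proj_apply]
  exact DirectSum.coe_decompose_mul_of_left_mem_of_not_le S.bideg (T.σ_pow_mem j) h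

/-- The span of the forms `σ ^ j w` of bidegree `p` with `w` primitive and in the range where the
Weil formula applies. -/
def lefschetzSpan (p : ℕ × ℕ) : Submodule ℂ Ω :=
  Submodule.span ℂ {v | ∃ (j : ℕ) (r : ℕ × ℕ) (w : Ω), T.IsPrimitive r w ∧ j + (r.1 + r.2) ≤ n ∧
    r + (j, j) = p ∧ T.σ ^ j * w = v}

/-- The Lefschetz decomposition below the middle degree: `σ ^ (n - k + 1) w = σ ^ (n - k + 2) u` for
some `u`, so that `w - σ u` is primitive. -/
theorem bideg_le_lefschetzSpan_of_le (k : ℕ) :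
    ∀ p : ℕ × ℕ, p.1 + p.2 = k → k ≤ n → S.bideg p ≤ T.lefschetzSpan p := by
  induction k using Nat.strong_induction_on with
  | _ k ih =>
    intro p hp hk w hw
    have prim : T.σ ^ (n - k + 1) * w = 0 → w ∈ T.lefschetzSpan p := fun h =>
      Submodule.subset_span ⟨0, p, w, ⟨hw, by omega, by rw [hp, h]⟩, by omega, by simp, by simp⟩
    by_cases hk2 : k < 2
    · apply prim
      have h1 := T.σ_pow_mul_mem (n - k + 1) hw
      rw [S.bideg_eq_bot (by simp only [Prod.fst_add, Prod.snd_add]; omega)] at h1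
      exact (Submodule.mem_bot ℂ).mp h1
    · have h1 : T.σ ^ (n - k + 1) * w ∈ S.deg (2 * n - (k - 2)) := by
        have h2 := S.bideg_le_deg _ (T.σ_pow_mul_mem (n - k + 1) hw)
        convert h2 using 2
        simp only [Prod.fst_add, Prod.snd_add]
        omega
      obtain ⟨u, -, hu⟩ := (T.lefschetz (k - 2) (by omega)).surjOn h1
      have e1 : n - (k - 2) = n - k + 1 + 1 := by omega
      simp only [e1] at hu
      have h3 := congrArg (GradedAlgebra.proj S.bideg (p + (n - k + 1, n - k + 1))) hu
      rw [S.proj_same (T.σ_pow_mul_mem (n - k + 1) hw)] at h3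
      by_cases hle : (1, 1) ≤ p
      · obtain ⟨r, rfl⟩ := exists_add_of_le hle
        simp only [Prod.fst_add, Prod.snd_add] at hp
        have e2 : (1, 1) + r + (n - k + 1, n - k + 1) - (n - k + 1 + 1, n - k + 1 + 1) = r := by
          ext <;> simp <;> omega
        have hle2 : (n - k + 1 + 1, n - k + 1 + 1) ≤ (1, 1) + r + (n - k + 1, n - k + 1) := by
          constructor <;> simp
        rw [T.proj_σ_pow_mul_of_le hle2, e2] at h3
        set v := GradedAlgebra.proj S.bideg r u
        have hv : v ∈ S.bideg r := S.proj_mem r u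
        have hσv : T.σ ^ 1 * v ∈ S.bideg (r + (1, 1)) := T.σ_pow_mul_mem 1 hv
        rw [pow_one, add_comm] at hσv
        have a1 : w - T.σ * v ∈ T.lefschetzSpan ((1, 1) + r) := by
          refine Submodule.subset_span ⟨0, _, w - T.σ * v, ⟨sub_mem hw hσv, ?_, ?_⟩, ?_, ?_, ?_⟩
          · simp only [Prod.fst_add, Prod.snd_add]; omega
          · simp only [Prod.fst_add, Prod.snd_add, hp]
            rw [mul_sub, ← mul_assoc, ← pow_succ, h3, sub_self]
          · simp only [Prod.fst_add, Prod.snd_add]; omega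
          · simp
          · simp
        have a2 : T.lefschetzSpan r ≤
            (T.lefschetzSpan ((1, 1) + r)).comap (LinearMap.mulLeft ℂ T.σ) := by
          refine Submodule.span_le.mpr ?_
          rintro _ ⟨j, r', w', hw', hj, rfl, rfl⟩
          simp only [Prod.fst_add, Prod.snd_add] at hp
          refine Submodule.subset_span ⟨j + 1, r', w', hw', by omega, ?_, ?_⟩
          · ext <;> simp <;> omega
          · rw [LinearMap.mulLeft_apply, ← mul_assoc, ← pow_succ']
        have a3 : v ∈ T.lefschetzSpan r := ih (k - 2) (by omega) r (by omega) (by omega) hv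
        have := add_mem a1 (a2 a3)
        simpa using this
      · apply prim
        rw [T.proj_σ_pow_mul_of_not_le] at h3
        · exact h3.symm
        · intro h
          apply hle
          have h4 : n - k + 1 + 1 ≤ p.1 + (n - k + 1) := h.1
          have h5 : n - k + 1 + 1 ≤ p.2 + (n - k + 1) := h.2
          constructor <;> simp only <;> omega

/-- The Lefschetz decomposition. -/
theorem bideg_le_lefschetzSpan (p : ℕ × ℕ) : S.bideg p ≤ T.lefschetzSpan p := by
  intro w hw
  rcases le_or_gt (p.1 + p.2) n with h | h
  · exact T.bideg_le_lefschetzSpan_of_le _ p rfl h hw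
  rcases lt_or_ge (2 * n) (p.1 + p.2) with h' | h'
  · rw [S.bideg_eq_bot h'] at hw
    rw [(Submodule.mem_bot ℂ).mp hw]
    exact zero_mem _
  have hw' := S.bideg_le_deg p hw
  obtain ⟨k, hk⟩ : ∃ k, p.1 + p.2 = k := ⟨_, rfl⟩
  rw [hk] at h h' hw'
  obtain ⟨u, -, hu⟩ := (T.lefschetz (2 * n - k) (by omega)).surjOn
    (show w ∈ S.deg (2 * n - (2 * n - k)) by rwa [Nat.sub_sub_self h'])
  have e1 : n - (2 * n - k) = k - n := by omega
  simp only [e1] at hu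
  have h3 := congrArg (GradedAlgebra.proj S.bideg p) hu
  rw [S.proj_same hw] at h3
  by_cases hle : (k - n, k - n) ≤ p
  · obtain ⟨r, rfl⟩ := exists_add_of_le hle
    simp only [Prod.fst_add, Prod.snd_add] at hk
    rw [T.proj_σ_pow_mul_of_le hle, add_tsub_cancel_left] at h3
    have hv := T.bideg_le_lefschetzSpan_of_le _ r rfl (by omega) (S.proj_mem r u)
    have a2 : T.lefschetzSpan r ≤ (T.lefschetzSpan ((k - n, k - n) + r)).comap
        (LinearMap.mulLeft ℂ (T.σ ^ (k - n))) := by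
      refine Submodule.span_le.mpr ?_
      rintro _ ⟨j, r', w', hw', hj, rfl, rfl⟩
      simp only [Prod.fst_add, Prod.snd_add] at hk
      refine Submodule.subset_span ⟨k - n + j, r', w', hw', by omega, ?_, ?_⟩
      · ext <;> simp <;> omega
      · rw [LinearMap.mulLeft_apply, ← mul_assoc, ← pow_add]
    rw [← h3]
    exact a2 hv
  · rw [T.proj_σ_pow_mul_of_not_le hle] at h3
    rw [← h3]
    exact zero_mem _

/-- An additive property of forms of bidegree `p` may be checked on the forms `σ ^ j w` with `w`
primitive. -/
theorem lefschetz_induction {C : Ω → Prop} {p : ℕ × ℕ} (h0 : C 0)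
    (hadd : ∀ w v, C w → C v → C (w + v))
    (h : ∀ (j : ℕ) (r : ℕ × ℕ) (w : Ω), T.IsPrimitive r w → j + (r.1 + r.2) ≤ n →
      r + (j, j) = p → C (T.σ ^ j * w)) {w : Ω} (hw : w ∈ S.bideg p) : C w := by
  refine Submodule.closure_induction (p := fun v _ => C v) h0 (fun x y _ _ => hadd x y) ?_
    (T.bideg_le_lefschetzSpan p hw)
  rintro c _ ⟨j, r, w, hw, hj, hr, rfl⟩
  rw [← mul_smul_comm]
  refine h j r (c • w) ⟨Submodule.smul_mem _ _ hw.mem, hw.le, ?_⟩ hj hr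
  rw [mul_smul_comm, hw.pow_mul, smul_zero]

theorem le_of_mem_bideg (T : HermitianStructure S) {p : ℕ × ℕ} {w : Ω} (hw : w ∈ S.bideg p)
    (h0 : w ≠ 0) :
    p.1 ≤ n ∧ p.2 ≤ n := by
  by_contra hp
  apply h0
  refine T.lefschetz_induction (C := fun w => w = 0) rfl (fun w v h1 h2 => by rw [h1, h2, add_zero])
    (fun j r w _ hj hr => ?_) hw
  subst hr
  exfalso
  apply hp
  simp only [Prod.fst_add, Prod.snd_add]
  omega

variable {T}

theorem isHodge_hodge (hT : ∃ f, T.IsHodge f) : T.IsHodge T.hodge := by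
  rw [hodge, dif_pos hT]
  exact hT.choose_spec

/-- A semilinear map that commutes with multiplication by powers of `σ`, is compatible with a
map of bidegrees preserving the Weil scalars and sends primitive forms to primitive forms commutes
with the Hodge map. -/
theorem hodge_comm (hT : ∃ f, T.IsHodge f) {τ : ℂ →+* ℂ} {f : Ω →ₛₗ[τ] Ω} {s : ℕ × ℕ → ℕ × ℕ}
    (hs : ∀ r, (s r).1 + (s r).2 = r.1 + r.2)
    (hτ : ∀ r : ℕ × ℕ, τ (Complex.I ^ ((r.1 : ℤ) - r.2)) =
      Complex.I ^ (((s r).1 : ℤ) - (s r).2))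
    (hf : ∀ r, ∀ w ∈ S.bideg r, f w ∈ S.bideg (s r))
    (hσ : ∀ j w, f (T.σ ^ j * w) = T.σ ^ j * f w) (w : Ω) :
    T.hodge (f w) = f (T.hodge w) := by
  refine S.linearMap_eq_of_bideg (f := fun w => T.hodge (f w)) (g := fun w => f (T.hodge w))
    (by simp) (by simp) (fun p w hw => ?_) w
  refine T.lefschetz_induction (C := fun w => T.hodge (f w) = f (T.hodge w)) (by simp)
    (fun w v h1 h2 => by simp only [map_add, h1, h2]) (fun j r w h hj _ => ?_) hw
  have h' : T.IsPrimitive (s r) (f w) :=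
    ⟨hf r w h.mem, by rw [hs]; exact h.le, by rw [hs, ← hσ, h.pow_mul, map_zero]⟩
  have e1 := isHodge_hodge hT r w h j hj
  have e2 := isHodge_hodge hT (s r) (f w) h' j (by rw [hs]; exact hj)
  rw [hσ, e2, e1, LinearMap.map_smulₛₗ, hσ, hs]
  congr 1
  simp only [map_mul, map_div₀, map_pow, map_neg, map_one, map_natCast, hτ]

theorem hodge_hodge (hT : ∃ f, T.IsHodge f) {p : ℕ × ℕ} {w : Ω} (hw : w ∈ S.bideg p) :
    T.hodge (T.hodge w) = (-1 : ℂ) ^ (p.1 + p.2) • w := by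
  refine T.lefschetz_induction (C := fun w => T.hodge (T.hodge w) = (-1 : ℂ) ^ (p.1 + p.2) • w)
    (by simp) (fun w v h1 h2 => by simp only [map_add, h1, h2, smul_add])
    (fun j r w h hj hr => ?_) hw
  have e1 := isHodge_hodge hT r w h j hj
  have e2 := isHodge_hodge hT r w h (n - j - (r.1 + r.2)) (by omega)
  have e3 : n - (n - j - (r.1 + r.2)) - (r.1 + r.2) = j := by omega
  rw [e3] at e2
  rw [e1, map_smul, e2, smul_smul]
  congr 1
  have h1 : ((-1 : ℂ) ^ ((r.1 + r.2) * (r.1 + r.2 + 1) / 2)) *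
      (-1) ^ ((r.1 + r.2) * (r.1 + r.2 + 1) / 2) = 1 := by rw [← mul_pow]; simp
  have h2 : (Complex.I ^ ((r.1 : ℤ) - r.2)) * Complex.I ^ ((r.1 : ℤ) - r.2) =
      (-1) ^ (p.1 + p.2) := by
    rw [← mul_zpow, Complex.I_mul_I, ← hr, zpow_sub₀ (by norm_num)]
    simp only [Prod.fst_add, Prod.snd_add, zpow_natCast, pow_add]
    rcases neg_one_pow_eq_or ℂ j with h | h <;> rcases neg_one_pow_eq_or ℂ r.2 with h' | h' <;>
      rcases neg_one_pow_eq_or ℂ r.1 with h'' | h'' <;> rw [h, h', h''] <;> norm_num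
  have h3 : ((j.factorial : ℂ)) ≠ 0 := by exact_mod_cast j.factorial_ne_zero
  have h4 : (((n - j - (r.1 + r.2)).factorial : ℂ)) ≠ 0 := by
    exact_mod_cast (n - j - (r.1 + r.2)).factorial_ne_zero
  have h5 : ((j.factorial : ℂ) / (n - j - (r.1 + r.2)).factorial) *
      ((n - j - (r.1 + r.2)).factorial / j.factorial) = 1 := by field_simp
  rw [← h2]
  linear_combination (Complex.I ^ ((r.1 : ℤ) - r.2)) ^ 2 * h1 +
    (Complex.I ^ ((r.1 : ℤ) - r.2)) ^ 2 *
    ((-1 : ℂ) ^ ((r.1 + r.2) * (r.1 + r.2 + 1) / 2)) ^ 2 * h5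

theorem hodge_mem (hT : ∃ f, T.IsHodge f) {p : ℕ × ℕ} {w : Ω} (hw : w ∈ S.bideg p) :
    T.hodge w ∈ S.bideg (n - p.2, n - p.1) := by
  refine T.lefschetz_induction (C := fun w => T.hodge w ∈ S.bideg (n - p.2, n - p.1))
    (by simp) (fun w v h1 h2 => by rw [map_add]; exact add_mem h1 h2)
    (fun j r w h hj hr => ?_) hw
  rw [isHodge_hodge hT r w h j hj]
  refine Submodule.smul_mem _ _ ?_
  convert T.σ_pow_mul_mem (n - j - (r.1 + r.2)) h.mem using 2
  subst hr
  ext <;> simp <;> omega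

theorem eq_zero_of_hodge_eq_zero (hT : ∃ f, T.IsHodge f) {p : ℕ × ℕ} {w : Ω}
    (hw : w ∈ S.bideg p) (h : T.hodge w = 0) : w = 0 := by
  have := hodge_hodge hT hw
  rw [h, map_zero, eq_comm, smul_eq_zero] at this
  exact this.resolve_left (pow_ne_zero _ (by norm_num))

theorem hodge_ι_mul (hT : ∃ f, T.IsHodge f) (b : X.B) (w : Ω) :
    T.hodge (S.ι b * w) = S.ι b * T.hodge w :=
  hodge_comm hT (f := LinearMap.mulLeft ℂ (S.ι b)) (s := id) (fun _ => rfl) (fun _ => rfl)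
    (fun _ _ hw => S.ι_mul_mem b hw)
    (fun j w => by
      simp only [LinearMap.mulLeft_apply]
      rw [← mul_assoc, ← T.σ_pow_comm, mul_assoc]) w

theorem hodge_mul_ι (hT : ∃ f, T.IsHodge f) (w : Ω) (b : X.B) :
    T.hodge (w * S.ι b) = T.hodge w * S.ι b :=
  hodge_comm hT (f := LinearMap.mulRight ℂ (S.ι b)) (s := id) (fun _ => rfl) (fun _ => rfl)
    (fun _ _ hw => S.mul_ι_mem hw b)
    (fun j w => by simp only [LinearMap.mulRight_apply, mul_assoc]) w

theorem starMap_σ_pow_mul (j : ℕ) (w : Ω) : S.starMap (T.σ ^ j * w) = T.σ ^ j * S.starMap w := by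
  have h1 : ∀ w, S.starMap (T.σ * w) = T.σ * S.starMap w := by
    intro w
    refine S.linearMap_eq_of_bideg (f := fun w => S.starMap (T.σ * w))
      (g := fun w => T.σ * S.starMap w) (by simp [mul_add]) (by simp [mul_add])
      (fun p w hw => ?_) w
    rw [S.starMap_mul _ _ _ (S.bideg_le_deg _ T.σ_mem) w (S.bideg_le_deg p hw), T.starMap_σ,
      ← T.central, Even.neg_one_pow ((show Even (1 + 1) by decide).mul_right _), one_mul]
  induction j with
  | zero => simp
  | succ j ih => rw [pow_succ', mul_assoc, h1, ih, mul_assoc]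

theorem hodge_starMap (hT : ∃ f, T.IsHodge f) (w : Ω) :
    T.hodge (S.starMap w) = S.starMap (T.hodge w) :=
  hodge_comm hT (f := S.starMap) (s := Prod.swap) (fun _ => add_comm _ _)
    (fun r => by
      rw [map_zpow₀, Complex.conj_I, Prod.fst_swap, Prod.snd_swap, ← Complex.inv_I, inv_zpow',
        neg_sub])
    (fun _ _ hw => S.starMap_mem hw) T.starMap_σ_pow_mul w

end HermitianStructure

end Hodge

end CQH

namespace CQH

/-! ### The metric and the adjoint of `∂̄` -/

section Metric

variable {A H : Type*} [Ring A] [HopfAlgebra ℂ A] [StarRing A] [StarModule ℂ A]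
  [Ring H] [HopfAlgebra ℂ H] [StarRing H] [StarModule ℂ H]
  {X : HomogeneousSpace A H} {Ω : Type*} [Ring Ω] [Algebra ℂ Ω]

namespace ComplexSpace

variable {m : ℕ} (S : ComplexSpace X Ω m)

theorem projDeg_same {k : ℕ} {w : Ω} (hw : w ∈ S.deg k) : GradedAlgebra.proj S.deg k w = w := by
  rw [GradedAlgebra.proj_apply, DirectSum.decompose_of_mem_same _ hw]

theorem projDeg_ne {k l : ℕ} {w : Ω} (hw : w ∈ S.deg k) (h : k ≠ l) :
    GradedAlgebra.proj S.deg l w = 0 := by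
  rw [GradedAlgebra.proj_apply, DirectSum.decompose_of_mem_ne _ hw h]

theorem projDeg_mem (k : ℕ) (w : Ω) : GradedAlgebra.proj S.deg k w ∈ S.deg k := by
  rw [GradedAlgebra.proj_apply]
  exact SetLike.coe_mem _

theorem deg_eq_zero {k : ℕ} {w : Ω} (h : m < k) (hw : w ∈ S.deg k) : w = 0 := by
  rw [S.deg_gt k h] at hw
  exact (Submodule.mem_bot ℂ).mp hw

/-- A semilinear map that sends forms of bidegree `p` into `N` for all `p` of total degree `k`
sends `k`-forms into `N`. -/
theorem map_deg_mem {τ : ℂ →+* ℂ} (f : Ω →ₛₗ[τ] Ω) {N : Submodule ℂ Ω} {k : ℕ}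
    (h : ∀ p : ℕ × ℕ, p.1 + p.2 = k → ∀ w ∈ S.bideg p, f w ∈ N) {w : Ω} (hw : w ∈ S.deg k) :
    f w ∈ N := by
  have : S.deg k ≤ N.comap f := by
    rw [S.deg_eq]
    exact iSup₂_le fun p hp w hw => h p hp w hw
  exact this hw

theorem starMap_mem_deg {k : ℕ} {w : Ω} (hw : w ∈ S.deg k) : S.starMap w ∈ S.deg k :=
  S.map_deg_mem S.starMap (fun p hp w hw => by
    have := S.bideg_le_deg _ (S.starMap_mem hw)
    rwa [Prod.fst_swap, Prod.snd_swap, add_comm, hp] at this) hw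

theorem del_mem_deg {k : ℕ} {w : Ω} (hw : w ∈ S.deg k) : S.del w ∈ S.deg (k + 1) :=
  S.map_deg_mem S.del (fun p hp w hw => by
    convert S.bideg_le_deg _ (S.del_mem hw) using 2
    simp only [Prod.fst_add, Prod.snd_add]
    omega) hw

theorem mul_mem_deg {k l : ℕ} {w v : Ω} (hw : w ∈ S.deg k) (hv : v ∈ S.deg l) :
    w * v ∈ S.deg (k + l) := SetLike.mul_mem_graded hw hv

/-- A linear left inverse of the inclusion of `B`, followed by the Haar functional. -/
noncomputable def haarForm : Ω →ₗ[ℂ] ℂ :=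
  haar A ∘ₗ X.B.val.toLinearMap ∘ₗ
    (S.ι.toLinearMap.exists_leftInverse_of_injective
      (LinearMap.ker_eq_bot.mpr S.ι_injective)).choose

theorem haarForm_ι (b : X.B) : S.haarForm (S.ι b) = haar A (b : A) := by
  have h := (S.ι.toLinearMap.exists_leftInverse_of_injective
    (LinearMap.ker_eq_bot.mpr S.ι_injective)).choose_spec
  have := LinearMap.congr_fun h b
  simp only [LinearMap.comp_apply, AlgHom.toLinearMap_apply, LinearMap.id_apply] at this
  simp only [haarForm, LinearMap.comp_apply, this]
  rfl

end ComplexSpace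

namespace HermitianStructure

variable {n : ℕ} {S : ComplexSpace X Ω (2 * n)} {T : HermitianStructure S}

theorem hodge_mem_deg (hT : ∃ f, T.IsHodge f) {k : ℕ} {w : Ω} (hw : w ∈ S.deg k) :
    T.hodge w ∈ S.deg (2 * n - k) :=
  S.map_deg_mem T.hodge (fun p hp w hw => by
    by_cases h0 : w = 0
    · simp [h0]
    have := T.le_of_mem_bideg hw h0
    convert S.bideg_le_deg _ (hodge_mem hT hw) using 2
    simp only
    omega) hw

theorem deg_top_le (T : HermitianStructure S) : S.deg (2 * n) ≤ S.bideg (n, n) := by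
  rw [S.deg_eq]
  refine iSup₂_le fun p hp w hw => ?_
  by_cases h0 : w = 0
  · simp [h0]
  have := T.le_of_mem_bideg hw h0
  convert hw using 2
  ext <;> simp only <;> omega

theorem metric_of_mem {k : ℕ} {w v : Ω} (hw : w ∈ S.deg k) (hv : v ∈ S.deg k) :
    T.metric w v = T.hodge (T.hodge (S.starMap w) * v) := by
  rcases lt_or_ge (2 * n) k with h | h
  · simp [S.deg_eq_zero h hw, metric]
  rw [metric, Finset.sum_eq_single k]
  · rw [S.projDeg_same hw, S.projDeg_same hv]
  · intro l _ hl
    rw [S.projDeg_ne hw hl.symm]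
    simp
  · intro h'
    exact absurd (Finset.mem_range.mpr (by omega)) h'

theorem metric_of_ne {k l : ℕ} {w v : Ω} (hw : w ∈ S.deg k) (hv : v ∈ S.deg l) (h : k ≠ l) :
    T.metric w v = 0 := by
  rw [metric]
  refine Finset.sum_eq_zero fun j _ => ?_
  by_cases hj : k = j
  · rw [S.projDeg_ne hv (by omega), mul_zero, map_zero]
  · rw [S.projDeg_ne hw hj]
    simp

theorem metric_add_left (w w' v : Ω) : T.metric (w + w') v = T.metric w v + T.metric w' v := by
  simp [metric, add_mul, Finset.sum_add_distrib]

theorem metric_add_right (w v v' : Ω) : T.metric w (v + v') = T.metric w v + T.metric w v' := by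
  simp [metric, mul_add, Finset.sum_add_distrib]

theorem metric_smul_left (c : ℂ) (w v : Ω) : T.metric (c • w) v = conj c • T.metric w v := by
  simp [metric, Finset.smul_sum, LinearMap.map_smulₛₗ]

theorem metric_smul_right (c : ℂ) (w v : Ω) : T.metric w (c • v) = c • T.metric w v := by
  simp [metric, Finset.smul_sum]

theorem metric_mem (hT : ∃ f, T.IsHodge f) (w v : Ω) : ∃ b, S.ι b = T.metric w v := by
  refine S.mem_range_ι ?_
  rw [metric, ← S.deg_zero_eq]
  refine sum_mem fun k hk => ?_
  have hk' : k < 2 * n + 1 := Finset.mem_range.mp hk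
  have h1 := hodge_mem_deg hT (S.mul_mem_deg
    (hodge_mem_deg hT (S.starMap_mem_deg (S.projDeg_mem k w))) (S.projDeg_mem k v))
  convert h1 using 2
  omega

theorem projDeg_mul_ι (k : ℕ) (w : Ω) (b : X.B) :
    GradedAlgebra.proj S.deg k (w * S.ι b) = GradedAlgebra.proj S.deg k w * S.ι b := by
  refine S.linearMap_eq_of_bideg (f := fun w => GradedAlgebra.proj S.deg k (w * S.ι b))
    (g := fun w => GradedAlgebra.proj S.deg k w * S.ι b) (by simp [add_mul]) (by simp [add_mul])
    (fun r w hw => ?_) w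
  have h1 := S.bideg_le_deg _ hw
  have h2 := S.bideg_le_deg _ (S.mul_ι_mem hw b)
  by_cases h : r.1 + r.2 = k
  · subst h
    simp only [S.projDeg_same h1, S.projDeg_same h2]
  · simp only [S.projDeg_ne h1 h, S.projDeg_ne h2 h, zero_mul]

theorem metric_mul_ι (hT : ∃ f, T.IsHodge f) (w v : Ω) (b c : X.B) :
    T.metric (w * S.ι b) (v * S.ι c) = S.ι (X.starB b) * T.metric w v * S.ι c := by
  simp only [metric, Finset.mul_sum, Finset.sum_mul]
  refine Finset.sum_congr rfl fun k _ => ?_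
  rw [projDeg_mul_ι, projDeg_mul_ι, S.starMap_mul_ι, hodge_ι_mul hT, ← mul_assoc, hodge_mul_ι hT,
    mul_assoc (S.ι (X.starB b)), hodge_ι_mul hT]

theorem inner_eq (hT : ∃ f, T.IsHodge f) (w v : Ω) :
    T.inner w v = S.haarForm (T.metric w v) := by
  obtain ⟨b, hb⟩ := metric_mem hT w v
  rw [inner, ← hb, Function.leftInverse_invFun S.ι_injective b, S.haarForm_ι]

end HermitianStructure

namespace HermitianSpace

variable {n : ℕ} (S : HermitianSpace X Ω n)

/-- Without a Hodge map the metric would be zero, contradicting positivity. -/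
theorem exists_isHodge : ∃ f, S.IsHodge f := by
  by_contra h
  have h0 : S.hodge = 0 := dif_neg h
  have h1 : ∀ w : Ω, w = 0 := fun w => by
    by_contra hw
    apply (S.positive w hw).1
    simp [HermitianStructure.metric, h0]
  exact h ⟨0, fun p w _ j _ => by rw [h1 (_ • _)]; rfl⟩

/-- The inner product as a sesquilinear map, conjugate-linear in the first argument. -/
noncomputable def innerₛₗ : Ω →ₗ⋆[ℂ] Ω →ₗ[ℂ] ℂ :=
  LinearMap.mk₂'ₛₗ (starRingEnd ℂ) (RingHom.id ℂ) S.inner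
    (fun w w' v => by
      simp only [HermitianStructure.inner_eq S.exists_isHodge, HermitianStructure.metric_add_left,
        map_add])
    (fun c w v => by
      simp only [HermitianStructure.inner_eq S.exists_isHodge, HermitianStructure.metric_smul_left,
        map_smul, smul_eq_mul])
    (fun w v v' => by
      simp only [HermitianStructure.inner_eq S.exists_isHodge, HermitianStructure.metric_add_right,
        map_add])
    (fun c w v => by
      simp only [HermitianStructure.inner_eq S.exists_isHodge, HermitianStructure.metric_smul_right,
        map_smul, smul_eq_mul, RingHom.id_apply])

theorem innerₛₗ_apply (w v : Ω) : S.innerₛₗ w v = S.inner w v := rfl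

theorem innerₛₗ_eq (w v : Ω) : S.innerₛₗ w v = S.haarForm (S.metric w v) :=
  HermitianStructure.inner_eq S.exists_isHodge w v

theorem innerₛₗ_pos (w : Ω) (hw : w ≠ 0) : ∃ r : ℝ, 0 < r ∧ S.innerₛₗ w w = r := by
  obtain ⟨h0, l, c, b, hc, h⟩ := S.positive w hw
  have h1 : ∀ i, ∃ r : ℝ, 0 ≤ r ∧ haar A (star (b i : A) * b i) = r ∧ (b i ≠ 0 → 0 < r) := by
    intro i
    by_cases hb : b i = 0
    · exact ⟨0, le_rfl, by simp [hb], fun h => absurd hb h⟩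
    · obtain ⟨r, hr, e⟩ := X.isCMQGA_left.haar_pos (b i : A) (by simpa using hb)
      exact ⟨r, hr.le, e, fun _ => hr⟩
  choose r hr0 hre hrp using h1
  have e : S.innerₛₗ w w = ((∑ i, c i * r i : ℝ) : ℂ) := by
    rw [S.innerₛₗ_eq, h, S.haarForm_ι]
    push_cast
    simp only [HomogeneousSpace.starB, map_sum, map_smul, hre, smul_eq_mul]
  refine ⟨_, ?_, e⟩
  have : ∃ i, b i ≠ 0 := by
    by_contra hb
    push Not at hb
    apply h0
    rw [h]
    simp [hb]
  obtain ⟨i, hi⟩ := this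
  exact Finset.sum_pos' (fun j _ => mul_nonneg (hc j).le (hr0 j))
    ⟨i, Finset.mem_univ i, mul_pos (hc i) (hrp i hi)⟩

theorem eq_of_innerₛₗ_eq {w w' : Ω} (h : ∀ v, S.innerₛₗ w v = S.innerₛₗ w' v) : w = w' := by
  by_contra hne
  obtain ⟨r, hr, e⟩ := S.innerₛₗ_pos (w - w') (sub_ne_zero.mpr hne)
  rw [LinearMap.map_sub S.innerₛₗ, LinearMap.sub_apply, h, sub_self] at e
  exact hr.ne (by exact_mod_cast e)

/-! ### Zero divisors -/

/-- Right multiplication by a non-zero element of `B` is injective on forms, because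
`g(w b, w b) = b^* g(w, w) b` and `A` is a domain. -/
theorem mul_ι_ne_zero {w : Ω} (hw : w ≠ 0) {b : X.B} (hb : b ≠ 0) : w * S.ι b ≠ 0 := by
  intro h
  have := S.noZeroDivisors
  have e := HermitianStructure.metric_mul_ι S.exists_isHodge w w b b
  obtain ⟨c, hc⟩ := HermitianStructure.metric_mem S.exists_isHodge w w
  have hc0 : c ≠ 0 := by
    rintro rfl
    exact (S.positive w hw).1 (by rw [← hc, map_zero])
  have e0 : S.metric (0 : Ω) 0 = 0 := by simp [HermitianStructure.metric]
  rw [h, e0, ← hc, ← map_mul, ← map_mul, eq_comm, map_eq_zero_iff _ S.ι_injective] at e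
  have e' : star (b : A) * c * b = 0 := congrArg Subtype.val e
  have hb' : (b : A) ≠ 0 := by simpa using hb
  have hc' : (c : A) ≠ 0 := by simpa using hc0
  exact mul_ne_zero (mul_ne_zero (star_ne_zero.mpr hb') hc') hb' e'

/-- Left multiplication by a non-zero element of `B` is injective on forms: apply `*` to the
corresponding statement about right multiplication. -/
theorem ι_mul_ne_zero {w : Ω} (hw : w ≠ 0) {b : X.B} (hb : b ≠ 0) : S.ι b * w ≠ 0 := by
  intro h
  have h1 := S.starMap_ι_mul b w
  rw [h, map_zero] at h1
  refine S.mul_ι_ne_zero (w := S.starMap w) (b := X.starB b) ?_ ?_ h1.symm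
  · rwa [ne_eq, map_eq_zero_iff _ S.starMap_injective]
  · intro hb0
    apply hb
    rw [← ComplexSpace.starB_starB b, hb0]
    exact Subtype.ext (star_zero A)

theorem ι_pow_mul_ne_zero {w : Ω} (hw : w ≠ 0) {b : X.B} (hb : b ≠ 0) (l : ℕ) :
    S.ι b ^ l * w ≠ 0 := by
  induction l with
  | zero => simpa
  | succ l ih =>
    rw [pow_succ', mul_assoc]
    exact S.ι_mul_ne_zero ih hb

/-! ### The adjoint of `∂̄` and the Laplacian -/

theorem haarForm_hodge_d {k : ℕ} (hk : k + 1 = 2 * n) {t : Ω} (ht : t ∈ S.deg k) :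
    S.haarForm (S.hodge (S.d t)) = 0 := by
  have h1 := S.d_mem k t ht
  rw [hk] at h1
  have h2 := S.vol_eq ⟨S.d t, h1⟩
  simp only at h2
  rw [← h2, S.haarForm_ι]
  exact S.integral_d k hk t ht ⟨S.d t, h1⟩ rfl

/-- Forms of top degree have bidegree `(n, n)`, so that on forms of degree `2n - 1` the integral of
`∂̄` is either zero or the integral of `d`. -/
theorem haarForm_hodge_delbar {p : ℕ × ℕ} (hp : p.1 + p.2 + 1 = 2 * n) {t : Ω}
    (ht : t ∈ S.bideg p) : S.haarForm (S.hodge (S.delbar t)) = 0 := by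
  by_cases h : p + (0, 1) = (n, n)
  · have h1 := S.d_mem _ t (S.bideg_le_deg p ht)
    rw [hp] at h1
    rw [S.delbar_apply ht, h, S.proj_same (S.deg_top_le h1)]
    exact S.haarForm_hodge_d hp (S.bideg_le_deg p ht)
  · have h0 : S.delbar t = 0 := by
      by_contra hne
      have := S.le_of_mem_bideg (S.delbar_mem ht) hne
      simp only [Prod.fst_add, Prod.snd_add] at this
      apply h
      ext <;> simp <;> omega
    rw [h0, map_zero, map_zero]

theorem isAdjoint_delbar : S.IsAdjoint S.delbar (S.hodge ∘ₗ S.del ∘ₗ S.hodge) := by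
  have hT := S.exists_isHodge
  intro w v
  rw [← S.innerₛₗ_apply, ← S.innerₛₗ_apply]
  refine S.linearMap_eq_of_bideg (f := fun w => S.innerₛₗ w (S.delbar v))
    (g := fun w => S.innerₛₗ ((S.hodge ∘ₗ S.del ∘ₗ S.hodge) w) v) (by simp) (by simp)
    (fun p w hw => ?_) w
  refine S.linearMap_eq_of_bideg (f := fun v => S.innerₛₗ w (S.delbar v))
    (g := fun v => S.innerₛₗ ((S.hodge ∘ₗ S.del ∘ₗ S.hodge) w) v) (by simp) (by simp)
    (fun r v hv => ?_) v
  simp only [LinearMap.comp_apply]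
  by_cases hw0 : w = 0
  · simp [hw0]
  obtain ⟨hp1, hp2⟩ := S.le_of_mem_bideg hw hw0
  have dw := S.bideg_le_deg p hw
  have dv := S.bideg_le_deg r hv
  have dv' : S.delbar v ∈ S.deg (r.1 + r.2 + 1) := S.bideg_le_deg _ (S.delbar_mem hv)
  have dg := HermitianStructure.hodge_mem_deg hT
    (S.del_mem_deg (HermitianStructure.hodge_mem_deg hT dw))
  rw [S.innerₛₗ_eq, S.innerₛₗ_eq]
  by_cases hdeg : p.1 + p.2 = r.1 + r.2 + 1
  · have e1 : 2 * n - (2 * n - (p.1 + p.2) + 1) = r.1 + r.2 := by omega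
    rw [e1] at dg
    rw [HermitianStructure.metric_of_mem dw (hdeg ▸ dv'), HermitianStructure.metric_of_mem dg dv,
      ← HermitianStructure.hodge_starMap hT, S.starMap_del,
      ← HermitianStructure.hodge_starMap hT]
    have hα := HermitianStructure.hodge_mem hT (S.starMap_mem hw)
    simp only [Prod.fst_swap, Prod.snd_swap] at hα
    set α := S.hodge (S.starMap w)
    rw [HermitianStructure.hodge_hodge hT (S.delbar_mem hα)]
    have e2 := S.haarForm_hodge_delbar (by simp only [Prod.fst_add, Prod.snd_add]; omega)
      (S.mul_mem_bideg hα hv)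
    rw [S.delbar_mul hα, map_add, map_add] at e2
    simp only [Prod.fst_add, Prod.snd_add, add_zero]
    rw [smul_mul_assoc, map_smul, map_smul, smul_eq_mul, ← add_assoc, pow_succ]
    rcases Nat.even_or_odd (n - p.1 + (n - p.2)) with h | h
    · rw [h.neg_one_pow, one_mul] at e2
      rw [h.neg_one_pow]
      linear_combination e2
    · rw [h.neg_one_pow, neg_one_mul, map_neg, map_neg] at e2
      rw [h.neg_one_pow]
      linear_combination -e2
  · rw [HermitianStructure.metric_of_ne dw dv' hdeg]
    by_cases hp0 : p.1 + p.2 = 0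
    · have : S.del (S.hodge w) = 0 := S.deg_eq_zero (by omega)
        (S.del_mem_deg (HermitianStructure.hodge_mem_deg hT dw))
      simp [this, HermitianStructure.metric]
    · rw [HermitianStructure.metric_of_ne dg dv (by omega)]

theorem inner_delbar (w v : Ω) : S.innerₛₗ w (S.delbar v) = S.innerₛₗ (S.delbarAdj w) v := by
  have h : ∃ g, S.IsAdjoint S.delbar g := ⟨_, S.isAdjoint_delbar⟩
  rw [HermitianStructure.delbarAdj, dif_pos h]
  exact h.choose_spec w v

/-- The adjoint of `∂̄` is `∗ ∘ ∂ ∘ ∗`. The sign is `+1` because the metric pairs `∗(w^*)` with `v`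
in this order. -/
theorem delbarAdj_apply (w : Ω) : S.delbarAdj w = S.hodge (S.del (S.hodge w)) :=
  S.eq_of_innerₛₗ_eq fun v => by
    rw [← S.inner_delbar]
    exact S.isAdjoint_delbar w v

theorem delbarAdj_delbarAdj (w : Ω) : S.delbarAdj (S.delbarAdj w) = 0 :=
  S.eq_of_innerₛₗ_eq fun v => by
    rw [← S.inner_delbar, ← S.inner_delbar, S.delbar_delbar, map_zero, map_zero,
      LinearMap.zero_apply]

theorem delbarAdj_mem {a b : ℕ} {w : Ω} (hw : w ∈ S.bideg (a, b + 1)) :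
    S.delbarAdj w ∈ S.bideg (a, b) := by
  have hT := S.exists_isHodge
  by_cases hw0 : w = 0
  · simp [hw0]
  obtain ⟨h1, h2⟩ := S.le_of_mem_bideg hw hw0
  simp only at h1 h2
  rw [S.delbarAdj_apply]
  convert HermitianStructure.hodge_mem hT (S.del_mem (HermitianStructure.hodge_mem hT hw)) using 2
  ext <;> simp <;> omega

theorem laplacian_apply (w : Ω) :
    S.laplacian w = S.delbar (S.delbarAdj w) + S.delbarAdj (S.delbar w) := by
  rw [HermitianStructure.laplacian, pow_two, Module.End.mul_apply]
  simp only [LinearMap.add_apply, map_add, S.delbar_delbar, S.delbarAdj_delbarAdj]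
  abel

theorem delbarAdj_ι_mul (b : X.B) (w : Ω) :
    S.delbarAdj (S.ι b * w) = S.hodge (S.del (S.ι b) * S.hodge w) + S.ι b * S.delbarAdj w := by
  have hT := S.exists_isHodge
  rw [S.delbarAdj_apply, S.delbarAdj_apply, HermitianStructure.hodge_ι_mul hT, S.del_ι_mul, map_add,
    HermitianStructure.hodge_ι_mul hT]

theorem delbarAdj_eq_zero_of_delbar_delbarAdj {w : Ω} (h : S.delbar (S.delbarAdj w) = 0) :
    S.delbarAdj w = 0 := by
  by_contra hne
  obtain ⟨r, hr, e⟩ := S.innerₛₗ_pos _ hne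
  rw [← S.inner_delbar, h, map_zero] at e
  exact hr.ne (by exact_mod_cast e)

theorem delbarAdj_ne_zero {v : Ω} (h : S.delbar v ≠ 0) : S.delbarAdj (S.delbar v) ≠ 0 := by
  intro h0
  obtain ⟨r, hr, e⟩ := S.innerₛₗ_pos _ h
  rw [S.inner_delbar, h0, map_zero, LinearMap.zero_apply] at e
  exact hr.ne (by exact_mod_cast e)

end HermitianSpace

end Metric

end CQH

namespace QuantumGroup

/-! ### The right action of `U_q(𝔤)` on comodules -/

section Operators

variable {ι : Type*} [DecidableEq ι] {D : CartanDatum ι} {q : Parameter}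
  {V W : Type*} [AddCommGroup V] [Module ℂ V] [AddCommGroup W] [Module ℂ W]

/-- Contraction `a ⊗ v ↦ ⟨x, a⟩ v`. -/
noncomputable def contract (V : Type*) [AddCommGroup V] [Module ℂ V] (x : Uq D q) :
    Oq D q ⊗[ℂ] V →ₗ[ℂ] V :=
  (TensorProduct.lid ℂ V).toLinearMap ∘ₗ (Oq.ev D q x).rTensor V

@[simp] theorem contract_tmul (x : Uq D q) (a : Oq D q) (v : V) :
    contract V x (a ⊗ₜ v) = Oq.ev D q x a • v := by simp [contract]

/-- The operator `v ↦ ⟨x, v₍₋₁₎⟩ v₍₀₎`. It is a right action of `U_q(𝔤)`; the left action `act` is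
its composition with the antipode. -/
noncomputable def op (δ : V →ₗ[ℂ] Oq D q ⊗[ℂ] V) (x : Uq D q) : V →ₗ[ℂ] V := contract V x ∘ₗ δ

theorem op_apply (δ : V →ₗ[ℂ] Oq D q ⊗[ℂ] V) (x : Uq D q) (v : V) :
    op δ x v = contract V x (δ v) := rfl

theorem act_eq (δ : V →ₗ[ℂ] Oq D q ⊗[ℂ] V) (x : Uq D q) :
    act δ x = op δ (HopfAlgebra.antipode ℂ x) := rfl

theorem contract_add_left (x y : Uq D q) (t : Oq D q ⊗[ℂ] V) :
    contract V (x + y) t = contract V x t + contract V y t := by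
  induction t with
  | zero => simp
  | add s t hs ht => simp only [map_add, hs, ht]; abel
  | tmul a v => simp [Oq.ev_add_left, add_smul]

theorem contract_smul_left (c : ℂ) (x : Uq D q) (t : Oq D q ⊗[ℂ] V) :
    contract V (c • x) t = c • contract V x t := by
  induction t with
  | zero => simp
  | add s t hs ht => simp only [map_add, hs, ht, smul_add]
  | tmul a v => simp [Oq.ev_smul_left, mul_smul]

theorem op_add_left (δ : V →ₗ[ℂ] Oq D q ⊗[ℂ] V) (x y : Uq D q) (v : V) :
    op δ (x + y) v = op δ x v + op δ y v := contract_add_left x y _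

theorem op_smul_left (δ : V →ₗ[ℂ] Oq D q ⊗[ℂ] V) (c : ℂ) (x : Uq D q) (v : V) :
    op δ (c • x) v = c • op δ x v := contract_smul_left c x _

/-- The orbit map `x ↦ op δ x v`. -/
noncomputable def orbit (δ : V →ₗ[ℂ] Oq D q ⊗[ℂ] V) (v : V) : Uq D q →ₗ[ℂ] V where
  toFun x := op δ x v
  map_add' x y := op_add_left δ x y v
  map_smul' c x := op_smul_left δ c x v

@[simp] theorem orbit_apply (δ : V →ₗ[ℂ] Oq D q ⊗[ℂ] V) (v : V) (x : Uq D q) :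
    orbit δ v x = op δ x v := rfl

theorem contract_lTensor (f : V →ₗ[ℂ] W) (x : Uq D q) (t : Oq D q ⊗[ℂ] V) :
    contract W x (f.lTensor _ t) = f (contract V x t) := by
  induction t with
  | zero => simp
  | add s t hs ht => simp only [map_add, hs, ht]
  | tmul a v => simp

theorem op_map {δ : V →ₗ[ℂ] Oq D q ⊗[ℂ] V} {δ' : W →ₗ[ℂ] Oq D q ⊗[ℂ] W} {f : V →ₗ[ℂ] W} {v : V}
    (h : δ' (f v) = f.lTensor _ (δ v)) (x : Uq D q) : op δ' x (f v) = f (op δ x v) := by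
  rw [op_apply, h, contract_lTensor, op_apply]

theorem op_one {δ : V →ₗ[ℂ] Oq D q ⊗[ℂ] V} (hδ : CQH.IsCoaction δ) (v : V) : op δ 1 v = v :=
  hδ.counit v

theorem op_mul {δ : V →ₗ[ℂ] Oq D q ⊗[ℂ] V} (hδ : CQH.IsCoaction δ) (x y : Uq D q) (v : V) :
    op δ (x * y) v = op δ y (op δ x v) := by
  have h1 : ∀ t : Oq D q ⊗[ℂ] V, op δ y (contract V x t) =
      contract V y (contract (Oq D q ⊗[ℂ] V) x (δ.lTensor _ t)) := by
    intro t
    induction t with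
    | zero => simp
    | add s t hs ht => simp only [map_add, hs, ht]
    | tmul a v => simp [op_apply]
  have h2 : ∀ t : Oq D q ⊗[ℂ] V, contract V y (contract (Oq D q ⊗[ℂ] V) x
      (TensorProduct.assoc ℂ _ _ V ((Coalgebra.comul (R := ℂ)).rTensor V t))) =
      contract V (x * y) t := by
    intro t
    induction t with
    | zero => simp
    | add s t hs ht => simp only [map_add, hs, ht]
    | tmul a v =>
      rw [LinearMap.rTensor_tmul, contract_tmul, ← Oq.ev₂_comul]
      induction Coalgebra.comul (R := ℂ) a with
      | zero => simp
      | add s t hs ht => simp only [TensorProduct.add_tmul, map_add, hs, ht, add_smul]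
      | tmul a b => simp [mul_smul]
  rw [op_apply δ x, h1, ← hδ.coassoc, h2, op_apply]

theorem finiteDimensional_orbit (δ : V →ₗ[ℂ] Oq D q ⊗[ℂ] V) (v : V) :
    FiniteDimensional ℂ (LinearMap.range (orbit δ v)) := by
  have key : ∀ t : Oq D q ⊗[ℂ] V, ∃ N : Submodule ℂ V, FiniteDimensional ℂ N ∧
      ∀ x, contract V x t ∈ N := by
    intro t
    induction t with
    | zero => exact ⟨⊥, inferInstance, by simp⟩
    | add s t hs ht =>
      obtain ⟨N, h1, h2⟩ := hs
      obtain ⟨N', h3, h4⟩ := ht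
      exact ⟨N ⊔ N', inferInstance, fun x => by
        rw [map_add]; exact Submodule.add_mem_sup (h2 x) (h4 x)⟩
    | tmul a v =>
      exact ⟨Submodule.span ℂ {v}, inferInstance, fun x => by
        rw [contract_tmul]
        exact Submodule.smul_mem _ _ (Submodule.mem_span_singleton_self v)⟩
  obtain ⟨N, h1, h2⟩ := key (δ v)
  exact Submodule.finiteDimensional_of_le (S₂ := N) (by rintro _ ⟨x, rfl⟩; exact h2 x)

/-- A subspace is stable if it is invariant under the action of `U_q(𝔤)`. -/
def IsStable (δ : V →ₗ[ℂ] Oq D q ⊗[ℂ] V) (N : Submodule ℂ V) : Prop :=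
  ∀ x, ∀ v ∈ N, op δ x v ∈ N

/-- An element of `A ⊗ V` all of whose contractions lie in `N` lies in `A ⊗ N`. -/
theorem mem_range_lTensor {N : Submodule ℂ V} {t : Oq D q ⊗[ℂ] V}
    (h : ∀ x, contract V x t ∈ N) : t ∈ LinearMap.range (N.subtype.lTensor (Oq D q)) := by
  rw [← lTensor_mkQ, LinearMap.mem_ker]
  refine Oq.separate (F := Oq.ev D q) (G := fun f : Module.Dual ℂ (V ⧸ N) => f)
    (fun _ => Oq.ev_eq_zero) (fun v hv => (Module.forall_dual_apply_eq_zero_iff ℂ v).mp hv) ?_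
  intro x f
  have e : ∀ t : Oq D q ⊗[ℂ] (V ⧸ N), LinearMap.mul' ℂ ℂ (TensorProduct.map (Oq.ev D q x) f t) =
      f (contract _ x t) := by
    intro t
    induction t with
    | zero => simp
    | add s t hs ht => simp only [map_add, hs, ht]
    | tmul a v => simp
  rw [e, contract_lTensor, show N.mkQ (contract V x t) = 0 from
    (Submodule.Quotient.mk_eq_zero N).mpr (h x), map_zero]

theorem isSubcomodule_iff {δ : V →ₗ[ℂ] Oq D q ⊗[ℂ] V} {N : Submodule ℂ V} :
    CQH.IsSubcomodule δ N ↔ IsStable δ N := by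
  constructor
  · intro h x v hv
    obtain ⟨t, ht⟩ := h v hv
    rw [op_apply, ← ht, contract_lTensor]
    exact SetLike.coe_mem _
  · intro h v hv
    exact mem_range_lTensor fun x => h x v hv

theorem isStable_orbit {δ : V →ₗ[ℂ] Oq D q ⊗[ℂ] V} (hδ : CQH.IsCoaction δ) (v : V) :
    IsStable δ (LinearMap.range (orbit δ v)) := by
  rintro x _ ⟨y, rfl⟩
  exact ⟨y * x, op_mul hδ y x v⟩

theorem mem_orbit {δ : V →ₗ[ℂ] Oq D q ⊗[ℂ] V} (hδ : CQH.IsCoaction δ) (v : V) :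
    v ∈ LinearMap.range (orbit δ v) := ⟨1, op_one hδ v⟩

theorem orbit_le {δ : V →ₗ[ℂ] Oq D q ⊗[ℂ] V} {N : Submodule ℂ V} (hN : IsStable δ N) {v : V}
    (hv : v ∈ N) : LinearMap.range (orbit δ v) ≤ N := by
  rintro _ ⟨x, rfl⟩
  exact hN x v hv

theorem isStable_of_gen {δ : V →ₗ[ℂ] Oq D q ⊗[ℂ] V} (hδ : CQH.IsCoaction δ) {N : Submodule ℂ V}
    (h : ∀ g, ∀ v ∈ N, op δ (Uq.gen D q g) v ∈ N) : IsStable δ N := by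
  intro x
  induction x using Uq.induction with
  | hs c =>
    intro v hv
    rw [Algebra.algebraMap_eq_smul_one, op_smul_left, op_one hδ]
    exact N.smul_mem c hv
  | hg x => exact h x
  | ha x y hx hy =>
    intro v hv
    rw [op_add_left]
    exact N.add_mem (hx v hv) (hy v hv)
  | hm x y hx hy =>
    intro v hv
    rw [op_mul hδ]
    exact hy _ (hx v hv)

section Relations

variable {δ : V →ₗ[ℂ] Oq D q ⊗[ℂ] V}

theorem op_K'_K (hδ : CQH.IsCoaction δ) (i : ι) (v : V) :
    op δ (Uq.K' D q i) (op δ (Uq.K D q i) v) = v := by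
  rw [← op_mul hδ, (Uq.relations D q).K_mul_K', op_one hδ]

theorem op_K_K' (hδ : CQH.IsCoaction δ) (i : ι) (v : V) :
    op δ (Uq.K D q i) (op δ (Uq.K' D q i) v) = v := by
  rw [← op_mul hδ, (Uq.relations D q).K'_mul_K, op_one hδ]

theorem op_E_K (hδ : CQH.IsCoaction δ) (i j : ι) (v : V) :
    op δ (Uq.E D q j) (op δ (Uq.K D q i) v) =
      (D.qi q i ^ D.a i j) • op δ (Uq.K D q i) (op δ (Uq.E D q j) v) := by
  rw [← op_mul hδ, (Uq.relations D q).K_mul_E, op_smul_left, op_mul hδ]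

theorem op_F_K (hδ : CQH.IsCoaction δ) (i j : ι) (v : V) :
    op δ (Uq.F D q j) (op δ (Uq.K D q i) v) =
      (D.qi q i ^ (-D.a i j)) • op δ (Uq.K D q i) (op δ (Uq.F D q j) v) := by
  rw [← op_mul hδ, (Uq.relations D q).K_mul_F, op_smul_left, op_mul hδ]

theorem op_K_E (hδ : CQH.IsCoaction δ) (i j : ι) (v : V) :
    op δ (Uq.K D q i) (op δ (Uq.E D q j) v) =
      (D.qi q i ^ (-D.a i j)) • op δ (Uq.E D q j) (op δ (Uq.K D q i) v) := by
  rw [op_E_K hδ, smul_smul, ← zpow_add₀ (D.generic q i).ne_zero, neg_add_cancel, zpow_zero,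
    one_smul]

theorem op_K_F (hδ : CQH.IsCoaction δ) (i j : ι) (v : V) :
    op δ (Uq.K D q i) (op δ (Uq.F D q j) v) =
      (D.qi q i ^ D.a i j) • op δ (Uq.F D q j) (op δ (Uq.K D q i) v) := by
  rw [op_F_K hδ, smul_smul, ← zpow_add₀ (D.generic q i).ne_zero, add_neg_cancel, zpow_zero,
    one_smul]

theorem op_E_K' (hδ : CQH.IsCoaction δ) (i j : ι) (v : V) :
    op δ (Uq.E D q j) (op δ (Uq.K' D q i) v) =
      (D.qi q i ^ (-D.a i j)) • op δ (Uq.K' D q i) (op δ (Uq.E D q j) v) := by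
  rw [← op_mul hδ, (Uq.relations D q).K'_mul_E, op_smul_left, op_mul hδ]

/-- The commutator of `Eᵢ` and `Fⱼ` acts as a combination of `Kᵢ` and `Kᵢ⁻¹`. -/
theorem op_E_F (hδ : CQH.IsCoaction δ) (i j : ι) : ∃ c : ℂ, ∀ v : V,
    op δ (Uq.F D q j) (op δ (Uq.E D q i) v) - op δ (Uq.E D q i) (op δ (Uq.F D q j) v) =
      c • (op δ (Uq.K D q i) v - op δ (Uq.K' D q i) v) := by
  have h := (Uq.relations D q).E_mul_F i j
  have e : ∀ (x y : Uq D q) (v : V), op δ (x - y) v = op δ x v - op δ y v := fun x y v =>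
    map_sub (orbit δ v) x y
  refine ⟨if i = j then (D.qi q i - (D.qi q i)⁻¹)⁻¹ else 0, fun v => ?_⟩
  rw [← op_mul hδ, ← op_mul hδ, ← e, h]
  split_ifs with hij
  · rw [op_smul_left, e]
  · rw [zero_smul]
    exact map_zero (orbit δ v)

end Relations

/-- In terms of the right action, a highest weight vector is annihilated by the `Eᵢ` and is an
eigenvector of the `Kᵢ` with inverted eigenvalues. -/
theorem IsHighestWeight.exists_weight {δ : V →ₗ[ℂ] Oq D q ⊗[ℂ] V} (hδ : CQH.IsCoaction δ) {v : V}
    (h : IsHighestWeight δ v) : (∀ i, op δ (Uq.E D q i) v = 0) ∧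
      ∃ μ : ι → ℤ, ∀ i, op δ (Uq.K D q i) v = (D.qi q i ^ μ i) • v := by
  constructor
  · intro i
    have h1 := h.E_act i
    rw [act_eq, Uq.antipode_gen] at h1
    have h2 : (Uq.antipodeGen D q (.E i)).unop = (-1 : ℂ) • (Uq.E D q i * Uq.K' D q i) := by
      simp [Uq.antipodeGen]
    rw [h2, op_smul_left, op_mul hδ, smul_eq_zero] at h1
    have h3 := h1.resolve_left (by norm_num)
    rw [← op_K_K' hδ i (op δ (Uq.E D q i) v), h3, map_zero]
  · obtain ⟨μ, hμ⟩ := h.K_act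
    refine ⟨fun i => -μ i, fun i => ?_⟩
    have h1 := hμ i
    rw [act_eq, Uq.antipode_gen] at h1
    change op δ (Uq.K' D q i) v = _ at h1
    have h2 := op_K_K' hδ i v
    rw [h1, map_smul] at h2
    rw [zpow_neg, eq_inv_smul_iff₀ (zpow_ne_zero _ (D.generic q i).ne_zero), h2]

end Operators

/-! ### Comodule algebras -/

section ComoduleAlgebra

variable {ι : Type*} [DecidableEq ι] {D : CartanDatum ι} {q : Parameter}
  {Ω : Type*} [Ring Ω] [Algebra ℂ Ω]

theorem contract_mul {κ : Type*} (x : Uq D q) (s : Coalgebra.Repr ℂ x κ)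
    (t u : Oq D q ⊗[ℂ] Ω) : contract Ω x (t * u) =
      ∑ i ∈ s.index, contract Ω (s.left i) t * contract Ω (s.right i) u := by
  induction t with
  | zero => simp
  | add a b ha hb => simp only [map_add, add_mul, ha, hb, Finset.sum_add_distrib]
  | tmul a b =>
    induction u with
    | zero => simp
    | add a b ha hb => simp only [map_add, mul_add, ha, hb, Finset.sum_add_distrib]
    | tmul c d =>
      rw [Algebra.TensorProduct.tmul_mul_tmul, contract_tmul, Oq.ev_mul x a c s, Finset.sum_smul]
      exact Finset.sum_congr rfl fun i _ => by
        rw [contract_tmul, contract_tmul, smul_mul_smul_comm]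

/-- A product decomposition of the coproduct with two summands. -/
noncomputable def reprTwo {x a b c d : Uq D q}
    (h : Coalgebra.comul (R := ℂ) x = a ⊗ₜ[ℂ] b + c ⊗ₜ[ℂ] d) : Coalgebra.Repr ℂ x (Fin 2) where
  index := Finset.univ
  left := ![a, c]
  right := ![b, d]
  eq := by simp [h]

variable (δ : Ω →ₐ[ℂ] Oq D q ⊗[ℂ] Ω)

theorem op_mul_of_comul {x a b c d : Uq D q}
    (h : Coalgebra.comul (R := ℂ) x = a ⊗ₜ[ℂ] b + c ⊗ₜ[ℂ] d) (w v : Ω) :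
    op δ.toLinearMap x (w * v) = op δ.toLinearMap a w * op δ.toLinearMap b v +
      op δ.toLinearMap c w * op δ.toLinearMap d v := by
  rw [op_apply, AlgHom.toLinearMap_apply, map_mul, contract_mul x (reprTwo h)]
  simp [reprTwo, op_apply]

theorem op_zero_left (w : Ω) : op δ.toLinearMap (0 : Uq D q) w = 0 :=
  map_zero (orbit δ.toLinearMap w)

theorem op_K_mul (i : ι) (w v : Ω) : op δ.toLinearMap (Uq.K D q i) (w * v) =
    op δ.toLinearMap (Uq.K D q i) w * op δ.toLinearMap (Uq.K D q i) v := by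
  rw [op_mul_of_comul δ (a := Uq.K D q i) (b := Uq.K D q i) (c := 0) (d := 0)
    (by rw [Uq.comul_gen]; simp [Uq.comulGen])]
  rw [op_zero_left, zero_mul, add_zero]

theorem op_K'_mul (i : ι) (w v : Ω) : op δ.toLinearMap (Uq.K' D q i) (w * v) =
    op δ.toLinearMap (Uq.K' D q i) w * op δ.toLinearMap (Uq.K' D q i) v := by
  rw [op_mul_of_comul δ (a := Uq.K' D q i) (b := Uq.K' D q i) (c := 0) (d := 0)
    (by rw [Uq.comul_gen]; simp [Uq.comulGen])]
  rw [op_zero_left, zero_mul, add_zero]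

variable {δ}

theorem op_E_mul (hδ : CQH.IsCoaction δ.toLinearMap) (i : ι) (w v : Ω) :
    op δ.toLinearMap (Uq.E D q i) (w * v) =
      op δ.toLinearMap (Uq.E D q i) w * op δ.toLinearMap (Uq.K D q i) v +
        w * op δ.toLinearMap (Uq.E D q i) v := by
  rw [op_mul_of_comul δ (Uq.comul_gen D q (.E i)), op_one hδ]

theorem op_F_mul (hδ : CQH.IsCoaction δ.toLinearMap) (i : ι) (w v : Ω) :
    op δ.toLinearMap (Uq.F D q i) (w * v) = op δ.toLinearMap (Uq.F D q i) w * v +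
        op δ.toLinearMap (Uq.K' D q i) w * op δ.toLinearMap (Uq.F D q i) v := by
  rw [op_mul_of_comul δ (Uq.comul_gen D q (.F i)), op_one hδ]

end ComoduleAlgebra

end QuantumGroup

namespace QuantumGroup

/-! ### Orthogonal projections for positive definite sesquilinear forms -/

section Form

variable {V : Type*} [AddCommGroup V] [Module ℂ V]

/-- A sesquilinear form with positive diagonal. -/
def IsPositive (B : V →ₗ⋆[ℂ] V →ₗ[ℂ] ℂ) : Prop :=
  ∀ w, w ≠ 0 → ∃ r : ℝ, 0 < r ∧ B w w = r

variable {B : V →ₗ⋆[ℂ] V →ₗ[ℂ] ℂ}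

theorem IsPositive.eq_zero (hB : IsPositive B) {w : V} (h : B w w = 0) : w = 0 := by
  by_contra hne
  obtain ⟨r, hr, e⟩ := hB w hne
  rw [h] at e
  exact hr.ne (by exact_mod_cast e)

theorem IsPositive.im_eq_zero (hB : IsPositive B) (w : V) : (B w w).im = 0 := by
  by_cases h : w = 0
  · simp [h]
  · obtain ⟨r, -, e⟩ := hB w h
    rw [e, Complex.ofReal_im]

/-- Polarisation: a complex sesquilinear form with real diagonal is Hermitian. -/
theorem IsPositive.conj_symm (hB : IsPositive B) (w v : V) : conj (B v w) = B w v := by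
  have h1 := hB.im_eq_zero (w + v)
  have h2 := hB.im_eq_zero (w + Complex.I • v)
  have h3 := hB.im_eq_zero w
  have h4 := hB.im_eq_zero v
  simp only [map_add, LinearMap.add_apply, map_smul, LinearMap.map_smulₛₗ, LinearMap.smul_apply,
    smul_eq_mul, Complex.add_im, Complex.mul_im, Complex.conj_I, Complex.neg_re,
    Complex.neg_im, Complex.I_re, Complex.I_im, Complex.add_re, Complex.mul_re] at h1 h2
  apply Complex.ext
  · rw [Complex.conj_re]
    linarith
  · rw [Complex.conj_im]
    linarith

/-- The inner product space structure given by a positive definite form. -/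
noncomputable abbrev IsPositive.core (hB : IsPositive B) : InnerProductSpace.Core ℂ V where
  inner w v := B w v
  conj_inner_symm w v := hB.conj_symm w v
  re_inner_nonneg w := by
    by_cases h : w = 0
    · simp [h]
    · obtain ⟨r, hr, e⟩ := hB w h
      change 0 ≤ (B w w).re
      rw [e, Complex.ofReal_re]
      exact hr.le
  add_left w w' v := by simp
  smul_left w v c := by simp
  definite w h := hB.eq_zero h

theorem IsPositive.exists_orthogonal (hB : IsPositive B) (N : Submodule ℂ V)
    [FiniteDimensional ℂ N] (v : V) : ∃ u ∈ N, ∀ w ∈ N, B w (v - u) = 0 := by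
  let _ := hB.core
  let _ : NormedAddCommGroup V := InnerProductSpace.Core.toNormedAddCommGroup (𝕜 := ℂ)
  let _ : InnerProductSpace ℂ V := InnerProductSpace.ofCore _
  refine ⟨N.starProjection v, N.starProjection_apply_mem v, fun w hw => ?_⟩
  exact (N.mem_orthogonal _).mp (N.sub_starProjection_mem_orthogonal v) w hw

end Form

/-! ### Cyclic modules generated by a highest weight vector -/

section Words

variable {ι V : Type*} [AddCommGroup V] [Module ℂ V]

/-- The span of the words in the operators `f j` applied to `v`. -/
def wordSpan (f : ι → V →ₗ[ℂ] V) (v : V) : Submodule ℂ V :=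
  Submodule.span ℂ (Set.range fun L : List ι => L.foldr (fun j w => f j w) v)

theorem mem_wordSpan (f : ι → V →ₗ[ℂ] V) (v : V) : v ∈ wordSpan f v :=
  Submodule.subset_span ⟨[], rfl⟩

theorem wordSpan_map {f : ι → V →ₗ[ℂ] V} {v : V} (j : ι) {w : V} (hw : w ∈ wordSpan f v) :
    f j w ∈ wordSpan f v := by
  have : wordSpan f v ≤ (wordSpan f v).comap (f j) := by
    refine Submodule.span_le.mpr ?_
    rintro _ ⟨L, rfl⟩
    exact Submodule.subset_span ⟨j :: L, rfl⟩
  exact this hw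

theorem wordSpan_le {f : ι → V →ₗ[ℂ] V} {v : V} {N : Submodule ℂ V} (hv : v ∈ N)
    (hf : ∀ j, ∀ w ∈ N, f j w ∈ N) : wordSpan f v ≤ N := by
  refine Submodule.span_le.mpr ?_
  rintro _ ⟨L, rfl⟩
  induction L with
  | nil => exact hv
  | cons j L ih => exact hf j _ ih

/-- Elements of `wordSpan f v` are multiples of `v` up to a combination of non-empty words. -/
theorem exists_smul_add_of_mem_wordSpan {f : ι → V →ₗ[ℂ] V} {v u : V} (hu : u ∈ wordSpan f v) :
    ∃ (a : ℂ) (p : V), p ∈ Submodule.span ℂ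
      (Set.range fun L : ι × List ι => f L.1 (L.2.foldr (fun j w => f j w) v)) ∧ u = a • v + p := by
  induction hu using Submodule.span_induction with
  | mem u hu =>
    obtain ⟨L, rfl⟩ := hu
    cases L with
    | nil => exact ⟨1, 0, zero_mem _, by simp⟩
    | cons j L => exact ⟨0, _, Submodule.subset_span ⟨(j, L), rfl⟩, by simp⟩
  | zero => exact ⟨0, 0, zero_mem _, by simp⟩
  | add u u' _ _ h h' =>
    obtain ⟨a, p, hp, rfl⟩ := h
    obtain ⟨a', p', hp', rfl⟩ := h'
    exact ⟨a + a', p + p', add_mem hp hp', by rw [add_smul]; abel⟩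
  | smul c u _ h =>
    obtain ⟨a, p, hp, rfl⟩ := h
    exact ⟨c * a, c • p, Submodule.smul_mem _ _ hp, by rw [smul_add, smul_smul]⟩

/-- Triangular decomposition applied to an extremal vector `v`: if the operators `e i` annihilate
`v`, the operators `k i` and `k' i` scale it, the `f j` are eigenvectors under conjugation by them
and the commutators of `e i` and `f j` are combinations of `k i` and `k' i`, then the words in the
`f j` span a submodule. -/
theorem wordSpan_stable {e f k k' : ι → V →ₗ[ℂ] V} {v : V}
    (hk : ∀ i j, ∃ c : ℂ, ∀ w, k i (f j w) = c • f j (k i w))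
    (hk' : ∀ i j, ∃ c : ℂ, ∀ w, k' i (f j w) = c • f j (k' i w))
    (he : ∀ i j, ∃ c : ℂ, ∀ w, e i (f j w) - f j (e i w) = c • (k i w - k' i w))
    (hev : ∀ i, e i v = 0) (hkv : ∀ i, ∃ c : ℂ, k i v = c • v) (hk'v : ∀ i, ∃ c : ℂ, k' i v = c • v)
    {w : V} (hw : w ∈ wordSpan f v) (i : ι) :
    e i w ∈ wordSpan f v ∧ k i w ∈ wordSpan f v ∧ k' i w ∈ wordSpan f v := by
  have key : wordSpan f v ≤ (wordSpan f v).comap (e i) ⊓ ((wordSpan f v).comap (k i) ⊓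
      (wordSpan f v).comap (k' i)) := by
    refine wordSpan_le ⟨?_, ?_, ?_⟩ ?_
    · change e i v ∈ wordSpan f v
      rw [hev]
      exact zero_mem _
    · obtain ⟨c, hc⟩ := hkv i
      change k i v ∈ wordSpan f v
      rw [hc]
      exact Submodule.smul_mem _ _ (mem_wordSpan f v)
    · obtain ⟨c, hc⟩ := hk'v i
      change k' i v ∈ wordSpan f v
      rw [hc]
      exact Submodule.smul_mem _ _ (mem_wordSpan f v)
    · rintro j w ⟨h1, h2, h3⟩
      obtain ⟨a, ha⟩ := hk i j
      obtain ⟨b, hb⟩ := hk' i j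
      obtain ⟨c, hc⟩ := he i j
      refine ⟨?_, ?_, ?_⟩
      · change e i (f j w) ∈ wordSpan f v
        rw [← sub_add_cancel (e i (f j w)) (f j (e i w)), hc]
        exact add_mem (Submodule.smul_mem _ _ (sub_mem h2 h3)) (wordSpan_map j h1)
      · change k i (f j w) ∈ wordSpan f v
        rw [ha]
        exact Submodule.smul_mem _ _ (wordSpan_map j h2)
      · change k' i (f j w) ∈ wordSpan f v
        rw [hb]
        exact Submodule.smul_mem _ _ (wordSpan_map j h3)
  exact key hw

end Words

section Cyclic

variable {ι : Type*} [DecidableEq ι] {D : CartanDatum ι} {q : Parameter}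
  {V : Type*} [AddCommGroup V] [Module ℂ V] {δ : V →ₗ[ℂ] Oq D q ⊗[ℂ] V}

theorem op_K'_eq (hδ : CQH.IsCoaction δ) {i : ι} {v : V} {c : ℂ} (hc : c ≠ 0)
    (h : op δ (Uq.K D q i) v = c • v) : op δ (Uq.K' D q i) v = c⁻¹ • v := by
  have := op_K'_K hδ i v
  rw [h, map_smul] at this
  rw [eq_inv_smul_iff₀ hc, this]

theorem op_K'_E (hδ : CQH.IsCoaction δ) (i j : ι) (v : V) :
    op δ (Uq.K' D q i) (op δ (Uq.E D q j) v) =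
      (D.qi q i ^ D.a i j) • op δ (Uq.E D q j) (op δ (Uq.K' D q i) v) := by
  rw [op_E_K' hδ, smul_smul, ← zpow_add₀ (D.generic q i).ne_zero, add_neg_cancel, zpow_zero,
    one_smul]

theorem op_K'_F (hδ : CQH.IsCoaction δ) (i j : ι) (v : V) :
    op δ (Uq.K' D q i) (op δ (Uq.F D q j) v) =
      (D.qi q i ^ (-D.a i j)) • op δ (Uq.F D q j) (op δ (Uq.K' D q i) v) := by
  rw [← op_mul hδ, ← op_mul hδ, (Uq.relations D q).K'_mul_F, op_smul_left, smul_smul,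
    ← zpow_add₀ (D.generic q i).ne_zero, neg_add_cancel, zpow_zero,
    one_smul]

/-- The module generated by a highest weight vector is spanned by the words in the `Fᵢ`. -/
theorem orbit_eq_wordSpan_F (hδ : CQH.IsCoaction δ) {v : V}
    (hE : ∀ i, op δ (Uq.E D q i) v = 0) (hK : ∀ i, ∃ c : ℂ, c ≠ 0 ∧ op δ (Uq.K D q i) v = c • v) :
    LinearMap.range (orbit δ v) = wordSpan (fun i => op δ (Uq.F D q i)) v := by
  refine le_antisymm (orbit_le (isStable_of_gen hδ fun g w hw => ?_) (mem_wordSpan _ v))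
    (wordSpan_le (mem_orbit hδ v) fun j w hw => isStable_orbit hδ v _ w hw)
  have key := wordSpan_stable (e := fun i => op δ (Uq.E D q i)) (k := fun i => op δ (Uq.K D q i))
    (k' := fun i => op δ (Uq.K' D q i)) (fun i j => ⟨_, op_K_F hδ i j⟩)
    (fun i j => ⟨_, op_K'_F hδ i j⟩)
    (fun i j => by
      obtain ⟨c, hc⟩ := op_E_F (δ := δ) hδ i j
      exact ⟨-c, fun w => by rw [neg_smul, ← hc, neg_sub]⟩) hE
    (fun i => (hK i).imp fun c h => h.2)
    (fun i => by
      obtain ⟨c, hc, h⟩ := hK i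
      exact ⟨_, op_K'_eq hδ hc h⟩) hw
  cases g with
  | E i => exact (key i).1
  | F i => exact wordSpan_map i hw
  | K i => exact (key i).2.1
  | K' i => exact (key i).2.2

/-- The module generated by a lowest weight vector is spanned by the words in the `Eᵢ`. -/
theorem orbit_eq_wordSpan_E (hδ : CQH.IsCoaction δ) {v : V}
    (hF : ∀ i, op δ (Uq.F D q i) v = 0) (hK : ∀ i, ∃ c : ℂ, c ≠ 0 ∧ op δ (Uq.K D q i) v = c • v) :
    LinearMap.range (orbit δ v) = wordSpan (fun i => op δ (Uq.E D q i)) v := by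
  refine le_antisymm (orbit_le (isStable_of_gen hδ fun g w hw => ?_) (mem_wordSpan _ v))
    (wordSpan_le (mem_orbit hδ v) fun j w hw => isStable_orbit hδ v _ w hw)
  have key := wordSpan_stable (e := fun i => op δ (Uq.F D q i)) (k := fun i => op δ (Uq.K D q i))
    (k' := fun i => op δ (Uq.K' D q i)) (fun i j => ⟨_, op_K_E hδ i j⟩)
    (fun i j => ⟨_, op_K'_E hδ i j⟩)
    (fun i j => by
      by_cases hij : i = j
      · subst hij
        exact op_E_F hδ i i
      · obtain ⟨c, hc⟩ := op_E_F (δ := δ) hδ j i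
        refine ⟨0, fun w => ?_⟩
        have h := (Uq.relations D q).E_mul_F j i
        rw [if_neg (Ne.symm hij), sub_eq_zero] at h
        rw [zero_smul, ← op_mul hδ, ← op_mul hδ]
        exact sub_eq_zero.mpr (congrArg (fun x => op δ x w) h)) hF
    (fun i => (hK i).imp fun c h => h.2)
    (fun i => by
      obtain ⟨c, hc, h⟩ := hK i
      exact ⟨_, op_K'_eq hδ hc h⟩) hw
  cases g with
  | F i => exact (key i).1
  | E i => exact wordSpan_map i hw
  | K i => exact (key i).2.1
  | K' i => exact (key i).2.2

/-! ### Invariant forms and irreducibility -/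

/-- A positive definite form on a comodule that is invariant for the compact real form. -/
structure IsInvariantForm (δ : V →ₗ[ℂ] Oq D q ⊗[ℂ] V) (B : V →ₗ⋆[ℂ] V →ₗ[ℂ] ℂ) : Prop where
  pos : IsPositive B
  map_K : ∀ i w v, B (op δ (Uq.K' D q i) w) (op δ (Uq.K D q i) v) = B w v
  map_E : ∀ i w v, B w (op δ (Uq.E D q i) v) = B (op δ (Uq.F D q i) w) (op δ (Uq.K D q i) v)
  map_F : ∀ i w v, B (op δ (Uq.K D q i) w) (op δ (Uq.F D q i) v) = B (op δ (Uq.E D q i) w) v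

variable {B : V →ₗ⋆[ℂ] V →ₗ[ℂ] ℂ}

theorem IsInvariantForm.adj_K (hB : IsInvariantForm δ B) (hδ : CQH.IsCoaction δ) (i : ι) (w v : V) :
    B w (op δ (Uq.K D q i) v) = B (op δ (Uq.K D q i) w) v := by
  rw [← hB.map_K i (op δ (Uq.K D q i) w), op_K'_K hδ]

theorem IsInvariantForm.adj_E (hB : IsInvariantForm δ B) (hδ : CQH.IsCoaction δ) (i : ι) (w v : V) :
    B w (op δ (Uq.E D q i) v) = B (op δ (Uq.K D q i) (op δ (Uq.F D q i) w)) v := by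
  rw [hB.map_E, hB.adj_K hδ]

theorem IsInvariantForm.adj_F (hB : IsInvariantForm δ B) (hδ : CQH.IsCoaction δ) (i : ι) (w v : V) :
    B w (op δ (Uq.F D q i) v) = B (op δ (Uq.E D q i) (op δ (Uq.K' D q i) w)) v := by
  rw [← hB.map_F, op_K_K' hδ]

/-- A highest weight vector is orthogonal to the image of the `Fᵢ`. -/
theorem IsInvariantForm.F_orthogonal (hB : IsInvariantForm δ B) (hδ : CQH.IsCoaction δ) {u : V}
    {i : ι} (hu : op δ (Uq.E D q i) u = 0) (v : V) : B u (op δ (Uq.F D q i) v) = 0 := by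
  rw [hB.adj_F hδ, op_E_K' hδ, hu]
  simp

/-- A vector annihilated by the `Eᵢ` in the module generated by a highest weight vector `v` is a
multiple of `v`, since it differs from one by a vector that is orthogonal to itself. -/
theorem IsInvariantForm.mem_span_of_E (hB : IsInvariantForm δ B) (hδ : CQH.IsCoaction δ) {u v : V}
    (hv : ∀ i, op δ (Uq.E D q i) v = 0)
    (hu : ∀ i, op δ (Uq.E D q i) u = 0) (h : u ∈ wordSpan (fun i => op δ (Uq.F D q i)) v) :
    ∃ a : ℂ, u = a • v := by
  obtain ⟨a, p, hp, rfl⟩ := exists_smul_add_of_mem_wordSpan h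
  refine ⟨a, ?_⟩
  have hpE : ∀ i, op δ (Uq.E D q i) p = 0 := fun i => by
    have := hu i
    rwa [map_add, map_smul, hv, smul_zero, zero_add] at this
  have hpp : B p p = 0 := by
    have : Submodule.span ℂ (Set.range fun L : ι × List ι => op δ (Uq.F D q L.1)
        (L.2.foldr (fun j w => op δ (Uq.F D q j) w) v)) ≤ LinearMap.ker (B p) := by
      refine Submodule.span_le.mpr ?_
      rintro _ ⟨L, rfl⟩
      exact hB.F_orthogonal hδ (hpE _) _
    exact this hp
  rw [hB.pos.eq_zero hpp, add_zero]

/-- The module generated by a highest weight vector of a unitary comodule is irreducible. -/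
theorem IsInvariantForm.eq_bot_or_eq (hB : IsInvariantForm δ B) (hδ : CQH.IsCoaction δ) {v : V}
    (hE : ∀ i, op δ (Uq.E D q i) v = 0) (hK : ∀ i, ∃ c : ℂ, c ≠ 0 ∧ op δ (Uq.K D q i) v = c • v)
    {N : Submodule ℂ V} (hN : IsStable δ N) (hle : N ≤ LinearMap.range (orbit δ v)) :
    N = ⊥ ∨ N = LinearMap.range (orbit δ v) := by
  have hfin := finiteDimensional_orbit δ v
  have : FiniteDimensional ℂ N := Submodule.finiteDimensional_of_le hle
  obtain ⟨u, hu, hperp⟩ := hB.pos.exists_orthogonal N v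
  have huE : ∀ i, op δ (Uq.E D q i) u = 0 := by
    intro i
    apply hB.pos.eq_zero
    have h1 : op δ (Uq.E D q i) u = - op δ (Uq.E D q i) (v - u) := by
      rw [map_sub, hE]
      abel
    have h2 := hN (Uq.E D q i) u hu
    nth_rewrite 2 [h1]
    rw [map_neg, hB.adj_E hδ, hperp _ (hN _ _ (hN _ _ h2)), neg_zero]
  obtain ⟨a, rfl⟩ := hB.mem_span_of_E hδ hE huE (orbit_eq_wordSpan_F hδ hE hK ▸ hle hu)
  by_cases ha : a = 0
  · left
    rw [eq_bot_iff]
    intro w hw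
    apply hB.pos.eq_zero
    have h3 : wordSpan (fun i => op δ (Uq.F D q i)) v ≤
        ⨅ w ∈ N, LinearMap.ker (B w) := by
      refine wordSpan_le ?_ ?_
      · simp only [Submodule.mem_iInf, LinearMap.mem_ker]
        intro w hw
        simpa [ha] using hperp w hw
      · intro j x hx
        simp only [Submodule.mem_iInf, LinearMap.mem_ker] at hx ⊢
        intro w hw
        rw [hB.adj_F hδ]
        exact hx _ (hN _ _ (hN _ _ hw))
    have h4 := h3 (orbit_eq_wordSpan_F hδ hE hK ▸ hle hw)
    simp only [Submodule.mem_iInf, LinearMap.mem_ker] at h4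
    exact h4 w hw
  · right
    refine le_antisymm hle (orbit_le hN ?_)
    have := N.smul_mem a⁻¹ hu
    rwa [smul_smul, inv_mul_cancel₀ ha, one_smul] at this

end Cyclic

end QuantumGroup

namespace QuantumGroup

/-! ### Multiplicity-free comodules -/

section Restrict

variable {ι : Type*} [DecidableEq ι] {D : CartanDatum ι} {q : Parameter}
  {V W : Type*} [AddCommGroup V] [Module ℂ V] [AddCommGroup W] [Module ℂ W]

theorem lTensor_injective {f : V →ₗ[ℂ] W} (hf : Function.Injective f) :
    Function.Injective (f.lTensor (Oq D q)) :=
  Module.Flat.lTensor_preserves_injective_linearMap f hf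

/-- A coaction restricts along an injective map whose range is a subcomodule. -/
theorem exists_restrict {δ : W →ₗ[ℂ] Oq D q ⊗[ℂ] W} (hδ : CQH.IsCoaction δ) {f : V →ₗ[ℂ] W}
    (hf : Function.Injective f) (h : IsStable δ (LinearMap.range f)) :
    ∃ ρ : V →ₗ[ℂ] Oq D q ⊗[ℂ] V, (∀ v, δ (f v) = f.lTensor _ (ρ v)) ∧ CQH.IsCoaction ρ := by
  have hf' := lTensor_injective (D := D) (q := q) hf
  have hmem : ∀ v, δ (f v) ∈ LinearMap.range (f.lTensor (Oq D q)) := by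
    intro v
    obtain ⟨t, ht⟩ := isSubcomodule_iff.mpr h (f v) ⟨v, rfl⟩
    rw [← ht]
    clear ht
    induction t with
    | zero => simp
    | add s t hs ht => rw [map_add]; exact add_mem hs ht
    | tmul a w =>
      obtain ⟨v, hv⟩ := w.2
      exact ⟨a ⊗ₜ v, by simp [hv]⟩
  let ρ : V →ₗ[ℂ] Oq D q ⊗[ℂ] V := (LinearEquiv.ofInjective _ hf').symm.toLinearMap ∘ₗ
    (δ ∘ₗ f).codRestrict (LinearMap.range (f.lTensor (Oq D q))) hmem
  have hρ : ∀ v, δ (f v) = f.lTensor _ (ρ v) := fun v =>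
    (congrArg Subtype.val (LinearEquiv.apply_symm_apply (LinearEquiv.ofInjective _ hf')
      ((δ ∘ₗ f).codRestrict (LinearMap.range (f.lTensor (Oq D q))) hmem v))).symm
  refine ⟨ρ, hρ, ⟨fun v => ?_, fun v => ?_⟩⟩
  · apply lTensor_injective (D := D) (q := q) hf'
    have h1 : ∀ t : Oq D q ⊗[ℂ] V, (f.lTensor (Oq D q)).lTensor (Oq D q)
        (TensorProduct.assoc ℂ _ _ V ((Coalgebra.comul (R := ℂ)).rTensor V t)) =
        TensorProduct.assoc ℂ _ _ W ((Coalgebra.comul (R := ℂ)).rTensor W (f.lTensor _ t)) := by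
      intro t
      induction t with
      | zero => simp
      | add s t hs ht => simp only [map_add, hs, ht]
      | tmul a v =>
        rw [LinearMap.lTensor_tmul, LinearMap.rTensor_tmul, LinearMap.rTensor_tmul]
        induction Coalgebra.comul (R := ℂ) a with
        | zero => simp
        | add s t hs ht => simp only [TensorProduct.add_tmul, map_add, hs, ht]
        | tmul a b => simp
    have h2 : ∀ t : Oq D q ⊗[ℂ] V, (f.lTensor (Oq D q)).lTensor (Oq D q) (ρ.lTensor _ t) =
        δ.lTensor _ (f.lTensor _ t) := by
      intro t
      induction t with
      | zero => simp
      | add s t hs ht => simp only [map_add, hs, ht]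
      | tmul a v => simp [hρ]
    rw [h1, h2, ← hρ, hδ.coassoc]
  · apply hf
    change f (contract V 1 (ρ v)) = f v
    rw [← contract_lTensor, ← hρ]
    exact hδ.counit (f v)

/-- The diagonal coaction on `W × W`. -/
noncomputable def prodCoaction (δ : W →ₗ[ℂ] Oq D q ⊗[ℂ] W) :
    W × W →ₗ[ℂ] Oq D q ⊗[ℂ] (W × W) :=
  (LinearMap.inl ℂ W W).lTensor _ ∘ₗ δ ∘ₗ LinearMap.fst ℂ W W +
    (LinearMap.inr ℂ W W).lTensor _ ∘ₗ δ ∘ₗ LinearMap.snd ℂ W W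

variable {δ : W →ₗ[ℂ] Oq D q ⊗[ℂ] W}

theorem prodCoaction_fst (w : W × W) :
    δ (LinearMap.fst ℂ W W w) = (LinearMap.fst ℂ W W).lTensor _ (prodCoaction δ w) := by
  simp only [prodCoaction, LinearMap.add_apply, LinearMap.comp_apply, map_add,
    ← LinearMap.lTensor_comp_apply]
  simp

theorem prodCoaction_snd (w : W × W) :
    δ (LinearMap.snd ℂ W W w) = (LinearMap.snd ℂ W W).lTensor _ (prodCoaction δ w) := by
  simp only [prodCoaction, LinearMap.add_apply, LinearMap.comp_apply, map_add,
    ← LinearMap.lTensor_comp_apply]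
  simp

theorem op_prodCoaction (x : Uq D q) (w : W × W) :
    op (prodCoaction δ) x w = (op δ x w.1, op δ x w.2) :=
  Prod.ext (op_map (prodCoaction_fst w) x).symm (op_map (prodCoaction_snd w) x).symm

theorem isCoaction_prod (hδ : CQH.IsCoaction δ) : CQH.IsCoaction (prodCoaction δ) := by
  have h1 : ∀ (f : W →ₗ[ℂ] W × W) (t : Oq D q ⊗[ℂ] W),
      TensorProduct.assoc ℂ _ _ _ ((Coalgebra.comul (R := ℂ)).rTensor _ (f.lTensor _ t)) =
      (f.lTensor (Oq D q)).lTensor (Oq D q)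
        (TensorProduct.assoc ℂ _ _ W ((Coalgebra.comul (R := ℂ)).rTensor W t)) := by
    intro f t
    induction t with
    | zero => simp
    | add s t hs ht => simp only [map_add, hs, ht]
    | tmul a v =>
      rw [LinearMap.lTensor_tmul, LinearMap.rTensor_tmul, LinearMap.rTensor_tmul]
      induction Coalgebra.comul (R := ℂ) a with
      | zero => simp
      | add s t hs ht => simp only [TensorProduct.add_tmul, map_add, hs, ht]
      | tmul a b => simp
  have h2 : ∀ (f : W →ₗ[ℂ] W × W) (_ : prodCoaction δ ∘ₗ f = f.lTensor _ ∘ₗ δ)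
      (t : Oq D q ⊗[ℂ] W), (prodCoaction δ).lTensor (Oq D q) (f.lTensor _ t) =
      (f.lTensor (Oq D q)).lTensor (Oq D q) (δ.lTensor _ t) := by
    intro f hf t
    rw [← LinearMap.lTensor_comp_apply, hf, LinearMap.lTensor_comp_apply]
  have e1 : prodCoaction δ ∘ₗ LinearMap.inl ℂ W W = (LinearMap.inl ℂ W W).lTensor _ ∘ₗ δ := by
    ext w
    simp [prodCoaction]
  have e2 : prodCoaction δ ∘ₗ LinearMap.inr ℂ W W = (LinearMap.inr ℂ W W).lTensor _ ∘ₗ δ := by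
    ext w
    simp [prodCoaction]
  constructor
  · intro w
    have e : prodCoaction δ w = (LinearMap.inl ℂ W W).lTensor _ (δ w.1) +
      (LinearMap.inr ℂ W W).lTensor _ (δ w.2) := rfl
    rw [e]
    simp only [map_add]
    rw [h1, h1, h2 _ e1, h2 _ e2, hδ.coassoc, hδ.coassoc]
  · intro w
    change op (prodCoaction δ) 1 w = w
    rw [op_prodCoaction, op_one hδ, op_one hδ]

/-- The orthogonal direct sum of a form with itself. -/
noncomputable def prodForm (B : W →ₗ⋆[ℂ] W →ₗ[ℂ] ℂ) : W × W →ₗ⋆[ℂ] W × W →ₗ[ℂ] ℂ :=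
  LinearMap.mk₂'ₛₗ (starRingEnd ℂ) (RingHom.id ℂ) (fun w v => B w.1 v.1 + B w.2 v.2)
    (fun w w' v => by simp; abel)
    (fun c w v => by simp [mul_add])
    (fun w v v' => by simp; abel)
    (fun c w v => by simp [mul_add])

theorem prodForm_apply (B : W →ₗ⋆[ℂ] W →ₗ[ℂ] ℂ) (w v : W × W) :
    prodForm B w v = B w.1 v.1 + B w.2 v.2 := rfl

theorem IsInvariantForm.prod {B : W →ₗ⋆[ℂ] W →ₗ[ℂ] ℂ} (hB : IsInvariantForm δ B) :
    IsInvariantForm (prodCoaction δ) (prodForm B) where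
  pos w hw := by
    have h : ∀ w, ∃ r : ℝ, 0 ≤ r ∧ B w w = r ∧ (w ≠ 0 → 0 < r) := by
      intro w
      by_cases h0 : w = 0
      · exact ⟨0, le_rfl, by simp [h0], fun h => absurd h0 h⟩
      · obtain ⟨r, hr, e⟩ := hB.pos w h0
        exact ⟨r, hr.le, e, fun _ => hr⟩
    obtain ⟨r, hr, er, hr'⟩ := h w.1
    obtain ⟨s, hs, es, hs'⟩ := h w.2
    refine ⟨r + s, ?_, by rw [prodForm_apply, er, es]; push_cast; rfl⟩
    by_cases h1 : w.1 = 0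
    · have h2 : w.2 ≠ 0 := fun h2 => hw (Prod.ext h1 h2)
      exact add_pos_of_nonneg_of_pos hr (hs' h2)
    · exact add_pos_of_pos_of_nonneg (hr' h1) hs
  map_K i w v := by simp only [prodForm_apply, op_prodCoaction, hB.map_K]
  map_E i w v := by simp only [prodForm_apply, op_prodCoaction, hB.map_E]
  map_F i w v := by simp only [prodForm_apply, op_prodCoaction, hB.map_F]

/-- The two projections of an irreducible subcomodule of `W × W` into a multiplicity-free comodule
are linearly dependent. -/
theorem exists_relation_of_isMultiplicityFree (hδ : CQH.IsCoaction δ) {U : Submodule ℂ W}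
    (hU : CQH.IsMultiplicityFree δ U) {N : Submodule ℂ (W × W)} [FiniteDimensional ℂ N]
    (hN : IsStable (prodCoaction δ) N) (hne : N ≠ ⊥)
    (hirr : ∀ N' ≤ N, IsStable (prodCoaction δ) N' → N' = ⊥ ∨ N' = N)
    (hNU : ∀ x ∈ N, x.1 ∈ U ∧ x.2 ∈ U) :
    ∃ a b : ℂ, (a ≠ 0 ∨ b ≠ 0) ∧ ∀ x ∈ N, a • x.1 + b • x.2 = 0 := by
  let e : (Fin (Module.finrank ℂ N) → ℂ) ≃ₗ[ℂ] N := (Module.finBasis ℂ N).equivFun.symm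
  let f : (Fin (Module.finrank ℂ N) → ℂ) →ₗ[ℂ] W × W := N.subtype ∘ₗ e.toLinearMap
  have hf : Function.Injective f := N.subtype_injective.comp e.injective
  have hrange : LinearMap.range f = N := by
    rw [LinearMap.range_comp_of_range_eq_top _ e.range, Submodule.range_subtype]
  obtain ⟨ρ, hρ, hco⟩ := exists_restrict (isCoaction_prod hδ) hf (by rwa [hrange])
  have hirrρ : CQH.IsIrreducible ρ ⊤ := by
    refine ⟨isSubcomodule_iff.mpr fun _ _ _ => Submodule.mem_top, ?_, ?_⟩
    · intro h
      apply hne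
      rw [← hrange, LinearMap.range_eq_map, h, Submodule.map_bot]
    · intro U' _ hU'
      have h1 : U'.map f ≤ N := by
        exact LinearMap.map_le_range.trans hrange.le
      have h2 : IsStable (prodCoaction δ) (U'.map f) := by
        rintro x _ ⟨v, hv, rfl⟩
        exact ⟨op ρ x v, isSubcomodule_iff.mp hU' x v hv, (op_map (hρ v) x).symm⟩
      rcases hirr _ h1 h2 with h | h
      · left
        exact Submodule.map_injective_of_injective hf (by rw [h, Submodule.map_bot])
      · right
        apply Submodule.map_injective_of_injective hf
        rw [h, ← LinearMap.range_eq_map, hrange]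
  have hrank := hU (Fin (Module.finrank ℂ N) → ℂ) ρ hco hirrρ
  rw [rank_le_one_iff] at hrank
  obtain ⟨g, hg⟩ := hrank
  have hfN : ∀ v, f v ∈ N := fun v => (e v).2
  have m1 : LinearMap.fst ℂ W W ∘ₗ f ∈ CQH.comoduleHom ρ δ U := by
    refine ⟨fun v => (hNU _ (hfN v)).1, fun v => ?_⟩
    rw [LinearMap.comp_apply, prodCoaction_fst, hρ, ← LinearMap.lTensor_comp_apply]
  have m2 : LinearMap.snd ℂ W W ∘ₗ f ∈ CQH.comoduleHom ρ δ U := by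
    refine ⟨fun v => (hNU _ (hfN v)).2, fun v => ?_⟩
    rw [LinearMap.comp_apply, prodCoaction_snd, hρ, ← LinearMap.lTensor_comp_apply]
  obtain ⟨r, hr⟩ := hg ⟨_, m1⟩
  obtain ⟨s, hs⟩ := hg ⟨_, m2⟩
  have key : ∀ x ∈ N, ∃ w, x.1 = r • w ∧ x.2 = s • w := by
    intro x hx
    obtain ⟨v, rfl⟩ : x ∈ LinearMap.range f := hrange.ge hx
    refine ⟨g.1 v, ?_, ?_⟩
    · exact (LinearMap.congr_fun (congrArg Subtype.val hr) v).symm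
    · exact (LinearMap.congr_fun (congrArg Subtype.val hs) v).symm
  by_cases h0 : r = 0 ∧ s = 0
  · refine ⟨1, 0, Or.inl one_ne_zero, fun x hx => ?_⟩
    obtain ⟨w, h1, -⟩ := key x hx
    rw [h1, h0.1]
    simp
  · refine ⟨s, -r, ?_, fun x hx => ?_⟩
    · by_contra h
      push Not at h
      exact h0 ⟨neg_eq_zero.mp h.2, h.1⟩
    · obtain ⟨w, h1, h2⟩ := key x hx
      rw [h1, h2, smul_smul, smul_smul, ← add_smul]
      simp [mul_comm]

end Restrict

end QuantumGroup

namespace QuantumGroup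

/-! ### The action on the calculus -/

section Calculus

variable {ι : Type*} [DecidableEq ι] {D : CartanDatum ι} {q : Parameter}
  {H : Type*} [Ring H] [HopfAlgebra ℂ H] [StarRing H] [StarModule ℂ H]
  {X : CQH.HomogeneousSpace (Oq D q) H} {Ω : Type*} [Ring Ω] [Algebra ℂ Ω]

section Complex

variable {m : ℕ} (S : CQH.ComplexSpace X Ω m)

theorem op_mem_bideg (x : Uq D q) {p : ℕ × ℕ} {w : Ω} (hw : w ∈ S.bideg p) :
    op S.δ.toLinearMap x w ∈ S.bideg p :=
  isSubcomodule_iff.mp (S.isSubcomodule_bideg p) x w hw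

theorem op_mem_deg (x : Uq D q) {k : ℕ} {w : Ω} (hw : w ∈ S.deg k) :
    op S.δ.toLinearMap x w ∈ S.deg k :=
  S.map_deg_mem (op S.δ.toLinearMap x) (fun p hp w hw => by
    have := S.bideg_le_deg p (op_mem_bideg S x hw)
    rwa [hp] at this) hw

theorem op_d (x : Uq D q) (w : Ω) : op S.δ.toLinearMap x (S.d w) = S.d (op S.δ.toLinearMap x w) :=
  op_map (S.δ_d w) x

theorem op_proj (x : Uq D q) (p : ℕ × ℕ) (w : Ω) :
    op S.δ.toLinearMap x (GradedAlgebra.proj S.bideg p w) =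
      GradedAlgebra.proj S.bideg p (op S.δ.toLinearMap x w) := by
  refine S.linearMap_eq_of_bideg
    (f := fun w => op S.δ.toLinearMap x (GradedAlgebra.proj S.bideg p w))
    (g := fun w => GradedAlgebra.proj S.bideg p (op S.δ.toLinearMap x w)) (by simp) (by simp)
    (fun r w hw => ?_) w
  by_cases h : r = p
  · subst h
    simp only [S.proj_same hw, S.proj_same (op_mem_bideg S x hw)]
  · simp only [S.proj_ne hw h, S.proj_ne (op_mem_bideg S x hw) h, map_zero]

theorem op_projDeg (x : Uq D q) (k : ℕ) (w : Ω) :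
    op S.δ.toLinearMap x (GradedAlgebra.proj S.deg k w) =
      GradedAlgebra.proj S.deg k (op S.δ.toLinearMap x w) := by
  refine S.linearMap_eq_of_bideg (f := fun w => op S.δ.toLinearMap x (GradedAlgebra.proj S.deg k w))
    (g := fun w => GradedAlgebra.proj S.deg k (op S.δ.toLinearMap x w)) (by simp) (by simp)
    (fun r w hw => ?_) w
  have h1 := S.bideg_le_deg _ hw
  have h2 := S.bideg_le_deg _ (op_mem_bideg S x hw)
  by_cases h : r.1 + r.2 = k
  · subst h
    simp only [S.projDeg_same h1, S.projDeg_same h2]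
  · simp only [S.projDeg_ne h1 h, S.projDeg_ne h2 h, map_zero]

theorem op_del (x : Uq D q) (w : Ω) :
    op S.δ.toLinearMap x (S.del w) = S.del (op S.δ.toLinearMap x w) := by
  refine S.linearMap_eq_of_bideg (f := fun w => op S.δ.toLinearMap x (S.del w))
    (g := fun w => S.del (op S.δ.toLinearMap x w)) (by simp) (by simp) (fun p w hw => ?_) w
  rw [S.del_apply hw, op_proj, op_d, S.del_apply (op_mem_bideg S x hw)]

theorem op_delbar (x : Uq D q) (w : Ω) :
    op S.δ.toLinearMap x (S.delbar w) = S.delbar (op S.δ.toLinearMap x w) := by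
  refine S.linearMap_eq_of_bideg (f := fun w => op S.δ.toLinearMap x (S.delbar w))
    (g := fun w => S.delbar (op S.δ.toLinearMap x w)) (by simp) (by simp) (fun p w hw => ?_) w
  rw [S.delbar_apply hw, op_proj, op_d, S.delbar_apply (op_mem_bideg S x hw)]

/-- On `B` the action is given by the coproduct of `A`. -/
theorem exists_op_ι (x : Uq D q) (b : X.B) : ∃ c : X.B, op S.δ.toLinearMap x (S.ι b) = S.ι c ∧
    (c : Oq D q) = contract _ x (Coalgebra.comul (R := ℂ) (b : Oq D q)) := by
  obtain ⟨t, ht, h⟩ := S.δ_ι b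
  refine ⟨contract _ x t, ?_, ?_⟩
  · rw [op_apply, AlgHom.toLinearMap_apply, h, contract_lTensor]
    rfl
  · rw [← ht, contract_lTensor]
    rfl

theorem haarForm_op (x : Uq D q) (b : X.B) : S.haarForm (op S.δ.toLinearMap x (S.ι b)) =
    Coalgebra.counit (R := ℂ) x * S.haarForm (S.ι b) := by
  obtain ⟨c, h1, h2⟩ := exists_op_ι S x b
  have hH : CQH.IsHaar (Oq D q) (CQH.haar (Oq D q)) := by
    rw [CQH.haar, dif_pos X.isCMQGA_left.exists_haar]
    exact X.isCMQGA_left.exists_haar.choose_spec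
  have h3 : ∀ t : Oq D q ⊗[ℂ] Oq D q, CQH.haar (Oq D q) (contract _ x t) =
      Oq.ev D q x (TensorProduct.rid ℂ _ ((CQH.haar (Oq D q)).lTensor _ t)) := by
    intro t
    induction t with
    | zero => simp
    | add s t hs ht => simp only [map_add, hs, ht]
    | tmul a v => simp [mul_comm]
  rw [h1, S.haarForm_ι, S.haarForm_ι, h2, h3, hH.left_invariant, map_smul, Oq.ev_one, smul_eq_mul,
    mul_comm]

theorem contract_star (x : Uq D q) (t : Oq D q ⊗[ℂ] Oq D q) :
    contract _ x (star t) = star (contract _ (Uq.theta D q x) t) := by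
  induction t with
  | zero => simp
  | add s t hs ht => simp only [map_add, star_add, hs, ht]
  | tmul a b => simp

/-- The form `w` satisfies `x · w^* = (θ(x) · w)^*` for all generators `x`. -/
def StarCompatible (w : Ω) : Prop := ∀ g, op S.δ.toLinearMap (Uq.gen D q g) (S.starMap w) =
  S.starMap (op S.δ.toLinearMap (Uq.thetaGen D q g) w)

theorem op_neg_left (x : Uq D q) (w : Ω) :
    op S.δ.toLinearMap (-x) w = -op S.δ.toLinearMap x w := map_neg (orbit S.δ.toLinearMap w) x

theorem starCompatible_ι (b : X.B) : StarCompatible S (S.ι b) := by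
  intro g
  obtain ⟨c, h1, h2⟩ := exists_op_ι S (Uq.gen D q g) (X.starB b)
  obtain ⟨c', h3, h4⟩ := exists_op_ι S (Uq.thetaGen D q g) b
  rw [S.starMap_ι, h1, h3, S.starMap_ι]
  congr 1
  apply Subtype.ext
  change (c : Oq D q) = star (c' : Oq D q)
  rw [h2, h4, ← Uq.theta_gen, ← contract_star, ← X.isCMQGA_left.comul_star]
  rfl

theorem starMap_mul_smul {k l : ℕ} {w v : Ω} (hw : w ∈ S.deg k) (hv : v ∈ S.deg l) :
    S.starMap (w * v) = (-1 : ℂ) ^ (k * l) • (S.starMap v * S.starMap w) := by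
  rw [S.starMap_mul k l w hw v hv, Algebra.smul_def, map_pow, map_neg, map_one]

theorem StarCompatible.mul {k l : ℕ} {w v : Ω} (hw : w ∈ S.deg k) (hv : v ∈ S.deg l)
    (cw : StarCompatible S w) (cv : StarCompatible S v) : StarCompatible S (w * v) := by
  have hδ := S.isCoaction
  intro g
  rw [starMap_mul_smul S hw hv, map_smul]
  cases g with
  | K i =>
    have h1 := cw (.K i)
    have h2 := cv (.K i)
    simp only [Uq.thetaGen] at h1 h2 ⊢
    rw [op_K_mul, h1, h2, op_K'_mul, starMap_mul_smul S (op_mem_deg S _ hw) (op_mem_deg S _ hv)]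
  | K' i =>
    have h1 := cw (.K' i)
    have h2 := cv (.K' i)
    simp only [Uq.thetaGen] at h1 h2 ⊢
    rw [op_K'_mul, h1, h2, op_K_mul, starMap_mul_smul S (op_mem_deg S _ hw) (op_mem_deg S _ hv)]
  | E i =>
    have h1 := cw (.E i)
    have h2 := cv (.E i)
    have h3 := cw (.K i)
    simp only [Uq.thetaGen, op_neg_left, map_neg] at h1 h2 h3 ⊢
    rw [op_E_mul hδ, h1, h2, h3, op_F_mul hδ, map_add, starMap_mul_smul S (op_mem_deg S _ hw) hv,
      starMap_mul_smul S (op_mem_deg S _ hw) (op_mem_deg S _ hv), ← smul_add, ← smul_neg, neg_mul,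
      mul_neg, neg_add_rev]
  | F i =>
    have h1 := cw (.F i)
    have h2 := cv (.F i)
    have h3 := cv (.K' i)
    simp only [Uq.thetaGen, op_neg_left, map_neg] at h1 h2 h3 ⊢
    rw [op_F_mul hδ, h1, h2, h3, op_E_mul hδ, map_add, starMap_mul_smul S hw (op_mem_deg S _ hv),
      starMap_mul_smul S (op_mem_deg S _ hw) (op_mem_deg S _ hv), ← smul_add, ← smul_neg, neg_mul,
      mul_neg, neg_add_rev]

/-- The coaction is compatible with `*`: this holds on `B` because the coproduct of `A` is a
`*`-homomorphism, it is preserved by `d` and by products, and `B` and `dB` generate. -/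
theorem starCompatible (w : Ω) : StarCompatible S w := by
  let Q : ℕ → Submodule ℂ Ω := fun k =>
    { carrier := {w | w ∈ S.deg k ∧ StarCompatible S w}
      zero_mem' := ⟨zero_mem _, fun g => by simp⟩
      add_mem' := fun {w v} hw hv => ⟨add_mem hw.1 hv.1, fun g => by
        simp only [map_add, hw.2 g, hv.2 g]⟩
      smul_mem' := fun c w hw => ⟨Submodule.smul_mem _ c hw.1, fun g => by
        simp only [LinearMap.map_smulₛₗ, hw.2 g, RingHom.id_apply]⟩ }
  have hmul : ∀ x ∈ ⨆ k, Q k, ∀ y ∈ ⨆ k, Q k, x * y ∈ ⨆ k, Q k := by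
    intro x hx y hy
    induction hx using Submodule.iSup_induction' with
    | mem k x hx =>
      induction hy using Submodule.iSup_induction' with
      | mem l y hy =>
        exact Submodule.mem_iSup_of_mem (k + l)
          ⟨S.mul_mem_deg hx.1 hy.1, hx.2.mul S hx.1 hy.1 hy.2⟩
      | zero => simp
      | add y y' _ _ h h' => rw [mul_add]; exact add_mem h h'
    | zero => simp
    | add x x' _ _ h h' => rw [add_mul]; exact add_mem h h'
  have hι : ∀ b, S.ι b ∈ ⨆ k, Q k := fun b =>
    Submodule.mem_iSup_of_mem 0 ⟨S.ι_mem_deg b, starCompatible_ι S b⟩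
  have htop : w ∈ ⨆ k, Q k := by
    have hw : w ∈ Algebra.adjoin ℂ (Set.range S.ι ∪ Set.range fun b => S.d (S.ι b)) := by
      rw [S.generated]
      exact Algebra.mem_top
    induction hw using Algebra.adjoin_induction with
    | mem w hw =>
      rcases hw with ⟨b, rfl⟩ | ⟨b, rfl⟩
      · exact hι b
      · refine Submodule.mem_iSup_of_mem 1 ⟨S.d_mem 0 _ (S.ι_mem_deg b), fun g => ?_⟩
        simp only
        rw [S.starMap_d, op_d, op_d, starCompatible_ι S b g, S.starMap_d]
    | algebraMap c => rw [← S.ι.commutes]; exact hι _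
    | add x y _ _ hx hy => exact add_mem hx hy
    | mul x y _ _ hx hy => exact hmul x hx y hy
  have hle : ∀ w ∈ ⨆ k, Q k, StarCompatible S w := by
    intro w hw
    induction hw using Submodule.iSup_induction' with
    | mem k w hw => exact hw.2
    | zero => exact fun g => by simp
    | add x y _ _ hx hy => exact fun g => by simp only [map_add, hx g, hy g]
  exact hle w htop

theorem op_starMap (x : Uq D q) (w : Ω) : op S.δ.toLinearMap x (S.starMap w) =
    S.starMap (op S.δ.toLinearMap (Uq.theta D q x) w) := by
  have hδ := S.isCoaction
  induction x using Uq.induction generalizing w with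
  | hs c =>
    rw [Uq.theta_algebraMap, Algebra.algebraMap_eq_smul_one, Algebra.algebraMap_eq_smul_one,
      op_smul_left, op_smul_left, op_one hδ, op_one hδ, LinearMap.map_smulₛₗ, Complex.conj_conj]
  | hg g => rw [starCompatible S w g, Uq.theta_gen]
  | ha x y hx hy => rw [map_add, op_add_left, op_add_left, map_add, hx, hy]
  | hm x y hx hy => rw [map_mul, op_mul hδ, op_mul hδ, hx, hy]

theorem op_K_starMap (i : ι) (w : Ω) : op S.δ.toLinearMap (Uq.K D q i) (S.starMap w) =
    S.starMap (op S.δ.toLinearMap (Uq.K' D q i) w) := starCompatible S w (.K i)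

theorem op_K'_starMap (i : ι) (w : Ω) : op S.δ.toLinearMap (Uq.K' D q i) (S.starMap w) =
    S.starMap (op S.δ.toLinearMap (Uq.K D q i) w) := starCompatible S w (.K' i)

theorem op_E_starMap (i : ι) (w : Ω) : op S.δ.toLinearMap (Uq.E D q i) (S.starMap w) =
    -S.starMap (op S.δ.toLinearMap (Uq.F D q i) w) := by
  rw [← map_neg, ← op_neg_left]
  exact starCompatible S w (.E i)

theorem op_F_starMap (i : ι) (w : Ω) : op S.δ.toLinearMap (Uq.F D q i) (S.starMap w) =
    -S.starMap (op S.δ.toLinearMap (Uq.E D q i) w) := by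
  rw [← map_neg, ← op_neg_left]
  exact starCompatible S w (.F i)

end Complex

section Hermitian

variable {n : ℕ} (S : CQH.HermitianSpace X Ω n)

theorem op_σ_pow_mul (x : Uq D q) (j : ℕ) (w : Ω) :
    op S.δ.toLinearMap x (S.σ ^ j * w) = S.σ ^ j * op S.δ.toLinearMap x w := by
  have h0 : ∀ t : Oq D q ⊗[ℂ] Ω, contract Ω x ((1 ⊗ₜ[ℂ] S.σ) * t) = S.σ * contract Ω x t := by
    intro t
    induction t with
    | zero => simp
    | add s t hs ht => simp only [map_add, mul_add, hs, ht]
    | tmul a v => simp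
  have h1 : ∀ w, op S.δ.toLinearMap x (S.σ * w) = S.σ * op S.δ.toLinearMap x w := by
    intro w
    rw [op_apply, op_apply, AlgHom.toLinearMap_apply, map_mul, S.coinvariant, h0]
    rfl
  induction j with
  | zero => simp
  | succ j ih => rw [pow_succ', mul_assoc, h1, ih, mul_assoc]

theorem op_hodge (x : Uq D q) (w : Ω) :
    op S.δ.toLinearMap x (S.hodge w) = S.hodge (op S.δ.toLinearMap x w) :=
  (CQH.HermitianStructure.hodge_comm S.exists_isHodge (f := op S.δ.toLinearMap x) (s := id)
    (fun _ => rfl) (fun _ => rfl) (fun _ _ hw => op_mem_bideg S.toComplexSpace x hw)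
    (op_σ_pow_mul S x) w).symm

theorem op_delbarAdj (x : Uq D q) (w : Ω) :
    op S.δ.toLinearMap x (S.delbarAdj w) = S.delbarAdj (op S.δ.toLinearMap x w) := by
  rw [S.delbarAdj_apply, S.delbarAdj_apply, op_hodge, op_del, op_hodge]

theorem op_K_metric (i : ι) (w v : Ω) : op S.δ.toLinearMap (Uq.K D q i) (S.metric w v) =
    S.metric (op S.δ.toLinearMap (Uq.K' D q i) w) (op S.δ.toLinearMap (Uq.K D q i) v) := by
  simp only [CQH.HermitianStructure.metric, map_sum]
  refine Finset.sum_congr rfl fun k _ => ?_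
  rw [op_hodge, op_K_mul, op_hodge, op_K_starMap, op_projDeg, op_projDeg]

theorem op_E_metric (i : ι) (w v : Ω) : op S.δ.toLinearMap (Uq.E D q i) (S.metric w v) =
    S.metric w (op S.δ.toLinearMap (Uq.E D q i) v) -
      S.metric (op S.δ.toLinearMap (Uq.F D q i) w) (op S.δ.toLinearMap (Uq.K D q i) v) := by
  simp only [CQH.HermitianStructure.metric, map_sum, ← Finset.sum_sub_distrib]
  refine Finset.sum_congr rfl fun k _ => ?_
  rw [op_hodge, op_E_mul S.isCoaction, op_hodge, op_E_starMap, op_projDeg, op_projDeg, op_projDeg,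
    map_neg, neg_mul, map_add, map_neg]
  abel

theorem op_F_metric (i : ι) (w v : Ω) : op S.δ.toLinearMap (Uq.F D q i) (S.metric w v) =
    S.metric (op S.δ.toLinearMap (Uq.K D q i) w) (op S.δ.toLinearMap (Uq.F D q i) v) -
      S.metric (op S.δ.toLinearMap (Uq.E D q i) w) v := by
  simp only [CQH.HermitianStructure.metric, map_sum, ← Finset.sum_sub_distrib]
  refine Finset.sum_congr rfl fun k _ => ?_
  rw [op_hodge, op_F_mul S.isCoaction, op_hodge, op_F_starMap, op_hodge, op_K'_starMap, op_projDeg,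
    op_projDeg, op_projDeg, map_neg, neg_mul, map_add, map_neg]
  abel

theorem haarForm_op_metric (x : Uq D q) (w v : Ω) :
    S.haarForm (op S.δ.toLinearMap x (S.metric w v)) =
      Coalgebra.counit (R := ℂ) x * S.innerₛₗ w v := by
  obtain ⟨b, hb⟩ := CQH.HermitianStructure.metric_mem S.exists_isHodge w v
  rw [S.innerₛₗ_eq, ← hb]
  exact haarForm_op S.toComplexSpace x b

/-- The inner product is invariant for the compact real form. -/
theorem isInvariantForm_innerₛₗ : IsInvariantForm S.δ.toLinearMap S.innerₛₗ where
  pos := S.innerₛₗ_pos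
  map_K i w v := by
    rw [S.innerₛₗ_eq, ← op_K_metric, haarForm_op_metric, Uq.counit_gen]
    simp [Uq.counitGen]
  map_E i w v := by
    have h := haarForm_op_metric S (Uq.E D q i) w v
    rw [op_E_metric, map_sub, ← S.innerₛₗ_eq, ← S.innerₛₗ_eq, Uq.counit_gen] at h
    simpa [Uq.counitGen, sub_eq_zero] using h
  map_F i w v := by
    have h := haarForm_op_metric S (Uq.F D q i) w v
    rw [op_F_metric, map_sub, ← S.innerₛₗ_eq, ← S.innerₛₗ_eq, Uq.counit_gen] at h
    simpa [Uq.counitGen, sub_eq_zero] using h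

end Hermitian

end Calculus

end QuantumGroup

namespace QuantumGroup

/-! ### Uniqueness of highest weight vectors in multiplicity-free comodules -/

section Maximal

variable {ι : Type*} [DecidableEq ι] {D : CartanDatum ι} {q : Parameter}

/-- `v` is zero or a highest weight vector on which `Kᵢ` has the eigenvalue `qᵢ ^ μᵢ` for the right
action. -/
structure IsMaximal {V : Type*} [AddCommGroup V] [Module ℂ V] (δ : V →ₗ[ℂ] Oq D q ⊗[ℂ] V)
    (μ : ι → ℤ) (v : V) : Prop where
  map_E : ∀ i, op δ (Uq.E D q i) v = 0
  map_K : ∀ i, op δ (Uq.K D q i) v = (D.qi q i ^ μ i) • v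

variable {V : Type*} [AddCommGroup V] [Module ℂ V] {δ : V →ₗ[ℂ] Oq D q ⊗[ℂ] V} {μ : ι → ℤ}

theorem IsMaximal.exists_eigenvalue {v : V} (h : IsMaximal δ μ v) (i : ι) :
    ∃ c : ℂ, c ≠ 0 ∧ op δ (Uq.K D q i) v = c • v :=
  ⟨_, zpow_ne_zero _ (D.generic q i).ne_zero, h.map_K i⟩

theorem IsMaximal.map {v : V} (h : IsMaximal δ μ v) {f : V →ₗ[ℂ] V}
    (hf : ∀ x w, op δ x (f w) = f (op δ x w)) : IsMaximal δ μ (f v) where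
  map_E i := by rw [hf, h.map_E, map_zero]
  map_K i := by rw [hf, h.map_K, map_smul]

theorem IsMaximal.mul {Ω : Type*} [Ring Ω] [Algebra ℂ Ω] {δ : Ω →ₐ[ℂ] Oq D q ⊗[ℂ] Ω}
    (hδ : CQH.IsCoaction δ.toLinearMap) {μ ν : ι → ℤ} {w v : Ω}
    (hw : IsMaximal δ.toLinearMap μ w) (hv : IsMaximal δ.toLinearMap ν v) :
    IsMaximal δ.toLinearMap (μ + ν) (w * v) where
  map_E i := by rw [op_E_mul hδ, hw.map_E, hv.map_E, zero_mul, mul_zero, add_zero]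
  map_K i := by
    rw [op_K_mul, hw.map_K, hv.map_K, smul_mul_smul_comm, Pi.add_apply,
      zpow_add₀ (D.generic q i).ne_zero]

theorem IsMaximal.pow_mul {Ω : Type*} [Ring Ω] [Algebra ℂ Ω] {δ : Ω →ₐ[ℂ] Oq D q ⊗[ℂ] Ω}
    (hδ : CQH.IsCoaction δ.toLinearMap) {μ ν : ι → ℤ} {w v : Ω}
    (hw : IsMaximal δ.toLinearMap μ w) (hv : IsMaximal δ.toLinearMap ν v) (l : ℕ) :
    IsMaximal δ.toLinearMap (l • μ + ν) (w ^ l * v) := by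
  induction l with
  | zero => simpa
  | succ l ih =>
    have h := hw.mul hδ ih
    rwa [← add_assoc, ← mul_assoc, ← pow_succ', ← succ_nsmul'] at h

/-- A pair of maximal vectors of the same weight generates an irreducible module, being itself a
maximal vector for the diagonal coaction. -/
theorem irreducible_orbit_pair (hδ : CQH.IsCoaction δ) {B : V →ₗ⋆[ℂ] V →ₗ[ℂ] ℂ}
    (hB : IsInvariantForm δ B) {v w : V} (hv : IsMaximal δ μ v) (hw : IsMaximal δ μ w)
    {N : Submodule ℂ (V × V)} (hN : IsStable (prodCoaction δ) N)
    (hle : N ≤ LinearMap.range (orbit (prodCoaction δ) (v, w))) :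
    N = ⊥ ∨ N = LinearMap.range (orbit (prodCoaction δ) (v, w)) := by
  have hmax : IsMaximal (prodCoaction δ) μ (v, w) :=
    ⟨fun i => by rw [op_prodCoaction, hv.map_E, hw.map_E]; rfl,
      fun i => by rw [op_prodCoaction, hv.map_K, hw.map_K]; rfl⟩
  exact hB.prod.eq_bot_or_eq (isCoaction_prod hδ) hmax.map_E hmax.exists_eigenvalue hN hle

theorem exists_smul_of_relation {a b : ℂ} (hab : a ≠ 0 ∨ b ≠ 0) {v w : V} (hv0 : v ≠ 0)
    (h : a • v + b • w = 0) : ∃ c : ℂ, w = c • v := by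
  have hb : b ≠ 0 := by
    rintro rfl
    rw [zero_smul, add_zero, smul_eq_zero] at h
    rcases h with h | h
    · exact hab.elim (fun h' => h' h) (fun h' => h' rfl)
    · exact hv0 h
  refine ⟨-(b⁻¹ * a), ?_⟩
  have h1 : b • w = -(a • v) := by rw [eq_neg_iff_add_eq_zero, add_comm]; exact h
  rw [neg_smul, mul_smul, ← smul_neg, ← h1, smul_smul, inv_mul_cancel₀ hb, one_smul]

/-- In a multiplicity-free unitary comodule, maximal vectors of the same weight are proportional:
the pair `(v, w)` generates an irreducible module whose two projections are linearly dependent. -/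
theorem IsMaximal.exists_smul (hδ : CQH.IsCoaction δ) {B : V →ₗ⋆[ℂ] V →ₗ[ℂ] ℂ}
    (hB : IsInvariantForm δ B) {U : Submodule ℂ V} (hU : CQH.IsMultiplicityFree δ U)
    (hUs : IsStable δ U) {v w : V} (hv : IsMaximal δ μ v) (hw : IsMaximal δ μ w)
    (hvU : v ∈ U) (hwU : w ∈ U) (hv0 : v ≠ 0) : ∃ c : ℂ, w = c • v := by
  have hp := isCoaction_prod hδ
  have hfin := finiteDimensional_orbit (prodCoaction δ) (v, w)
  have hmem := mem_orbit hp (v, w)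
  obtain ⟨a, b, hab, h⟩ := exists_relation_of_isMultiplicityFree hδ hU (isStable_orbit hp (v, w))
    (fun h => by
      rw [h, Submodule.mem_bot] at hmem
      exact hv0 (congrArg Prod.fst hmem))
    (fun N' hle hN' => irreducible_orbit_pair hδ hB hv hw hN' hle)
    (by
      rintro _ ⟨x, rfl⟩
      rw [orbit_apply, op_prodCoaction]
      exact ⟨hUs x v hvU, hUs x w hwU⟩)
  exact exists_smul_of_relation hab hv0 (h _ hmem)

end Maximal

section Calculus

variable {ι : Type*} [DecidableEq ι] {D : CartanDatum ι} {q : Parameter}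
  {H : Type*} [Ring H] [HopfAlgebra ℂ H] [StarRing H] [StarModule ℂ H]
  {X : CQH.HomogeneousSpace (Oq D q) H} {Ω : Type*} [Ring Ω] [Algebra ℂ Ω] {n : ℕ}
  (S : CQH.HermitianSpace X Ω n) {μ : ι → ℤ}

theorem isStable_bideg (p : ℕ × ℕ) : IsStable S.δ.toLinearMap (S.bideg p) :=
  fun x _ hv => op_mem_bideg S.toComplexSpace x hv

theorem IsMaximal.exists_smul_of_gelfand (hS : S.IsGelfand) {k : ℕ} {v w : Ω}
    (hv : IsMaximal S.δ.toLinearMap μ v) (hw : IsMaximal S.δ.toLinearMap μ w)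
    (hvU : v ∈ S.bideg (0, k)) (hwU : w ∈ S.bideg (0, k)) (hv0 : v ≠ 0) : ∃ c : ℂ, w = c • v :=
  hv.exists_smul S.isCoaction (isInvariantForm_innerₛₗ S) (hS k) (isStable_bideg S _) hw hvU hwU hv0

/-- The conjugate-linear map `(v, w) ↦ (v^*, w^*)`. -/
noncomputable def starPair : Ω × Ω →ₗ⋆[ℂ] Ω × Ω where
  toFun w := (S.starMap w.1, S.starMap w.2)
  map_add' w v := by simp
  map_smul' c w := by simp [LinearMap.map_smulₛₗ]

theorem starPair_starPair (w : Ω × Ω) : starPair S (starPair S w) = w :=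
  Prod.ext (S.starMap_starMap w.1) (S.starMap_starMap w.2)

theorem map_starPair_map_starPair (N : Submodule ℂ (Ω × Ω)) :
    (N.map (starPair S)).map (starPair S) = N := by
  ext w
  simp only [Submodule.mem_map, exists_exists_and_eq_and, starPair_starPair, exists_eq_right]

theorem isStable_map_starPair {N : Submodule ℂ (Ω × Ω)}
    (hN : IsStable (prodCoaction S.δ.toLinearMap) N) :
    IsStable (prodCoaction S.δ.toLinearMap) (N.map (starPair S)) := by
  rintro x _ ⟨w, hw, rfl⟩
  refine ⟨_, hN (Uq.theta D q x) w hw, ?_⟩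
  rw [op_prodCoaction, op_prodCoaction]
  exact Prod.ext (op_starMap S.toComplexSpace x w.1).symm (op_starMap S.toComplexSpace x w.2).symm

/-- The forms of bidegree `(k, 0)` are also multiplicity-free, being the conjugates of the forms of
bidegree `(0, k)`. -/
theorem IsMaximal.exists_smul_of_gelfand_conj (hS : S.IsGelfand) {k : ℕ} {v w : Ω}
    (hv : IsMaximal S.δ.toLinearMap μ v) (hw : IsMaximal S.δ.toLinearMap μ w)
    (hvU : v ∈ S.bideg (k, 0)) (hwU : w ∈ S.bideg (k, 0)) (hv0 : v ≠ 0) : ∃ c : ℂ, w = c • v := by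
  have hp := isCoaction_prod S.isCoaction
  set N := LinearMap.range (orbit (prodCoaction S.δ.toLinearMap) (v, w)) with hNdef
  have hfin : FiniteDimensional ℂ N := finiteDimensional_orbit _ _
  have hmem : (v, w) ∈ N := mem_orbit hp (v, w)
  have hfin' : FiniteDimensional ℂ (N.map (starPair S)) :=
    Module.Finite.iff_fg.mpr ((Module.Finite.iff_fg.mp hfin).map _)
  obtain ⟨a, b, hab, h⟩ := exists_relation_of_isMultiplicityFree S.isCoaction (hS k)
    (N := N.map (starPair S)) (isStable_map_starPair S (isStable_orbit hp (v, w)))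
    (fun h => by
      have h1 : starPair S (v, w) ∈ N.map (starPair S) := ⟨_, hmem, rfl⟩
      rw [h, Submodule.mem_bot] at h1
      apply hv0
      rw [← S.starMap_starMap v, show S.starMap v = 0 from congrArg Prod.fst h1, map_zero])
    (fun N' hle hN' => by
      rcases irreducible_orbit_pair S.isCoaction (isInvariantForm_innerₛₗ S) hv hw
        (isStable_map_starPair S hN') (by
          rw [← hNdef, ← map_starPair_map_starPair S N]
          exact Submodule.map_mono hle) with h | h
      · left
        rw [← map_starPair_map_starPair S N', h, Submodule.map_bot]
      · right
        rw [← map_starPair_map_starPair S N', h])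
    (by
      rintro _ ⟨_, ⟨x, rfl⟩, rfl⟩
      rw [orbit_apply, op_prodCoaction]
      exact ⟨S.starMap_mem (isStable_bideg S _ x v hvU),
        S.starMap_mem (isStable_bideg S _ x w hwU)⟩)
  have h1 := congrArg S.starMap (h _ ⟨_, hmem, rfl⟩)
  simp only [starPair, LinearMap.coe_mk, AddHom.coe_mk, map_add, LinearMap.map_smulₛₗ,
    S.starMap_starMap, map_zero] at h1
  refine exists_smul_of_relation (a := conj a) (b := conj b) ?_ hv0 h1
  simpa using hab

end Calculus

end QuantumGroup

namespace CQH

/-- If `D z z = c z D z` and `D z v = a z D v`, then `D (z ^ l v)` is a multiple of `z ^ l D v`. -/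
theorem derivation_pow_mul_of_smul {R : Type*} [Ring R] [Algebra ℂ R] {D : R → R} {z v : R}
    {a c : ℂ} (hD : ∀ v, D (z * v) = D z * v + z * D v) (h : D z * z = c • (z * D z))
    (hv : D z * v = a • (z * D v)) (l : ℕ) :
    D (z ^ l * v) = (a * QuantumGroup.quantumInt l c + 1) • (z ^ l * D v) := by
  rw [derivation_pow_mul hD h, hv]
  cases l with
  | zero => simp [QuantumGroup.quantumInt]
  | succ l =>
    rw [mul_smul_comm, smul_smul, Nat.add_sub_cancel, ← mul_assoc, ← pow_succ, add_smul, one_smul,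
      mul_comm a]

end CQH

namespace QuantumGroup

/-! ### Laplacian eigenvalues along a ray of highest weights -/

section Ray

variable {ι : Type*} [DecidableEq ι] {D : CartanDatum ι} {q : Parameter}
  {H : Type*} [Ring H] [HopfAlgebra ℂ H] [StarRing H] [StarModule ℂ H]
  {X : CQH.HomogeneousSpace (Oq D q) H} {Ω : Type*} [Ring Ω] [Algebra ℂ Ω] {n : ℕ}
  (S : CQH.HermitianSpace X Ω n) {μ ν : ι → ℤ} {k : ℕ} {z : X.B} {ω : Ω}

theorem delbar_delbarAdj_mem {w : Ω} (hw : w ∈ S.bideg (0, k + 1)) :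
    S.delbar (S.delbarAdj w) ∈ S.bideg (0, k + 1) := S.delbar_mem (S.delbarAdj_mem hw)

theorem laplacian_mem {w : Ω} (hw : w ∈ S.bideg (0, k + 1)) :
    S.laplacian w ∈ S.bideg (0, k + 1) := by
  rw [S.laplacian_apply]
  exact add_mem (delbar_delbarAdj_mem S hw) (S.delbarAdj_mem (S.delbar_mem hw))

theorem IsMaximal.delbar {w : Ω} (hw : IsMaximal S.δ.toLinearMap μ w) :
    IsMaximal S.δ.toLinearMap μ (S.delbar w) := hw.map (op_delbar S.toComplexSpace)

theorem IsMaximal.del {w : Ω} (hw : IsMaximal S.δ.toLinearMap μ w) :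
    IsMaximal S.δ.toLinearMap μ (S.del w) := hw.map (op_del S.toComplexSpace)

theorem IsMaximal.delbarAdj {w : Ω} (hw : IsMaximal S.δ.toLinearMap μ w) :
    IsMaximal S.δ.toLinearMap μ (S.delbarAdj w) := hw.map (op_delbarAdj S)

theorem IsMaximal.laplacian {w : Ω} (hw : IsMaximal S.δ.toLinearMap μ w) :
    IsMaximal S.δ.toLinearMap μ (S.laplacian w) := hw.map fun x w => by
  rw [S.laplacian_apply, S.laplacian_apply, map_add, op_delbar, op_delbarAdj, op_delbarAdj,
    op_delbar]

/-- A highest weight vector of positive degree is an eigenvector of the Laplacian. -/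
theorem exists_hasEigenvector (hS : S.IsGelfand) {w : Ω} (hw : IsMaximal S.δ.toLinearMap μ w)
    (hmem : w ∈ S.bideg (0, k + 1)) (h0 : w ≠ 0) : ∃ c : ℂ, S.laplacian.HasEigenvector c w := by
  obtain ⟨c, hc⟩ := hw.exists_smul_of_gelfand S hS (hw.laplacian S) hmem (laplacian_mem S hmem) h0
  exact ⟨c, Module.End.hasEigenvector_iff.mpr ⟨Module.End.mem_eigenspace_iff.mpr hc, h0⟩⟩

/-- A highest weight vector is closed or coclosed, because `∂̄ ∂̄†` scales it. -/
theorem delbar_eq_zero_or_delbarAdj_eq_zero (hS : S.IsGelfand) {w : Ω}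
    (hw : IsMaximal S.δ.toLinearMap μ w) (hmem : w ∈ S.bideg (0, k + 1)) :
    S.delbar w = 0 ∨ S.delbarAdj w = 0 := by
  by_cases h0 : w = 0
  · simp [h0]
  obtain ⟨c, hc⟩ := hw.exists_smul_of_gelfand S hS ((hw.delbarAdj S).delbar S) hmem
    (delbar_delbarAdj_mem S hmem) h0
  by_cases hc0 : c = 0
  · right
    apply S.delbarAdj_eq_zero_of_delbar_delbarAdj
    rw [hc, hc0, zero_smul]
  · left
    have h1 := congrArg S.delbar hc
    rw [S.delbar_delbar, map_smul, eq_comm, smul_eq_zero] at h1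
    exact h1.resolve_left hc0

theorem existsUnique_smul {y x : Ω} (hy : y ≠ 0) (h : ∃ c : ℂ, x = c • y) :
    ∃! c : ℂ, x = c • y := by
  obtain ⟨c, hc⟩ := h
  exact ⟨c, hc, fun c' hc' => smul_left_injective ℂ hy (hc'.symm.trans hc)⟩

theorem ne_zero_of_ι_ne_zero (hz0 : S.ι z ≠ 0) : z ≠ 0 := by
  rintro rfl
  exact hz0 (map_zero _)

theorem hodge_del_hodge_mem (hmem : ω ∈ S.bideg (0, k + 1)) :
    S.del (S.hodge ω) ∈ S.bideg (n - (k + 1) + 1, n) :=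
  S.del_mem (CQH.HermitianStructure.hodge_mem S.exists_isHodge hmem)

theorem ι_mul_del_hodge_ne_zero (hz0 : S.ι z ≠ 0) (hadj : S.delbarAdj ω ≠ 0) :
    S.ι z * S.del (S.hodge ω) ≠ 0 := by
  refine S.ι_mul_ne_zero ?_ (ne_zero_of_ι_ne_zero S hz0)
  intro h
  apply hadj
  rw [S.delbarAdj_apply, h, map_zero]

/-- Existence of the scalar `A`: by uniqueness of highest weight vectors `∂̄† (z ω)` is a multiple
of `z ∂̄† ω`. -/
theorem exists_del_mul_hodge (hS : S.IsGelfand) (hz0 : S.ι z ≠ 0)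
    (hz : IsMaximal S.δ.toLinearMap μ (S.ι z)) (hω : IsMaximal S.δ.toLinearMap ν ω)
    (hmem : ω ∈ S.bideg (0, k + 1)) (hadj : S.delbarAdj ω ≠ 0) :
    ∃ a : ℂ, S.del (S.ι z) * S.hodge ω = a • (S.ι z * S.del (S.hodge ω)) := by
  have hT := S.exists_isHodge
  obtain ⟨c, hc⟩ := (hz.mul S.isCoaction (hω.delbarAdj S)).exists_smul_of_gelfand S hS
    ((hz.mul S.isCoaction hω).delbarAdj S) (S.ι_mul_mem z (S.delbarAdj_mem hmem))
    (S.delbarAdj_mem (S.ι_mul_mem z hmem)) (S.ι_mul_ne_zero hadj (ne_zero_of_ι_ne_zero S hz0))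
  refine ⟨c - 1, sub_eq_zero.mp ?_⟩
  rw [S.delbarAdj_ι_mul] at hc
  refine CQH.HermitianStructure.eq_zero_of_hodge_eq_zero hT (p := (n - (k + 1) + 1, n))
    (sub_mem ?_ (Submodule.smul_mem _ _ (S.ι_mul_mem z (hodge_del_hodge_mem S hmem)))) ?_
  · have h1 := S.mul_mem_bideg (S.del_mem (S.ι_mem z))
      (CQH.HermitianStructure.hodge_mem hT hmem)
    convert h1 using 2
    ext
    · simp
      omega
    · simp
  · rw [map_sub, map_smul, CQH.HermitianStructure.hodge_ι_mul hT, ← S.delbarAdj_apply, sub_smul,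
      ← hc, one_smul]
    abel

/-- Existence of the scalar `B`: by uniqueness of highest weight vectors `∂̄ (z ∂̄† ω)` is a
multiple of `z ∂̄ ∂̄† ω`. -/
theorem exists_delbar_mul_delbarAdj (hS : S.IsGelfand) (hz0 : S.ι z ≠ 0)
    (hz : IsMaximal S.δ.toLinearMap μ (S.ι z)) (hω : IsMaximal S.δ.toLinearMap ν ω)
    (hmem : ω ∈ S.bideg (0, k + 1)) (hlap : S.delbar (S.delbarAdj ω) ≠ 0) :
    ∃ b : ℂ, S.delbar (S.ι z) * S.delbarAdj ω = b • (S.ι z * S.delbar (S.delbarAdj ω)) := by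
  obtain ⟨c, hc⟩ := (hz.mul S.isCoaction ((hω.delbarAdj S).delbar S)).exists_smul_of_gelfand S hS
    ((hz.mul S.isCoaction (hω.delbarAdj S)).delbar S)
    (S.ι_mul_mem z (delbar_delbarAdj_mem S hmem))
    (S.delbar_mem (S.ι_mul_mem z (S.delbarAdj_mem hmem)))
    (S.ι_mul_ne_zero hlap (ne_zero_of_ι_ne_zero S hz0))
  refine ⟨c - 1, ?_⟩
  rw [sub_smul, ← hc, S.delbar_ι_mul]
  simp

/-- Existence of the scalars `λ` and `ζ`, for `x = ∂z` or `x = ∂̄z`. They are non-zero as `x z`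
is. -/
theorem exists_commutation {x : Ω} (hz0 : S.ι z ≠ 0) (hx : x ≠ 0)
    (h : ∀ y, y ≠ 0 → y = S.ι z * x → ∃ c : ℂ, x * S.ι z = c • y) :
    ∃ c : ℂ, c ≠ 0 ∧ ∀ c' : ℂ, x * S.ι z = c' • (S.ι z * x) ↔ c' = c := by
  have hz0' := ne_zero_of_ι_ne_zero S hz0
  have hy := S.ι_mul_ne_zero hx hz0'
  obtain ⟨c, hc⟩ := h _ hy rfl
  refine ⟨c, ?_, fun c' => ⟨fun h' => smul_left_injective ℂ hy (h'.symm.trans hc), ?_⟩⟩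
  · rintro rfl
    rw [zero_smul] at hc
    exact S.mul_ι_ne_zero hx hz0' hc
  · rintro rfl
    exact hc

theorem exists_commutation_del (hS : S.IsGelfand) (hz0 : S.ι z ≠ 0)
    (hz : IsMaximal S.δ.toLinearMap μ (S.ι z)) (hx : S.del (S.ι z) ≠ 0) :
    ∃ c : ℂ, c ≠ 0 ∧
      ∀ c' : ℂ, S.del (S.ι z) * S.ι z = c' • (S.ι z * S.del (S.ι z)) ↔ c' = c :=
  exists_commutation S hz0 hx fun y hy e => by
    subst e
    exact (hz.mul S.isCoaction (hz.del S)).exists_smul_of_gelfand_conj S hS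
      ((hz.del S).mul S.isCoaction hz) (S.ι_mul_mem z (S.del_mem (S.ι_mem z)))
      (S.mul_ι_mem (S.del_mem (S.ι_mem z)) z) hy

theorem exists_commutation_delbar (hS : S.IsGelfand) (hz0 : S.ι z ≠ 0)
    (hz : IsMaximal S.δ.toLinearMap μ (S.ι z)) (hx : S.delbar (S.ι z) ≠ 0) :
    ∃ c : ℂ, c ≠ 0 ∧
      ∀ c' : ℂ, S.delbar (S.ι z) * S.ι z = c' • (S.ι z * S.delbar (S.ι z)) ↔ c' = c :=
  exists_commutation S hz0 hx fun y hy e => by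
    subst e
    exact (hz.mul S.isCoaction (hz.delbar S)).exists_smul_of_gelfand S hS
      ((hz.delbar S).mul S.isCoaction hz) (S.ι_mul_mem z (S.delbar_mem (S.ι_mem z)))
      (S.mul_ι_mem (S.delbar_mem (S.ι_mem z)) z) hy

section Eigenvalue

variable {a b c d : ℂ}

theorem delbarAdj_pow_mul (ha : S.del (S.ι z) * S.hodge ω = a • (S.ι z * S.del (S.hodge ω)))
    (hc : S.del (S.ι z) * S.ι z = c • (S.ι z * S.del (S.ι z))) (l : ℕ) :
    S.delbarAdj (S.ι z ^ l * ω) =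
      (a * quantumInt l c + 1) • (S.ι z ^ l * S.delbarAdj ω) := by
  have hT := S.exists_isHodge
  rw [S.delbarAdj_apply, ← map_pow, CQH.HermitianStructure.hodge_ι_mul hT, map_pow,
    CQH.derivation_pow_mul_of_smul (S.del_ι_mul z) hc ha, map_smul, ← map_pow,
    CQH.HermitianStructure.hodge_ι_mul hT, S.delbarAdj_apply]

/-- Unless both commutation scalars are `-1`, the form `∂̄z ∧ ω` vanishes. Otherwise, as each
`z ^ l ω` is closed or coclosed, the cases `l = 1`, `l = 2` and `l = 3` successively give `a = -1`,
`d = -1` and `c = -1`. -/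
theorem delbar_mul_eq_zero (hS : S.IsGelfand) (hz0 : S.ι z ≠ 0)
    (hz : IsMaximal S.δ.toLinearMap μ (S.ι z)) (hω : IsMaximal S.δ.toLinearMap ν ω)
    (hmem : ω ∈ S.bideg (0, k + 1)) (hadj : S.delbarAdj ω ≠ 0) (hclosed : S.delbar ω = 0)
    (ha : S.del (S.ι z) * S.hodge ω = a • (S.ι z * S.del (S.hodge ω)))
    (hc : S.del (S.ι z) * S.ι z = c • (S.ι z * S.del (S.ι z)))
    (hd : S.delbar (S.ι z) * S.ι z = d • (S.ι z * S.delbar (S.ι z)))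
    (hcd : ¬(c = -1 ∧ d = -1)) : S.delbar (S.ι z) * ω = 0 := by
  by_contra hne
  have hz0' := ne_zero_of_ι_ne_zero S hz0
  have hdelbar : ∀ l, S.delbar (S.ι z ^ l * ω) = 0 → quantumInt l d = 0 := by
    intro l h
    rw [CQH.derivation_pow_mul (S.delbar_ι_mul z) hd, hclosed, mul_zero, add_zero,
      smul_eq_zero] at h
    exact h.resolve_right (S.ι_pow_mul_ne_zero hne hz0' _)
  have hdelbarAdj : ∀ l, S.delbarAdj (S.ι z ^ l * ω) = 0 → a * quantumInt l c + 1 = 0 := by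
    intro l h
    rw [delbarAdj_pow_mul S ha hc, smul_eq_zero] at h
    exact h.resolve_right (S.ι_pow_mul_ne_zero hadj hz0' _)
  have hor : ∀ l, quantumInt l d = 0 ∨ a * quantumInt l c + 1 = 0 := fun l =>
    (delbar_eq_zero_or_delbarAdj_eq_zero S hS (hz.pow_mul S.isCoaction hω l)
      (S.ι_pow_mul_mem z hmem l)).imp (hdelbar l) (hdelbarAdj l)
  have q1 : ∀ x, quantumInt 1 x = 1 := fun x => by simp [quantumInt]
  have q2 : ∀ x, quantumInt 2 x = 1 + x := fun x => by simp [quantumInt, Finset.sum_range_succ]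
  have q3 : ∀ x, quantumInt 3 x = 1 + x + x ^ 2 := fun x => by
    simp [quantumInt, Finset.sum_range_succ]
  have e1 : a = -1 := by
    have := hor 1
    rw [q1, q1] at this
    exact eq_neg_of_add_eq_zero_left (by simpa using this)
  have hdel : S.del (S.ι z) ≠ 0 := by
    intro h
    rw [h, zero_mul, eq_comm, smul_eq_zero, e1] at ha
    exact ι_mul_del_hodge_ne_zero S hz0 hadj (ha.resolve_left (by norm_num))
  have hc0 : c ≠ 0 := by
    rintro rfl
    rw [zero_smul] at hc
    exact S.mul_ι_ne_zero hdel hz0' hc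
  have e2 : d = -1 := by
    have := hor 2
    rw [q2, q2, e1] at this
    rcases this with h | h
    · exact eq_neg_of_add_eq_zero_right h
    · exact absurd (by linear_combination -h) hc0
  have e3 : c = -1 := by
    have := hor 3
    rw [q3, q3, e1, e2] at this
    rcases this with h | h
    · norm_num at h
    · have h' : c * (1 + c) = 0 := by linear_combination -h
      exact eq_neg_of_add_eq_zero_right ((mul_eq_zero.mp h').resolve_left hc0)
  exact hcd ⟨e3, e2⟩

theorem laplacian_pow_mul (hclosed : S.delbar ω = 0) (hzω : S.delbar (S.ι z) * ω = 0)
    (ha : S.del (S.ι z) * S.hodge ω = a • (S.ι z * S.del (S.hodge ω)))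
    (hb : S.delbar (S.ι z) * S.delbarAdj ω = b • (S.ι z * S.delbar (S.delbarAdj ω)))
    (hc : S.del (S.ι z) * S.ι z = c • (S.ι z * S.del (S.ι z)))
    (hd : S.delbar (S.ι z) * S.ι z = d • (S.ι z * S.delbar (S.ι z)))
    {m : ℂ} (hm : S.laplacian ω = m • ω) (l : ℕ) :
    S.laplacian (S.ι z ^ l * ω) =
      ((a * quantumInt l c + 1) * (b * quantumInt l d + 1) * m) • (S.ι z ^ l * ω) := by
  have h1 : S.delbar (S.ι z ^ l * ω) = 0 := by
    rw [CQH.derivation_pow_mul (S.delbar_ι_mul z) hd, hclosed, hzω]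
    simp
  rw [S.laplacian_apply, hclosed, map_zero, add_zero] at hm
  rw [S.laplacian_apply, h1, map_zero, add_zero, delbarAdj_pow_mul S ha hc, map_smul,
    CQH.derivation_pow_mul_of_smul (S.delbar_ι_mul z) hd hb, hm, mul_smul_comm, smul_smul,
    smul_smul, mul_assoc]

end Eigenvalue

end Ray

end QuantumGroup

namespace QuantumGroup

/-! ### Weights and the leading term of a coaction -/

section Weight

theorem Generic.zpow_injective {x : ℂ} (hx : Generic x) : Function.Injective (x ^ · : ℤ → ℂ) := by
  have key : ∀ m : ℤ, x ^ m = 1 → m = 0 := by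
    intro m hm
    by_contra hne
    apply hx.pow_ne_one m.natAbs (by omega)
    have h : x ^ ((2 * m.natAbs : ℕ) : ℤ) = (x ^ m) ^ (2 * m.sign) := by
      rw [← zpow_mul]
      congr 1
      rw [Nat.cast_mul, Int.natCast_natAbs, ← Int.sign_mul_self_eq_abs]
      push_cast
      ring
    rw [← zpow_natCast, h, hm, one_zpow]
  intro m m' h
  simp only at h
  refine sub_eq_zero.mp (key _ ?_)
  rw [zpow_sub₀ hx.ne_zero, h, div_self (zpow_ne_zero _ hx.ne_zero)]

variable {ι : Type*} [DecidableEq ι] {D : CartanDatum ι} {q : Parameter}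

/-- `v` is zero or a weight vector on which `Kᵢ` has the eigenvalue `qᵢ ^ μᵢ` for the right
action. -/
def IsWeight {V : Type*} [AddCommGroup V] [Module ℂ V] (δ : V →ₗ[ℂ] Oq D q ⊗[ℂ] V)
    (μ : ι → ℤ) (v : V) : Prop :=
  ∀ i, op δ (Uq.K D q i) v = (D.qi q i ^ μ i) • v

variable {V : Type*} [AddCommGroup V] [Module ℂ V] {δ : V →ₗ[ℂ] Oq D q ⊗[ℂ] V} {μ ν : ι → ℤ}

theorem IsWeight.word (hδ : CQH.IsCoaction δ) {v : V} (hv : IsWeight δ μ v) (L : List ι) :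
    IsWeight δ (fun i => μ i - (L.map (D.a i)).sum)
      (L.foldr (fun j w => op δ (Uq.E D q j) w) v) := by
  induction L with
  | nil => simpa using hv
  | cons j L ih =>
    intro i
    rw [List.foldr_cons, op_K_E hδ, ih i, map_smul, smul_smul,
      ← zpow_add₀ (D.generic q i).ne_zero]
    congr 2
    simp only [List.map_cons, List.sum_cons]
    ring

theorem IsWeight.map {v : V} (hv : IsWeight δ μ v) {f : V →ₗ[ℂ] V}
    (hf : ∀ x w, op δ x (f w) = f (op δ x w)) : IsWeight δ μ (f v) := fun i => by
  rw [hf, hv i, map_smul]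

theorem IsWeight.mul {Ω : Type*} [Ring Ω] [Algebra ℂ Ω] {δ : Ω →ₐ[ℂ] Oq D q ⊗[ℂ] Ω} {w v : Ω}
    (hw : IsWeight δ.toLinearMap μ w) (hv : IsWeight δ.toLinearMap ν v) :
    IsWeight δ.toLinearMap (μ + ν) (w * v) := fun i => by
  rw [op_K_mul, hw i, hv i, smul_mul_smul_comm, Pi.add_apply,
    zpow_add₀ (D.generic q i).ne_zero]

theorem IsWeight.sub_smul {w v : V} (hw : IsWeight δ μ w) (hv : IsWeight δ μ v) (c : ℂ) :
    IsWeight δ μ (w - c • v) := fun i => by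
  rw [map_sub, map_smul, hw i, hv i, smul_sub, smul_comm]

/-- Vectors of different weights are orthogonal, the `Kᵢ` being self-adjoint. -/
theorem IsInvariantForm.eq_zero_of_weight_ne {B : V →ₗ⋆[ℂ] V →ₗ[ℂ] ℂ} (hB : IsInvariantForm δ B)
    (hδ : CQH.IsCoaction δ) {w v : V} (hw : IsWeight δ μ w) (hv : IsWeight δ ν v) (h : μ ≠ ν) :
    B w v = 0 := by
  by_contra hne
  apply h
  ext i
  apply (D.generic q i).zpow_injective
  have h1 := hB.adj_K hδ i w v
  rw [hw i, hv i, map_smul, LinearMap.map_smulₛₗ, LinearMap.smul_apply, map_zpow₀, D.conj_qi,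
    smul_eq_mul, smul_eq_mul] at h1
  exact (mul_right_cancel₀ hne h1).symm

/-- Contractions separate the elements of `A ⊗ V`. -/
theorem eq_of_contract_eq {s t : Oq D q ⊗[ℂ] V} (h : ∀ x, contract V x s = contract V x t) :
    s = t := by
  obtain ⟨u, hu⟩ := mem_range_lTensor (N := (⊥ : Submodule ℂ V)) (t := s - t) fun x => by
    rw [map_sub, h, sub_self]
    exact zero_mem _
  have h0 : (⊥ : Submodule ℂ V).subtype = 0 := by
    ext v
    exact v.2
  rw [h0, LinearMap.lTensor_zero, LinearMap.zero_apply] at hu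
  exact sub_eq_zero.mp hu.symm

theorem exists_tmul_add_lTensor {N : Submodule ℂ V} {y : V} {t : Oq D q ⊗[ℂ] V}
    (h : ∀ x, contract V x t ∈ Submodule.span ℂ {y} ⊔ N) :
    ∃ (a : Oq D q) (s : Oq D q ⊗[ℂ] N), t = a ⊗ₜ y + N.subtype.lTensor _ s := by
  obtain ⟨u, rfl⟩ := mem_range_lTensor h
  induction u with
  | zero => exact ⟨0, 0, by simp⟩
  | add s t hs ht =>
    obtain ⟨a, s', hs⟩ := hs fun x => by rw [contract_lTensor]; exact SetLike.coe_mem _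
    obtain ⟨b, t', ht⟩ := ht fun x => by rw [contract_lTensor]; exact SetLike.coe_mem _
    exact ⟨a + b, s' + t', by rw [map_add, hs, ht, TensorProduct.add_tmul, map_add]; abel⟩
  | tmul a v =>
    obtain ⟨v, hv⟩ := v
    obtain ⟨w, hw, p, hp, rfl⟩ := Submodule.mem_sup.mp hv
    obtain ⟨c, rfl⟩ := Submodule.mem_span_singleton.mp hw
    refine ⟨c • a, a ⊗ₜ ⟨p, hp⟩, ?_⟩
    simp [TensorProduct.tmul_add, TensorProduct.smul_tmul]

/-- If a bilinear form vanishes on `y × N`, `N × y` and `N × N`, its extension to `A ⊗ V` only sees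
the coefficient of `y`. -/
theorem map₂_mul_tmul_add {A : Type*} [Ring A] [Algebra ℂ A] {N : Submodule ℂ V}
    {β : V →ₗ[ℂ] V →ₗ[ℂ] ℂ} {y : V}
    (h1 : ∀ v ∈ N, β y v = 0) (h2 : ∀ v ∈ N, β v y = 0) (h3 : ∀ v ∈ N, ∀ w ∈ N, β v w = 0)
    (a : A) (s : A ⊗[ℂ] N) :
    TensorProduct.map₂ (LinearMap.mul ℂ A) β (a ⊗ₜ y + N.subtype.lTensor _ s)
      (a ⊗ₜ y + N.subtype.lTensor _ s) = (a * a) ⊗ₜ β y y := by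
  have e1 : ∀ t : A ⊗[ℂ] N, TensorProduct.map₂ (LinearMap.mul ℂ A) β (a ⊗ₜ y)
      (N.subtype.lTensor _ t) = 0 := by
    intro t
    induction t with
    | zero => simp
    | add s t hs ht => rw [map_add, map_add, hs, ht, add_zero]
    | tmul b v => simp [h1]
  have e2 : ∀ t : A ⊗[ℂ] N, TensorProduct.map₂ (LinearMap.mul ℂ A) β (N.subtype.lTensor _ t)
      (a ⊗ₜ y) = 0 := by
    intro t
    induction t with
    | zero => simp
    | add s t hs ht => rw [map_add, map_add, LinearMap.add_apply, hs, ht, add_zero]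
    | tmul b v => simp [h2]
  have e3 : ∀ s t : A ⊗[ℂ] N, TensorProduct.map₂ (LinearMap.mul ℂ A) β (N.subtype.lTensor _ s)
      (N.subtype.lTensor _ t) = 0 := by
    intro s t
    induction s with
    | zero => simp
    | add s t hs ht => rw [map_add, map_add, LinearMap.add_apply, hs, ht, add_zero]
    | tmul b v =>
      induction t with
      | zero => simp
      | add s t hs ht => rw [map_add, map_add, hs, ht, add_zero]
      | tmul b v => simp [h3]
  simp only [map_add, LinearMap.add_apply, e1, e2, e3, add_zero]
  exact TensorProduct.map_tmul _ _ _ _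

end Weight

section LowestWeight

variable {ι : Type*} [DecidableEq ι] {D : CartanDatum ι} {q : Parameter}
  {Ω : Type*} [Ring Ω] [Algebra ℂ Ω] {δ : Ω →ₐ[ℂ] Oq D q ⊗[ℂ] Ω}

/-- The bilinear map `(u, v) ↦ f u * v - c • u * f v`. -/
noncomputable def twistedCommutator (f : Ω →ₗ[ℂ] Ω) (c : ℂ) : Ω →ₗ[ℂ] Ω →ₗ[ℂ] Ω :=
  (LinearMap.mul ℂ Ω).comp f - c • (LinearMap.mul ℂ Ω).compl₂ f

@[simp] theorem twistedCommutator_apply (f : Ω →ₗ[ℂ] Ω) (c : ℂ) (u v : Ω) :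
    twistedCommutator f c u v = f u * v - c • (u * f v) := rfl

theorem map₂_twistedCommutator (f : Ω →ₗ[ℂ] Ω) (c : ℂ) (g : Ω →ₗ[ℂ] ℂ) (s t : Oq D q ⊗[ℂ] Ω) :
    TensorProduct.map₂ (LinearMap.mul ℂ (Oq D q)) ((twistedCommutator f c).compr₂ g) s t =
      g.lTensor _ (f.lTensor _ s * t - c • (s * f.lTensor _ t)) := by
  induction s with
  | zero => simp
  | add s s' hs hs' =>
    simp only [map_add, LinearMap.add_apply, hs, hs', add_mul, smul_add, map_sub]
    abel
  | tmul a u =>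
    induction t with
    | zero => simp
    | add t t' ht ht' =>
      simp only [map_add, ht, ht', mul_add, smul_add, map_sub]
      abel
    | tmul b v =>
      simp [TensorProduct.tmul_sub, ← TensorProduct.tmul_smul]

/-- A quadratic relation satisfied by a vector `z` is inherited by a lowest weight vector `y` of the
module generated by `z`. Write the coaction of `z` as `a ⊗ y` plus terms in other weights: the
coefficient of the relation for `y` in the relation for `z` is `a ^ 2`, and `a ≠ 0`. -/
theorem twistedCommutator_lowest [NoZeroDivisors (Oq D q)]
    (hδ : CQH.IsCoaction δ.toLinearMap) {B : Ω →ₗ⋆[ℂ] Ω →ₗ[ℂ] ℂ}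
    (hB : IsInvariantForm δ.toLinearMap B)
    (hD : ∀ L : List ι, (∀ i, (L.map (D.a i)).sum = 0) → L = [])
    {f : Ω →ₗ[ℂ] Ω} (hf : ∀ x w, op δ.toLinearMap x (f w) = f (op δ.toLinearMap x w))
    {μ : ι → ℤ} {y z : Ω} (hyF : ∀ i, op δ.toLinearMap (Uq.F D q i) y = 0)
    (hy : IsWeight δ.toLinearMap μ y) (hy0 : y ≠ 0)
    (horb : LinearMap.range (orbit δ.toLinearMap z) = LinearMap.range (orbit δ.toLinearMap y))
    {c : ℂ} (h : twistedCommutator f c z z = 0) : twistedCommutator f c y y = 0 := by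
  set word : List ι → Ω :=
    fun L => L.foldr (fun j w => op δ.toLinearMap (Uq.E D q j) w) y with hword
  set N : Submodule ℂ Ω := Submodule.span ℂ (Set.range fun L : ι × List ι => word (L.1 :: L.2))
    with hN
  set e := twistedCommutator f c y y with he
  have hwt : ∀ L L', IsWeight δ.toLinearMap
      (fun i => μ i + μ i - ((L ++ L').map (D.a i)).sum)
      (twistedCommutator f c (word L) (word L')) := by
    intro L L'
    have h1 := hy.word hδ L
    have h2 := hy.word hδ L'
    rw [twistedCommutator_apply]
    convert ((h1.map hf).mul h2).sub_smul (h1.mul (h2.map hf)) c using 1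
    ext i
    simp only [Pi.add_apply, List.map_append, List.sum_append]
    ring
  have horth : ∀ L L', L ++ L' ≠ [] → B e (twistedCommutator f c (word L) (word L')) = 0 := by
    intro L L' hne
    refine hB.eq_zero_of_weight_ne hδ (hwt [] []) (hwt L L') fun h => hne (hD _ fun i => ?_)
    have := congrFun h i
    simp only [List.append_nil, List.map_nil, List.sum_nil, sub_zero] at this
    linarith
  have h1 : ∀ v ∈ N, (twistedCommutator f c).compr₂ (B e) y v = 0 := by
    have : N ≤ LinearMap.ker ((twistedCommutator f c).compr₂ (B e) y) := by
      refine Submodule.span_le.mpr ?_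
      rintro _ ⟨L, rfl⟩
      exact horth [] (L.1 :: L.2) (by simp)
    exact this
  have h2 : ∀ v ∈ N, (twistedCommutator f c).compr₂ (B e) v y = 0 := by
    have : N ≤ LinearMap.ker (((twistedCommutator f c).compr₂ (B e)).flip y) := by
      refine Submodule.span_le.mpr ?_
      rintro _ ⟨L, rfl⟩
      exact horth (L.1 :: L.2) [] (by simp)
    exact this
  have h3 : ∀ v ∈ N, ∀ w ∈ N, (twistedCommutator f c).compr₂ (B e) v w = 0 := by
    intro v hv w hw
    have : N ≤ LinearMap.ker ((twistedCommutator f c).compr₂ (B e) v) := by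
      refine Submodule.span_le.mpr ?_
      rintro _ ⟨L, rfl⟩
      have : N ≤
          LinearMap.ker (((twistedCommutator f c).compr₂ (B e)).flip (word (L.1 :: L.2))) := by
        refine Submodule.span_le.mpr ?_
        rintro _ ⟨L', rfl⟩
        exact horth (L'.1 :: L'.2) (L.1 :: L.2) (by simp)
      exact this hv
    exact this hw
  have hK : ∀ i, ∃ c : ℂ, c ≠ 0 ∧ op δ.toLinearMap (Uq.K D q i) y = c • y := fun i =>
    ⟨_, zpow_ne_zero _ (D.generic q i).ne_zero, hy i⟩
  obtain ⟨a, s, has⟩ := exists_tmul_add_lTensor (N := N) (y := y) (t := δ z) fun x => by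
    have hx : op δ.toLinearMap x z ∈ wordSpan (fun i => op δ.toLinearMap (Uq.E D q i)) y := by
      rw [← orbit_eq_wordSpan_E hδ hyF hK, ← horb]
      exact ⟨x, rfl⟩
    obtain ⟨b, p, hp, hbp⟩ := exists_smul_add_of_mem_wordSpan hx
    rw [← AlgHom.toLinearMap_apply, ← op_apply, hbp]
    exact Submodule.add_mem_sup (Submodule.smul_mem _ _ (Submodule.mem_span_singleton_self y)) hp
  -- if `a` were zero, `y` would be a combination of non-empty words, to which it is orthogonal
  have ha : a ≠ 0 := by
    rintro rfl
    obtain ⟨x, hx⟩ : y ∈ LinearMap.range (orbit δ.toLinearMap z) := horb ▸ mem_orbit hδ y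
    have hyN : y ∈ N := by
      rw [← hx, orbit_apply, op_apply, AlgHom.toLinearMap_apply, has, TensorProduct.zero_tmul,
        zero_add, contract_lTensor]
      exact SetLike.coe_mem _
    have hle : N ≤ LinearMap.ker (B y) := by
      refine Submodule.span_le.mpr ?_
      rintro _ ⟨L, rfl⟩
      change B y (op δ.toLinearMap (Uq.E D q L.1) (word L.2)) = 0
      rw [hB.adj_E hδ, hyF, map_zero, map_zero, LinearMap.zero_apply]
    exact hy0 (hB.pos.eq_zero (hle hyN))
  have hδf : ∀ w, δ (f w) = f.lTensor _ (δ w) := fun w => eq_of_contract_eq fun x => by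
    rw [contract_lTensor]
    exact hf x w
  have key := map₂_twistedCommutator f c (B e) (δ z) (δ z)
  rw [← hδf, ← map_mul, ← map_mul, ← map_smul, ← map_sub, ← twistedCommutator_apply, h, map_zero,
    map_zero, has, map₂_mul_tmul_add h1 h2 h3] at key
  have key' := congrArg (TensorProduct.rid ℂ (Oq D q)) key
  rw [TensorProduct.rid_tmul, map_zero, smul_eq_zero] at key'
  exact hB.pos.eq_zero (key'.resolve_right (mul_ne_zero ha ha))

end LowestWeight

/-! ### Self-conjugate spaces -/

section SelfConjugate

variable {ι : Type*} [DecidableEq ι] {D : CartanDatum ι} {q : Parameter}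
  {H : Type*} [Ring H] [HopfAlgebra ℂ H] [StarRing H] [StarModule ℂ H]
  {X : CQH.HomogeneousSpace (Oq D q) H} {Ω : Type*} [Ring Ω] [Algebra ℂ Ω] {n : ℕ}
  (S : CQH.HermitianSpace X Ω n) {μ : ι → ℤ} {z : X.B}

theorem IsMaximal.op_F_starMap_eq_zero {w : Ω} (hw : IsMaximal S.δ.toLinearMap μ w) (i : ι) :
    op S.δ.toLinearMap (Uq.F D q i) (S.starMap w) = 0 := by
  rw [op_F_starMap, hw.map_E, map_zero, neg_zero]

theorem IsMaximal.isWeight_starMap {w : Ω} (hw : IsMaximal S.δ.toLinearMap μ w) :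
    IsWeight S.δ.toLinearMap (-μ) (S.starMap w) := fun i => by
  have h0 := zpow_ne_zero (μ i) (D.generic q i).ne_zero
  rw [op_K_starMap, op_K'_eq S.isCoaction h0 (hw.map_K i), LinearMap.map_smulₛₗ, map_inv₀,
    map_zpow₀, D.conj_qi, Pi.neg_apply, zpow_neg]

/-- On a self-conjugate space, a highest weight function and its adjoint generate the same
irreducible module. -/
theorem orbit_starMap (hconj : S.IsSelfConjugate) (hz0 : S.ι z ≠ 0)
    (hz : IsMaximal S.δ.toLinearMap μ (S.ι z)) :
    LinearMap.range (orbit S.δ.toLinearMap (S.ι z)) =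
      LinearMap.range (orbit S.δ.toLinearMap (S.starMap (S.ι z))) := by
  have hδ := S.isCoaction
  have hirr : ∀ N : Submodule ℂ Ω, IsStable S.δ.toLinearMap N →
      N ≤ LinearMap.range (orbit S.δ.toLinearMap (S.ι z)) →
      N = ⊥ ∨ N = LinearMap.range (orbit S.δ.toLinearMap (S.ι z)) := fun N hN hle =>
    (isInvariantForm_innerₛₗ S).eq_bot_or_eq hδ hz.map_E hz.exists_eigenvalue hN hle
  have hmem : S.starMap (S.ι z) ∈ LinearMap.range (orbit S.δ.toLinearMap (S.ι z)) := by
    refine hconj _ (orbit_le (fun x v hv => op_mem_deg S.toComplexSpace x hv) (S.ι_mem_deg z))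
      ⟨isSubcomodule_iff.mpr (isStable_orbit hδ _), ?_, fun N hle hN =>
        hirr N (isSubcomodule_iff.mp hN) hle⟩ _ (mem_orbit hδ _)
    intro h
    exact hz0 ((Submodule.mem_bot ℂ).mp (h ▸ mem_orbit hδ (S.ι z)))
  refine ((hirr _ (isStable_orbit hδ _) (orbit_le (isStable_orbit hδ _) hmem)).resolve_left ?_).symm
  intro h
  refine hz0 (S.starMap_injective ?_)
  rw [map_zero]
  exact (Submodule.mem_bot ℂ).mp (h ▸ mem_orbit hδ _)

/-- `∂z = 0` implies `∂ z^* = 0`, because `z^*` lies in the module generated by `z`. -/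
theorem delbar_eq_zero_of_del_eq_zero (hconj : S.IsSelfConjugate) (hz0 : S.ι z ≠ 0)
    (hz : IsMaximal S.δ.toLinearMap μ (S.ι z)) (h : S.del (S.ι z) = 0) : S.delbar (S.ι z) = 0 := by
  obtain ⟨x, hx⟩ := orbit_starMap S hconj hz0 hz ▸ mem_orbit S.isCoaction (S.starMap (S.ι z))
  apply S.starMap_injective
  rw [S.starMap_delbar, ← hx, orbit_apply, ← op_del, h, map_zero, map_zero]

/-- On a self-conjugate space with real `λ`, the relation `∂̄z z = ζ z ∂̄z` is inherited by `z^*`,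
and applying the involution to `∂z z = λ z ∂z` gives `z^* ∂̄z^* = λ ∂̄z^* z^*`. -/
theorem commutation_delbar_eq_inv (hconj : S.IsSelfConjugate)
    (hD : ∀ L : List ι, (∀ i, (L.map (D.a i)).sum = 0) → L = []) (hz0 : S.ι z ≠ 0)
    (hz : IsMaximal S.δ.toLinearMap μ (S.ι z)) (hdelbar : S.delbar (S.ι z) ≠ 0) {c d : ℂ}
    (hc : S.del (S.ι z) * S.ι z = c • (S.ι z * S.del (S.ι z)))
    (hd : S.delbar (S.ι z) * S.ι z = d • (S.ι z * S.delbar (S.ι z))) (hreal : conj c = c) :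
    d = c⁻¹ := by
  have := S.noZeroDivisors
  have hδ := S.isCoaction
  have hy0 : S.starMap (S.ι z) ≠ 0 := fun h =>
    hz0 (S.starMap_injective (h.trans (map_zero _).symm))
  have hdel : S.delbar (S.starMap (S.ι z)) ≠ 0 := by
    rw [← S.starMap_del]
    intro h
    exact hdelbar (delbar_eq_zero_of_del_eq_zero S hconj hz0 hz
      (S.starMap_injective (h.trans (map_zero _).symm)))
  have h1 : twistedCommutator S.delbar d (S.starMap (S.ι z)) (S.starMap (S.ι z)) = 0 :=
    twistedCommutator_lowest hδ (isInvariantForm_innerₛₗ S) hD (op_delbar S.toComplexSpace)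
      (hz.op_F_starMap_eq_zero S) (hz.isWeight_starMap S) hy0 (orbit_starMap S hconj hz0 hz)
      (by rw [twistedCommutator_apply, hd, sub_self])
  rw [twistedCommutator_apply, sub_eq_zero] at h1
  have h2 := congrArg S.starMap hc
  rw [S.starMap_mul_ι, LinearMap.map_smulₛₗ, hreal, S.starMap_ι_mul, S.starMap_del,
    ← S.starMap_ι, h1, smul_smul] at h2
  have h3 : S.starMap (S.ι z) * S.delbar (S.starMap (S.ι z)) ≠ 0 := by
    rw [S.starMap_ι] at hy0 hdel ⊢
    exact S.ι_mul_ne_zero hdel (ne_zero_of_ι_ne_zero S hy0)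
  have h4 : c * d = 1 := by
    refine smul_left_injective ℂ h3 ?_
    simp only
    rw [one_smul, ← h2]
  exact eq_inv_of_mul_eq_one_right h4

end SelfConjugate

/-- No non-empty sum of simple roots vanishes on all simple coroots, the Cartan matrix being
non-degenerate. -/
theorem eq_nil_of_sum_cartanMatrix {ι R M N : Type*} [Finite ι] [CommRing R] [CharZero R]
    [IsDomain R] [AddCommGroup M] [Module R M] [AddCommGroup N] [Module R N]
    {P : RootPairing ι R M N} [P.IsRootSystem] [P.IsCrystallographic] (b : P.Base)
    [DecidableEq b.support] (L : List b.support)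
    (h : ∀ i, (L.map fun j => b.cartanMatrix j i).sum = 0) : L = [] := by
  have := Fintype.ofFinite b.support
  have hv : (fun j => (L.count j : ℤ)) = 0 := by
    refine (b.cartanMatrix_nondegenerate).separatingLeft.eq_zero_of_vecMul_eq_zero ?_
    ext i
    rw [Pi.zero_apply, ← h i, Finset.sum_list_map_count, Matrix.vecMul, dotProduct]
    simp only [nsmul_eq_mul]
    refine (Finset.sum_subset (Finset.subset_univ _) fun j _ hj => ?_).symm
    rw [List.count_eq_zero_of_not_mem (by simpa using hj)]
    simp
  refine List.eq_nil_iff_forall_not_mem.mpr fun j hj => ?_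
  have := congrFun hv j
  rw [Pi.zero_apply, Nat.cast_eq_zero] at this
  exact List.count_eq_zero.mp this hj

end QuantumGroup

/-! ### The spectrum along a ray -/

/-- The spectrum of the Laplacian along `z ^ l ω`, for the quantised function algebra of any Cartan
datum for which no non-empty sum of simple roots vanishes on all simple coroots. -/
theorem QuantumGroup.spectrum_ray {ι : Type*} [DecidableEq ι] {D : QuantumGroup.CartanDatum ι}
    (hD : ∀ L : List ι, (∀ i, (L.map (D.a i)).sum = 0) → L = []) {q : QuantumGroup.Parameter}
    {H : Type*} [Ring H] [HopfAlgebra ℂ H] [StarRing H] [StarModule ℂ H]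
    {X : CQH.HomogeneousSpace (QuantumGroup.Oq D q) H}
    {Ω : Type*} [Ring Ω] [Algebra ℂ Ω] {n : ℕ}
    (S : CQH.HermitianSpace X Ω n) (hS : S.IsGelfand)
    {k : ℕ} {ω : Ω} (hmem : ω ∈ S.bideg (0, k + 1)) (hclosed : S.delbar ω = 0)
    (hadj : S.delbarAdj ω ≠ 0) (hωhw : QuantumGroup.IsHighestWeight S.δ.toLinearMap ω)
    {z : X.B} (hz : QuantumGroup.IsHighestWeight S.δ.toLinearMap (S.ι z)) :
    (∀ l : ℕ, ∃ μ : ℂ, S.laplacian.HasEigenvector μ (S.ι z ^ l * ω)) ∧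
    (∃! A : ℂ, S.del (S.ι z) * S.hodge ω = A • (S.ι z * S.del (S.hodge ω))) ∧
    (∃! B : ℂ, S.delbar (S.ι z) * S.delbarAdj ω = B • (S.ι z * S.delbar (S.delbarAdj ω))) ∧
    (S.del (S.ι z) ≠ 0 →
      ∃ c : ℂ, c ≠ 0 ∧ ∀ c' : ℂ, S.del (S.ι z) * S.ι z = c' • (S.ι z * S.del (S.ι z)) ↔ c' = c) ∧
    (S.delbar (S.ι z) ≠ 0 →
      ∃ c : ℂ, c ≠ 0 ∧
        ∀ c' : ℂ, S.delbar (S.ι z) * S.ι z = c' • (S.ι z * S.delbar (S.ι z)) ↔ c' = c) ∧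
    ∀ A B lam ζ μ : ℂ,
      S.del (S.ι z) * S.hodge ω = A • (S.ι z * S.del (S.hodge ω)) →
      S.delbar (S.ι z) * S.delbarAdj ω = B • (S.ι z * S.delbar (S.delbarAdj ω)) →
      S.del (S.ι z) * S.ι z = lam • (S.ι z * S.del (S.ι z)) →
      S.delbar (S.ι z) * S.ι z = ζ • (S.ι z * S.delbar (S.ι z)) →
      S.laplacian ω = μ • ω →
      (¬ (lam = -1 ∧ ζ = -1) → ∀ l : ℕ,
        S.laplacian (S.ι z ^ l * ω) =
          ((A * QuantumGroup.quantumInt l lam + 1) * (B * QuantumGroup.quantumInt l ζ + 1) * μ) •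
            (S.ι z ^ l * ω)) ∧
      (S.IsSelfConjugate → (∃ r : ℝ, lam = r) → lam ≠ -1 →
        (S.delbar (S.ι z) ≠ 0 → ζ = lam⁻¹) ∧
        ∀ l : ℕ, S.laplacian (S.ι z ^ l * ω) =
          ((A * QuantumGroup.quantumInt l lam + 1) * (B * QuantumGroup.quantumInt l lam⁻¹ + 1) *
            μ) • (S.ι z ^ l * ω)) := by
  have hδ := S.isCoaction
  have hlap : S.delbar (S.delbarAdj ω) ≠ 0 := fun h =>
    hadj (S.delbarAdj_eq_zero_of_delbar_delbarAdj h)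
  obtain ⟨hωE, wt, hωK⟩ := hωhw.exists_weight hδ
  obtain ⟨hzE, wt', hzK⟩ := hz.exists_weight hδ
  have hω' : QuantumGroup.IsMaximal S.δ.toLinearMap wt ω := ⟨hωE, hωK⟩
  have hz' : QuantumGroup.IsMaximal S.δ.toLinearMap wt' (S.ι z) := ⟨hzE, hzK⟩
  have hz0 := hz.ne_zero
  have hz0' := QuantumGroup.ne_zero_of_ι_ne_zero S hz0
  refine ⟨fun l => QuantumGroup.exists_hasEigenvector S hS (hz'.pow_mul hδ hω' l)
      (S.ι_pow_mul_mem z hmem l) (S.ι_pow_mul_ne_zero hωhw.ne_zero hz0' l),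
    QuantumGroup.existsUnique_smul (QuantumGroup.ι_mul_del_hodge_ne_zero S hz0 hadj)
      (QuantumGroup.exists_del_mul_hodge S hS hz0 hz' hω' hmem hadj),
    QuantumGroup.existsUnique_smul (S.ι_mul_ne_zero hlap hz0')
      (QuantumGroup.exists_delbar_mul_delbarAdj S hS hz0 hz' hω' hmem hlap),
    QuantumGroup.exists_commutation_del S hS hz0 hz',
    QuantumGroup.exists_commutation_delbar S hS hz0 hz', ?_⟩
  intro A B lam ζ μ hA hB hlam hζ hμ
  refine ⟨fun hne l => QuantumGroup.laplacian_pow_mul S hclosed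
    (QuantumGroup.delbar_mul_eq_zero S hS hz0 hz' hω' hmem hadj hclosed hA hlam hζ hne)
    hA hB hlam hζ hμ l, ?_⟩
  rintro hconj ⟨r, rfl⟩ hr
  have hinv : S.delbar (S.ι z) ≠ 0 → ζ = (r : ℂ)⁻¹ := fun h =>
    QuantumGroup.commutation_delbar_eq_inv S hconj hD hz0 hz' h hlam hζ (Complex.conj_ofReal r)
  -- if `∂̄z = 0`, then every scalar may serve as `ζ`
  have hζ' : S.delbar (S.ι z) * S.ι z = (r : ℂ)⁻¹ • (S.ι z * S.delbar (S.ι z)) := by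
    by_cases h : S.delbar (S.ι z) = 0
    · rw [h, zero_mul, mul_zero, smul_zero]
    · rw [← hinv h, hζ]
  exact ⟨hinv, QuantumGroup.laplacian_pow_mul S hclosed
    (QuantumGroup.delbar_mul_eq_zero S hS hz0 hz' hω' hmem hadj hclosed hA hlam hζ'
      fun h => hr h.1) hA hB hlam hζ' hμ⟩

theorem mainTheorem5 {𝔤 : Type*} [LieRing 𝔤] [LieAlgebra ℂ 𝔤] [FiniteDimensional ℂ 𝔤]
    [LieAlgebra.IsSimple ℂ 𝔤] (𝔥 : LieSubalgebra ℂ 𝔤) [𝔥.IsCartanSubalgebra]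
    (b : (LieAlgebra.IsKilling.rootSystem 𝔥).Base) [DecidableEq b.support]
    (D : QuantumGroup.CartanDatum b.support) (hDa : ∀ i j, D.a i j = b.cartanMatrix j i)
    (hDd : ∃ i, D.d i = 1) (q : QuantumGroup.Parameter)
    {H : Type*} [Ring H] [HopfAlgebra ℂ H] [StarRing H] [StarModule ℂ H]
    (X : CQH.HomogeneousSpace (QuantumGroup.Oq D q) H)
    {Ω : Type*} [Ring Ω] [Algebra ℂ Ω] {n : ℕ}
    (S : CQH.HermitianSpace X Ω n) (hS : S.IsGelfand)
    (k : ℕ) (ω : Ω) (hω : ∃ ν ∈ S.bideg (0, k), S.delbar ν = ω)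
    (hωhw : QuantumGroup.IsHighestWeight S.δ.toLinearMap ω)
    (z : X.B) (hz : QuantumGroup.IsHighestWeight S.δ.toLinearMap (S.ι z)) :
    (∀ l : ℕ, ∃ μ : ℂ, S.laplacian.HasEigenvector μ (S.ι z ^ l * ω)) ∧
    (∃! A : ℂ, S.del (S.ι z) * S.hodge ω = A • (S.ι z * S.del (S.hodge ω))) ∧
    (∃! B : ℂ, S.delbar (S.ι z) * S.delbarAdj ω = B • (S.ι z * S.delbar (S.delbarAdj ω))) ∧
    (S.del (S.ι z) ≠ 0 →
      ∃ c : ℂ, c ≠ 0 ∧ ∀ c' : ℂ, S.del (S.ι z) * S.ι z = c' • (S.ι z * S.del (S.ι z)) ↔ c' = c) ∧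
    (S.delbar (S.ι z) ≠ 0 →
      ∃ c : ℂ, c ≠ 0 ∧
        ∀ c' : ℂ, S.delbar (S.ι z) * S.ι z = c' • (S.ι z * S.delbar (S.ι z)) ↔ c' = c) ∧
    ∀ A B lam ζ μ : ℂ,
      S.del (S.ι z) * S.hodge ω = A • (S.ι z * S.del (S.hodge ω)) →
      S.delbar (S.ι z) * S.delbarAdj ω = B • (S.ι z * S.delbar (S.delbarAdj ω)) →
      S.del (S.ι z) * S.ι z = lam • (S.ι z * S.del (S.ι z)) →
      S.delbar (S.ι z) * S.ι z = ζ • (S.ι z * S.delbar (S.ι z)) →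
      S.laplacian ω = μ • ω →
      (¬ (lam = -1 ∧ ζ = -1) → ∀ l : ℕ,
        S.laplacian (S.ι z ^ l * ω) =
          ((A * QuantumGroup.quantumInt l lam + 1) * (B * QuantumGroup.quantumInt l ζ + 1) * μ) •
            (S.ι z ^ l * ω)) ∧
      (S.IsSelfConjugate → (∃ r : ℝ, lam = r) → lam ≠ -1 →
        (S.delbar (S.ι z) ≠ 0 → ζ = lam⁻¹) ∧
        ∀ l : ℕ, S.laplacian (S.ι z ^ l * ω) =
          ((A * QuantumGroup.quantumInt l lam + 1) * (B * QuantumGroup.quantumInt l lam⁻¹ + 1) *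
            μ) • (S.ι z ^ l * ω)) := by
  obtain ⟨ν, hν, rfl⟩ := hω
  have hD : ∀ L : List b.support, (∀ i, (L.map (D.a i)).sum = 0) → L = [] := fun L hL =>
    QuantumGroup.eq_nil_of_sum_cartanMatrix b L fun i => by simpa only [← hDa] using hL i
  exact QuantumGroup.spectrum_ray hD S hS (S.delbar_mem hν) (S.delbar_delbar ν)
    (S.delbarAdj_ne_zero hωhw.ne_zero) hωhw hz
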